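/- Let $n,m\ge 1$. Functions are real- or complex-valued, $Q$ denotes a cube in $\mathbb R^n$ with sides parallel to the axes, and $g_Q=\frac1{|Q|}\int_Q g$. Let $T$ be a bounded $m$-linear Calderón–Zygmund operator on $\mathbb R^n$. That is, $T$ is $m$-linear, it is bounded $L^{p_1}\times\dots\times L^{p_m}\to L^{p}$ whenever $1<p_1,\dots,p_m<\infty$ and $\frac1p=\frac1{p_1}+\dots+\frac1{p_m}$, it is bounded $L^1\times\dots\times L^1\to L^{1/m,\infty}$, and there are constants $A$ and $\varepsilon>0$ and a kernel $K(y_0,y_1,\dots,y_m)$ satisfying, away from the diagonal $y_0=y_1=\dots=y_m$, $$|K(y_0,\dots,y_m)|\le \frac{A}{\bigl(\sum_{k,l=0}^m|y_k-y_l|\bigr)^{mn}},$$ $$|K(y_0,\dots,y_j,\dots,y_m)-K(y_0,\dots,y_j',\dots,y_m)|\le \frac{A|y_j-y_j'|^{\varepsilon}}{\bigl(\sum_{k,l=0}^m|y_k-y_l|\bigr)^{mn+\varepsilon}}$$ for all $0\le j\le m$ whenever $|y_j-y_j'|\le\frac12\max_{k}|y_j-y_k|$, such that for all bounded compactly supported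 $f_1,\dots,f_m$ $$T(f_1,\dots,f_m)(x)=\int K(x,y_1,\dots,y_m)f_1(y_1)\cdots f_m(y_m)\,dy_1\cdots dy_m\quad\text{for a.e. } x\notin\bigcap_j\operatorname{supp}f_j .$$ For ${\bf b}=(b_1,\dots,b_m)\in BMO^m$, where $\|b\|_{BMO}=\sup_Q\frac1{|Q|}\int_Q|b-b_Q|$, put $[b,S]_j(f_1,\dots,f_m)=b\,S(f_1,\dots,f_m)-S(f_1,\dots,bf_j,\dots,f_m)$ and define the iterated commutator $$T_{\Pi{\bf b}}=[b_1,[b_2,\dots[b_{m-1},[b_m,T]_m]_{m-1}\dots]_2]_1 .$$ Let $\Phi(t)=t(1+\log^+t)$, let $\Phi^{(m)}=\Phi\circ\dots\circ\Phi$ ($m$ times), and for ${\bf f}=(f_1,\dots,f_m)$ put $$\|f\|_{L\log L,Q}=\inf\Bigl\{\lambda>0:\frac1{|Q|}\int_Q\Phi\Bigl(\frac{|f|}{\lambda}\Bigr)\le1\Bigr\},\qquad \mathcal M_{L\log L}({\bf f})(x)=\sup_{Q\ni x}\prod_{j=1}^m\|f_j\|_{L\log L,Q}.$$ **Theorem 3.2.**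 Let $w$ be a weight in $A_\infty=\bigcup_{1<q<\infty}A_q$, and write $w(E)=\int_E w$. (1) For every $0<p<\infty$ there is a finite constant $C_w$, independent of ${\bf b}$ and ${\bf f}$, such that for all ${\bf b}\in BMO^m$ and all ${\bf f}=(f_1,\dots,f_m)$ bounded with compact support $$\int_{\mathbb R^n}|T_{\Pi{\bf b}}({\bf f})(x)|^p\,w(x)\,dx\le C_w\Bigl(\prod_{j=1}^m\|b_j\|_{BMO}\Bigr)^{p}\int_{\mathbb R^n}\mathcal M_{L\log L}({\bf f})(x)^p\,w(x)\,dx .$$ (The right-hand side is read as $0$ if $\prod_j\|b_j\|_{BMO}=0$.) (2) For every ${\bf b}\in BMO^m$ there is a finite constant $c_w({\bf b})$ such that for all ${\bf f}=(f_1,\dots,f_m)$ bounded with compact support $$\sup_{t>0}\frac{1}{\Phi^{(m)}(1/t)}\,w\bigl(\{y:|T_{\Pi{\bf b}}({\bf f})(y)|>t^m\}\bigr)\le c_w({\bf b})\,\sup_{t>0}\frac{1}{\Phi^{(m)}(1/t)}\,w\bigl(\{y:\mathcal M_{L\log L}({\bf f})(y)>t^m\}\bigr).$$ The constants may also depend on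 $n$, $m$ and $T$. -/

import Mathlib

open MeasureTheory
open scoped ENNReal NNReal

namespace MultiCZ

noncomputable section

/-- Euclidean space `ℝⁿ`, with its Euclidean norm and Lebesgue measure. -/
abbrev Rn (n : ℕ) : Type := EuclideanSpace ℝ (Fin n)

/-- The cube with lower corner `a`, side length `l`, and sides parallel to the axes. -/
def cube {n : ℕ} (a : Rn n) (l : ℝ) : Set (Rn n) :=
  {y | ∀ i, a i ≤ y i ∧ y i ≤ a i + l}

/-! ### BMO -/

/-- `‖b‖_BMO = sup_Q (1/|Q|) ∫_Q |b - b_Q|`, with `b_Q` the average of `b` over `Q`. -/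
def bmoNorm {n : ℕ} {𝕜 : Type*} [RCLike 𝕜] (b : Rn n → 𝕜) : ℝ≥0∞ :=
  ⨆ (a : Rn n) (l : ℝ) (_ : 0 < l),
    ⨍⁻ y in cube a l, ‖b y - ⨍ z in cube a l, b z‖ₑ ∂volume

/-- `b ∈ BMO(ℝⁿ)`. -/
def IsBMO {n : ℕ} {𝕜 : Type*} [RCLike 𝕜] (b : Rn n → 𝕜) : Prop :=
  LocallyIntegrable b ∧ bmoNorm b < ∞

/-! ### Weights -/

/-- `w` is a weight of Muckenhoupt class `A_q`, `1 < q < ∞`: it is locally integrable, positive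
almost everywhere, and `sup_Q (avg_Q w) (avg_Q w^{-1/(q-1)})^{q-1} < ∞`. -/
def IsMuckenhoupt {n : ℕ} (q : ℝ) (w : Rn n → ℝ) : Prop :=
  LocallyIntegrable w ∧ (∀ᵐ x, 0 < w x) ∧
    ∃ C : ℝ≥0, ∀ (a : Rn n) (l : ℝ), 0 < l →
      (⨍⁻ x in cube a l, ENNReal.ofReal (w x) ∂volume) *
        (⨍⁻ x in cube a l, ENNReal.ofReal (w x ^ (-1 / (q - 1))) ∂volume) ^ (q - 1) ≤ C

/-- `A_∞` is the union of the classes `A_q`, `1 < q < ∞`. -/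
def IsAInfty {n : ℕ} (w : Rn n → ℝ) : Prop :=
  ∃ q : ℝ, 1 < q ∧ IsMuckenhoupt q w

/-- The measure `w(x) dx`. -/
def weightMeasure {n : ℕ} (w : Rn n → ℝ) : Measure (Rn n) :=
  volume.withDensity fun x => ENNReal.ofReal (w x)

/-! ### The Young function, Luxemburg averages and the maximal operator -/

/-- `Φ(t) = t (1 + log⁺ t)`. Its `m`-fold composition is `Phi^[m]`. -/
def Phi (t : ℝ) : ℝ := t * (1 + max 0 (Real.log t))

/-- The Luxemburg average
`‖f‖_{L log L, Q} = inf {s > 0 : (1/|Q|) ∫_Q Φ(|f(x)|/s) dx ≤ 1}` over `Q = cube a l`;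
it is `∞` if there is no such `s`. -/
def luxemburg {n : ℕ} {𝕜 : Type*} [RCLike 𝕜] (f : Rn n → 𝕜) (a : Rn n) (l : ℝ) : ℝ≥0∞ :=
  ⨅ (s : ℝ) (_ : 0 < s) (_ : (⨍⁻ x in cube a l, ENNReal.ofReal (Phi (‖f x‖ / s)) ∂volume) ≤ 1),
    ENNReal.ofReal s

/-- `𝓜_{L log L}(f₁, …, f_m)(x) = sup_{Q ∋ x} ∏_j ‖f_j‖_{L log L, Q}`. -/
def maxLLogL {n m : ℕ} {𝕜 : Type*} [RCLike 𝕜] (f : Fin m → Rn n → 𝕜) (x : Rn n) : ℝ≥0∞ :=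
  ⨆ (a : Rn n) (l : ℝ) (_ : 0 < l) (_ : x ∈ cube a l), ∏ j, luxemburg (f j) a l

/-! ### Multilinear Calderón–Zygmund operators

An operator acts on `m`-tuples of functions and returns a function; both are considered up to
almost everywhere equality. Only its values on the products
`L^{p₁} × ⋯ × L^{p_m}` with `1 < p_j < ∞` for all `j`, and on `L¹ × ⋯ × L¹`, carry meaning. -/

/-- The exponents `(p₁, …, p_m)` at which an operator is defined: all `p_j` in `(1, ∞)`, or all
`p_j` equal to `1`. -/
def Admissible {m : ℕ} (P : Fin m → ℝ≥0∞) : Prop :=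
  (∀ j, 1 < P j ∧ P j < ∞) ∨ ∀ j, P j = 1

/-- `f ∈ L^{p₁} × ⋯ × L^{p_m}`. -/
def MemProd {n m : ℕ} {𝕜 : Type*} [RCLike 𝕜] (P : Fin m → ℝ≥0∞) (f : Fin m → Rn n → 𝕜) : Prop :=
  ∀ j, MemLp (f j) (P j) volume

/-- `f` is an `m`-tuple of (essentially) bounded measurable functions with compact support. -/
def BddCompactSupp {n m : ℕ} {𝕜 : Type*} [RCLike 𝕜] (f : Fin m → Rn n → 𝕜) : Prop :=
  ∀ j, MemLp (f j) ∞ volume ∧ HasCompactSupport (f j)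

/-- A multilinear Calderón–Zygmund kernel `K(y₀, y₁, …, y_m)` with constants `A` and `ε`: the size
and smoothness conditions away from the diagonal `y₀ = y₁ = ⋯ = y_m`. -/
structure IsCZKernel {n m : ℕ} {𝕜 : Type*} [RCLike 𝕜] (A ε : ℝ)
    (K : (Fin (m + 1) → Rn n) → 𝕜) : Prop where
  size : ∀ y : Fin (m + 1) → Rn n, (∃ k l, y k ≠ y l) →
    ‖K y‖ ≤ A / (∑ k, ∑ l, ‖y k - y l‖) ^ (m * n)
  /-- The condition `∃ k, …` says `|y_j - y_j'| ≤ (1/2) max_k |y_j - y_k|`. -/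
  smooth : ∀ (y : Fin (m + 1) → Rn n) (j : Fin (m + 1)) (z : Rn n), (∃ k l, y k ≠ y l) →
    (∃ k, ‖y j - z‖ ≤ 1 / 2 * ‖y j - y k‖) →
    ‖K y - K (Function.update y j z)‖ ≤
      A * ‖y j - z‖ ^ ε / (∑ k, ∑ l, ‖y k - y l‖) ^ ((m : ℝ) * n + ε)

/-- `T` is a bounded `m`-linear Calderón–Zygmund operator on `ℝⁿ`. -/
structure IsCZOperator {n m : ℕ} {𝕜 : Type*} [RCLike 𝕜]
    (T : (Fin m → Rn n → 𝕜) → Rn n → 𝕜) : Prop where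
  /-- `T f` is measurable. -/
  measurable : ∀ P, Admissible P → ∀ f, MemProd P f → AEStronglyMeasurable (T f) volume
  /-- `T` is well defined on classes of functions modulo null sets. -/
  congr_ae : ∀ P, Admissible P → ∀ f g, MemProd P f → (∀ j, f j =ᵐ[volume] g j) →
    T f =ᵐ[volume] T g
  /-- Additivity in each entry. -/
  map_add : ∀ P, Admissible P → ∀ f, MemProd P f → ∀ j g, MemLp g (P j) volume →
    T (Function.update f j (f j + g)) =ᵐ[volume] T f + T (Function.update f j g)
  /-- Homogeneity in each entry. -/
  map_smul : ∀ P, Admissible P → ∀ f, MemProd P f → ∀ (j : Fin m) (c : 𝕜),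
    T (Function.update f j (c • f j)) =ᵐ[volume] c • T f
  /-- `T : L^{p₁} × ⋯ × L^{p_m} → L^p` for `1 < p_j < ∞` and `1/p = 1/p₁ + ⋯ + 1/p_m`. -/
  strong : ∀ P : Fin m → ℝ≥0∞, (∀ j, 1 < P j ∧ P j < ∞) → ∃ C : ℝ≥0, ∀ f, MemProd P f →
    eLpNorm (T f) (∑ j, (P j)⁻¹)⁻¹ volume ≤ C * ∏ j, eLpNorm (f j) (P j) volume
  /-- `T : L¹ × ⋯ × L¹ → L^{1/m,∞}`. -/
  weak : ∃ C : ℝ≥0, ∀ f, MemProd (fun _ => 1) f → ∀ t : ℝ, 0 < t →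
    ENNReal.ofReal t * volume {x | t < ‖T f x‖} ^ m ≤ C * ∏ j, eLpNorm (f j) 1 volume
  /-- `T` is represented by a Calderón–Zygmund kernel off the common support of its entries. -/
  kernel : ∃ (A ε : ℝ) (K : (Fin (m + 1) → Rn n) → 𝕜), 0 < ε ∧ IsCZKernel A ε K ∧
    ∀ f, BddCompactSupp f → ∀ᵐ x, x ∉ ⋂ j, tsupport (f j) →
      T f x = ∫ y : Fin m → Rn n, K (Fin.cons x y) * ∏ j, f j (y j)

/-! ### Commutators -/

/-- The commutator in the `j`-th entry,
`[b, S]_j(f) = b S(f₁, …, f_m) - S(f₁, …, b f_j, …, f_m)`. -/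
def entryCommutator {n m : ℕ} {𝕜 : Type*} [RCLike 𝕜] (b : Rn n → 𝕜) (j : Fin m)
    (S : (Fin m → Rn n → 𝕜) → Rn n → 𝕜) : (Fin m → Rn n → 𝕜) → Rn n → 𝕜 :=
  fun f x => b x * S f x - S (Function.update f j (b * f j)) x

/-- The iterated commutator `T_{Πb} = [b₁, [b₂, … [b_{m-1}, [b_m, T]_m]_{m-1} … ]_2]_1`. -/
def iteratedCommutator {n m : ℕ} {𝕜 : Type*} [RCLike 𝕜] (b : Fin m → Rn n → 𝕜)
    (T : (Fin m → Rn n → 𝕜) → Rn n → 𝕜) : (Fin m → Rn n → 𝕜) → Rn n → 𝕜 :=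
  (List.finRange m).foldr (fun j S => entryCommutator (b j) j S) T

end

end MultiCZ

open MultiCZ

/-! The proof is a stopping-time argument in the spirit of sparse domination. It compares
distribution functions directly, so no good-lambda inequality and no sharp maximal function is
needed.

Fix a cube containing the supports, subdivide it dyadically, and let `Q*` be the dilate of a dyadic
box `Q`. The iterated commutator is unchanged when constants are subtracted from the symbols, so on
`Q` each `b j` may be replaced by `b j` minus its mean over `Q*`. Expanding the commutator leaves
finitely many terms: a product of symbols at `x` times `T` applied to a tuple some of whose entries
carry a symbol. Exponential integrability of BMO functions and the pairing of `exp L` with `L log L`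
bound the `L¹` averages of these entries over `Q*` by `‖b j‖_BMO ‖f j‖_{L log L, Q*}`.

The weak `L¹ × ⋯ × L¹` bound, the weak bound for the maximal function over balls, and kernel
smoothness then give a small exceptional set in each box (`exists_exceptional_set`,
`exists_commutator_exceptional_set`). Off it the terms of the expansion are bounded. On a subbox `P`
that it does not fill, replacing `f 1_{Q*}` by `f 1_{P*}` changes `T` by a bounded amount. A
Calderón-Zygmund selection (`exists_stopping_children`) covers the part of the exceptional set in
`Q` by disjoint subboxes that occupy at most half of `Q` and are at most half filled. Iteration
produces a tree of boxes. By `A_∞` the children of a box carry at most a fraction `θ < 1` of its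
weight.

Along the tree the symbols drift linearly: at a point `s` generations below `Q` they differ from
their means over `Q*` by at most a multiple of `s + 1`. Hence passing from `Q` to a child costs at
most a constant times `a_Q = ∏ ‖b j‖_BMO ∏ ‖f j‖_{L log L, Q*}` times a power of order `m` of the
number of generations still to come. This factor grows with the height above the final box, while
the weight of points at height `s` decays like `θ ^ s`. `StoppingTree.measure_lt_le` turns this
competition into a bound of `w{|T_{Πb} f| > 2Kr}` by `∑ θ^s w{sup a_Q > r / (s+1)^(m+2)}`.

Both parts follow from this one estimate, because `θ ^ s` beats every power of `s + 1`: part (1) by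
integrating over `r`, part (2) by the at most polynomial growth of `Phi^[m]` under dilations. The
same tree, with Lebesgue measure, gives the John-Nirenberg inequality used above. -/

namespace MultiCZ

open Set
open scoped Topology

/-! ### Abstract stopping trees and their distributional estimate -/

section

/-- A family of measurable sets in which every set has a prescribed family of pairwise disjoint
children contained in it. -/
structure StoppingTree (ι X : Type*) [MeasurableSpace X] where
  box : ι → Set X
  child : ι → Set ι
  measurableSet_box : ∀ Q, MeasurableSet (box Q)
  box_subset : ∀ Q, ∀ P ∈ child Q, box P ⊆ box Q
  pairwiseDisjoint : ∀ Q, (child Q).PairwiseDisjoint box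

namespace StoppingTree

variable {ι X : Type*} [MeasurableSpace X] (t : StoppingTree ι X)

/-- The union of the descendants of `Q` in generation `s`. -/
def descend : ℕ → ι → Set X
  | 0, Q => t.box Q
  | s + 1, Q => ⋃ P ∈ t.child Q, descend s P

/-- The points of `Q` which lie in a descendant of generation `s`, but in no later one. -/
def leaves : ℕ → ι → Set X
  | 0, Q => t.box Q \ ⋃ P ∈ t.child Q, t.box P
  | s + 1, Q => ⋃ P ∈ t.child Q, leaves s P

/-- The points of `Q` lying in a generation-`s` descendant of the first cube with `c < a` on the
way down from `Q`, when this cube is found within `d` steps. -/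
def deepAfterLarge (a : ι → ℝ) (c : ℝ) (s : ℕ) : ℕ → ι → Set X
  | 0, _ => ∅
  | d + 1, Q => {x | c < a Q ∧ x ∈ t.descend s Q} ∪
      {x | a Q ≤ c ∧ x ∈ ⋃ P ∈ t.child Q, deepAfterLarge a c s d P}

theorem descend_subset_box (s : ℕ) (Q : ι) : t.descend s Q ⊆ t.box Q := by
  induction s generalizing Q with
  | zero => exact subset_rfl
  | succ s ih => exact iUnion₂_subset fun P hP => (ih P).trans (t.box_subset Q P hP)

theorem leaves_subset_descend (s : ℕ) (Q : ι) : t.leaves s Q ⊆ t.descend s Q := by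
  induction s generalizing Q with
  | zero => exact sdiff_subset
  | succ s ih => exact iUnion₂_mono fun P _ => ih P

theorem leaves_subset_box (s : ℕ) (Q : ι) : t.leaves s Q ⊆ t.box Q :=
  (t.leaves_subset_descend s Q).trans (t.descend_subset_box s Q)

theorem mem_descend_of_forall_notMem_leaves {x : X} (s : ℕ) (Q : ι) (hx : x ∈ t.box Q)
    (h : ∀ r < s, x ∉ t.leaves r Q) : x ∈ t.descend s Q := by
  induction s generalizing Q with
  | zero => exact hx
  | succ s ih =>
    have h0 := h 0 s.succ_pos
    simp only [leaves, mem_sdiff, not_and, not_not] at h0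
    obtain ⟨P, hP, hxP⟩ := mem_iUnion₂.1 (h0 hx)
    exact mem_iUnion₂.2 ⟨P, hP, ih P hxP fun r hr hmem =>
      h (r + 1) (by omega) (mem_iUnion₂.2 ⟨P, hP, hmem⟩)⟩

theorem deepAfterLarge_mono (a : ι → ℝ) (c : ℝ) (s d : ℕ) (Q : ι) :
    t.deepAfterLarge a c s d Q ⊆ t.deepAfterLarge a c s (d + 1) Q := by
  induction d generalizing Q with
  | zero => exact empty_subset _
  | succ d ih =>
    rintro x (hx | ⟨ha, hx⟩)
    · exact Or.inl hx
    · exact Or.inr ⟨ha, (iUnion₂_mono fun P _ => ih P) hx⟩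

section Measure

variable [Countable ι] {μ : Measure X} {θ : ℝ≥0∞}

/-- Each generation loses a factor `θ`: the children are disjoint, so the bounds for their
descendants add up to the measure of their union. -/
theorem measure_descend_le (hθ : ∀ Q, μ (⋃ P ∈ t.child Q, t.box P) ≤ θ * μ (t.box Q))
    (s : ℕ) (Q : ι) : μ (t.descend s Q) ≤ θ ^ s * μ (t.box Q) := by
  induction s generalizing Q with
  | zero => simp [descend]
  | succ s ih =>
    calc μ (⋃ P ∈ t.child Q, t.descend s P)
        ≤ ∑' P : t.child Q, μ (t.descend s P) := measure_biUnion_le μ (to_countable _) _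
      _ ≤ ∑' P : t.child Q, θ ^ s * μ (t.box P) := ENNReal.tsum_le_tsum fun P => ih P
      _ = θ ^ s * μ (⋃ P ∈ t.child Q, t.box P) := by
        rw [ENNReal.tsum_mul_left, measure_biUnion (to_countable _) (t.pairwiseDisjoint Q)
          fun P _ => t.measurableSet_box P]
      _ ≤ θ ^ s * (θ * μ (t.box Q)) := by gcongr; exact hθ Q
      _ = θ ^ (s + 1) * μ (t.box Q) := by ring

/-- A point that is never a leaf lies in every generation of descendants, and those have measure
tending to zero. This makes induction on the height above the final box possible almost everywhere.
-/
theorem ae_mem_leaves (hθ : ∀ Q, μ (⋃ P ∈ t.child Q, t.box P) ≤ θ * μ (t.box Q)) (hθ1 : θ < 1)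
    (hfin : ∀ Q, μ (t.box Q) ≠ ∞) : ∀ᵐ x ∂μ, ∀ Q, x ∈ t.box Q → ∃ s, x ∈ t.leaves s Q := by
  rw [ae_all_iff]
  intro Q
  have hz : μ (⋂ s, t.descend s Q) = 0 := by
    have hlim : Filter.Tendsto (fun s : ℕ => θ ^ s * μ (t.box Q)) Filter.atTop (nhds 0) := by
      simpa using ENNReal.Tendsto.mul_const (ENNReal.tendsto_pow_atTop_nhds_zero_of_lt_one hθ1)
        (Or.inr (hfin Q))
    refine le_antisymm (ge_of_tendsto' hlim fun s => ?_) zero_le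
    exact (measure_mono (iInter_subset _ s)).trans (t.measure_descend_le hθ s Q)
  refine measure_mono_null ?_ hz
  intro x hx
  simp only [mem_compl_iff, mem_ofPred_eq, not_forall, not_exists] at hx
  exact mem_iInter.2 fun s => t.mem_descend_of_forall_notMem_leaves s Q hx.1 fun r _ => hx.2 r

/-- At the first box with `c < a` the whole box lies in the set on the right, and `s` further
generations cost `θ ^ s`. Above that box the estimate is summed over disjoint children. Stopping at
the first large box avoids counting nested ones repeatedly. -/
theorem measure_deepAfterLarge_le
    (hθ : ∀ Q, μ (⋃ P ∈ t.child Q, t.box P) ≤ θ * μ (t.box Q)) (a : ι → ℝ) (c : ℝ) (s d : ℕ)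
    (Q : ι) : μ (t.deepAfterLarge a c s d Q) ≤
      θ ^ s * μ (t.box Q ∩ {x | ∃ P, x ∈ t.box P ∧ c < a P}) := by
  have hM : MeasurableSet {x | ∃ P, x ∈ t.box P ∧ c < a P} := by
    have : {x | ∃ P, x ∈ t.box P ∧ c < a P} = ⋃ P ∈ {P | c < a P}, t.box P := by
      ext x; simp [and_comm]
    rw [this]
    exact MeasurableSet.biUnion (to_countable _) fun P _ => t.measurableSet_box P
  induction d generalizing Q with
  | zero => simp [deepAfterLarge]
  | succ d ih =>
    by_cases hc : c < a Q
    · have h1 : t.deepAfterLarge a c s (d + 1) Q ⊆ t.descend s Q := by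
        rintro x (⟨_, hx⟩ | ⟨h, _⟩)
        · exact hx
        · exact absurd hc h.not_gt
      refine (measure_mono h1).trans ((t.measure_descend_le hθ s Q).trans ?_)
      gcongr
      exact fun x hx => ⟨hx, Q, hx, hc⟩
    · have h1 : t.deepAfterLarge a c s (d + 1) Q ⊆
          ⋃ P ∈ t.child Q, t.deepAfterLarge a c s d P := by
        rintro x (⟨h, _⟩ | ⟨_, hx⟩)
        · exact absurd h hc
        · exact hx
      calc μ (t.deepAfterLarge a c s (d + 1) Q)
          ≤ μ (⋃ P ∈ t.child Q, t.deepAfterLarge a c s d P) := measure_mono h1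
        _ ≤ ∑' P : t.child Q, μ (t.deepAfterLarge a c s d P) :=
          measure_biUnion_le μ (to_countable _) _
        _ ≤ ∑' P : t.child Q, θ ^ s * μ (t.box P ∩ {x | ∃ P, x ∈ t.box P ∧ c < a P}) :=
          ENNReal.tsum_le_tsum fun P => ih P
        _ = θ ^ s * μ (⋃ P ∈ t.child Q, (t.box P ∩ {x | ∃ P, x ∈ t.box P ∧ c < a P})) := by
          rw [ENNReal.tsum_mul_left, measure_biUnion (to_countable _)
            ((t.pairwiseDisjoint Q).mono fun _ => inter_subset_left)
            fun P _ => (t.measurableSet_box P).inter hM]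
        _ ≤ _ := by
          gcongr
          exact iUnion₂_subset fun P hP => inter_subset_inter_left _ (t.box_subset Q P hP)

/-- If along the tree `F` grows by at most `K * a * (depth + 1) ^ m` in every step, then the
distribution function of `F` is controlled by that of `sup_Q a_Q 1_Q`. -/
theorem measure_lt_le (hθ : ∀ Q, μ (⋃ P ∈ t.child Q, t.box P) ≤ θ * μ (t.box Q)) (hθ1 : θ < 1)
    (hfin : ∀ Q, μ (t.box Q) ≠ ∞) {a : ι → ℝ} {F : ι → X → ℝ} {K : ℝ} (hK : 0 ≤ K) (m : ℕ)
    (h0 : ∀ᵐ x ∂μ, ∀ Q, x ∈ t.leaves 0 Q → F Q x ≤ K * a Q)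
    (h1 : ∀ᵐ x ∂μ, ∀ Q, ∀ P ∈ t.child Q, ∀ s, x ∈ t.leaves s P →
      F Q x ≤ F P x + K * a Q * ((s : ℝ) + 2) ^ m) {l : ℝ} (hl : 0 ≤ l) (Q : ι) :
    μ (t.box Q ∩ {x | 2 * K * l < F Q x}) ≤
      ∑' s : ℕ, θ ^ s * μ (t.box Q ∩
        {x | ∃ P, x ∈ t.box P ∧ (((s : ℝ) + 1) ^ (m + 2))⁻¹ * l < a P}) := by
  -- The threshold depends on the height `s` above the final box. Of the exponent `m + 2`, `m`
  -- absorbs the growth of the cost of one step and `2` leaves a summable series.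
  set g : ℕ → ℝ := fun s => (((s : ℝ) + 1) ^ (m + 2))⁻¹ * l with hg
  have ganti : ∀ s r : ℕ, s ≤ r → g r ≤ g s := by
    intro s r h
    simp only [hg]
    gcongr
  -- Induction on the height `s`. Outside the sets `deepAfterLarge` the costs of the steps sum to at
  -- most `2 * K * l`; the term `-1 / (s + 1)` is the slack that makes the sum telescope.
  have key : ∀ x, (∀ Q, x ∈ t.leaves 0 Q → F Q x ≤ K * a Q) →
      (∀ Q, ∀ P ∈ t.child Q, ∀ s, x ∈ t.leaves s P →
        F Q x ≤ F P x + K * a Q * ((s : ℝ) + 2) ^ m) →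
      ∀ s Q, x ∈ t.leaves s Q → (∀ r ≤ s, ∀ d, x ∉ t.deepAfterLarge a (g r) r d Q) →
      F Q x ≤ K * l * (2 - 1 / ((s : ℝ) + 1)) := by
    intro x hx0 hx1 s
    induction s with
    | zero =>
      intro Q hQ hd
      have haQ : a Q ≤ g 0 := by
        by_contra! h
        exact hd 0 le_rfl 1 (Or.inl ⟨h, t.leaves_subset_descend 0 Q hQ⟩)
      have : g 0 = l := by simp [hg]
      rw [this] at haQ
      refine (hx0 Q hQ).trans ?_
      norm_num
      gcongr
    | succ s ih =>
      intro Q hQ hd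
      -- Otherwise `Q` itself is the first large box, and `x` lies `s + 1` generations below it.
      have haQ : a Q ≤ g (s + 1) := by
        by_contra! h
        exact hd (s + 1) le_rfl 1 (Or.inl ⟨h, t.leaves_subset_descend _ Q hQ⟩)
      obtain ⟨P, hP, hxP⟩ := mem_iUnion₂.1 hQ
      -- The exclusions pass to the child: `a Q` lies below every threshold `g r` with `r ≤ s`, so
      -- the search for the first large box goes on below `Q`.
      have hrec := ih P hxP fun r hr d hmem => hd r (hr.trans (Nat.le_succ s)) (d + 1)
        (Or.inr ⟨haQ.trans (ganti _ _ (hr.trans (Nat.le_succ s))), mem_iUnion₂.2 ⟨P, hP, hmem⟩⟩)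
      have h2 := hx1 Q P hP s hxP
      have h3 : K * a Q * ((s : ℝ) + 2) ^ m ≤ K * l * (1 / ((s : ℝ) + 2) ^ 2) := by
        calc K * a Q * ((s : ℝ) + 2) ^ m ≤ K * g (s + 1) * ((s : ℝ) + 2) ^ m := by gcongr
          _ = K * l * (1 / ((s : ℝ) + 2) ^ 2) := by
            have : (s : ℝ) + 2 ≠ 0 := by positivity
            simp only [hg, Nat.cast_add, Nat.cast_one]
            rw [show (s : ℝ) + 1 + 1 = s + 2 by ring, pow_add]
            field_simp
      have h4 : (2 - 1 / ((s : ℝ) + 1)) + 1 / ((s : ℝ) + 2) ^ 2 ≤ 2 - 1 / (((s + 1 : ℕ) : ℝ) + 1) := by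
        push_cast
        rw [show (s : ℝ) + 1 + 1 = s + 2 by ring]
        have : 1 / ((s : ℝ) + 1) - 1 / ((s : ℝ) + 2) - 1 / ((s : ℝ) + 2) ^ 2 =
            1 / (((s : ℝ) + 1) * ((s : ℝ) + 2) ^ 2) := by
          field_simp
          ring
        have h5 : 0 ≤ 1 / (((s : ℝ) + 1) * ((s : ℝ) + 2) ^ 2) := by positivity
        linarith
      have h6 := mul_le_mul_of_nonneg_left h4 (mul_nonneg hK hl)
      linarith
  have hsub : ∀ᵐ x ∂μ, x ∈ t.box Q ∩ {x | 2 * K * l < F Q x} →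
      x ∈ ⋃ s : ℕ, ⋃ d : ℕ, t.deepAfterLarge a (g s) s d Q := by
    filter_upwards [h0, h1, t.ae_mem_leaves hθ hθ1 hfin] with x hx0 hx1 hx2 hx
    by_contra hcon
    simp only [mem_iUnion, not_exists] at hcon
    obtain ⟨s, hs⟩ := hx2 Q hx.1
    have h3 := key x hx0 hx1 s Q hs fun r _ d => hcon r d
    have h4 : 0 ≤ K * l * (1 / ((s : ℝ) + 1)) := by positivity
    have h5 := hx.2
    simp only [mem_ofPred_eq] at h5
    nlinarith
  calc μ (t.box Q ∩ {x | 2 * K * l < F Q x})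
      ≤ μ (⋃ s : ℕ, ⋃ d : ℕ, t.deepAfterLarge a (g s) s d Q) := measure_mono_ae hsub
    _ ≤ ∑' s : ℕ, μ (⋃ d : ℕ, t.deepAfterLarge a (g s) s d Q) := measure_iUnion_le _
    _ ≤ _ := by
      refine ENNReal.tsum_le_tsum fun s => ?_
      rw [(monotone_nat_of_le_succ fun d => t.deepAfterLarge_mono a (g s) s d Q).measure_iUnion]
      exact iSup_le fun d => t.measure_deepAfterLarge_le hθ a (g s) s d Q

end Measure

end StoppingTree

end

/-! ### Cubes, dyadic boxes and the selection of stopping children -/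

section

variable {n : ℕ}

theorem norm_le_of_forall_abs_le {x : Rn n} {c : ℝ} (h : ∀ i, |x i| ≤ c) : ‖x‖ ≤ n * c := by
  rcases Nat.eq_zero_or_pos n with rfl | hn
  · have : x = 0 := Subsingleton.elim _ _
    simp [this]
  have hc : 0 ≤ c := (abs_nonneg _).trans (h ⟨0, hn⟩)
  have h1 : (1 : ℝ) ≤ n := by exact_mod_cast hn
  rw [EuclideanSpace.norm_eq]
  refine Real.sqrt_le_iff.2 ⟨by positivity, ?_⟩
  calc ∑ i, ‖x i‖ ^ 2 ≤ ∑ _i : Fin n, c ^ 2 := by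
        gcongr with i
        exact h i
    _ = n * c ^ 2 := by simp
    _ ≤ n * (n * c ^ 2) := le_mul_of_one_le_left (by positivity) h1
    _ = (n * c) ^ 2 := by ring

theorem abs_apply_le_norm (x : Rn n) (i : Fin n) : |x i| ≤ ‖x‖ :=
  PiLp.norm_apply_le x i

theorem cube_eq_preimage (a : Rn n) (l : ℝ) :
    cube a l = (MeasurableEquiv.toLp 2 (Fin n → ℝ)).symm ⁻¹' (univ.pi fun i => Icc (a i) (a i + l)) := by
  ext x
  simp [cube, forall_and, Pi.le_def]

theorem measurableSet_cube (a : Rn n) (l : ℝ) : MeasurableSet (cube a l) := by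
  rw [cube_eq_preimage]
  exact (MeasurableEquiv.toLp 2 (Fin n → ℝ)).symm.measurable
    (MeasurableSet.univ_pi fun i => measurableSet_Icc)

theorem volume_cube (a : Rn n) (l : ℝ) : volume (cube a l) = ENNReal.ofReal l ^ n := by
  rw [cube_eq_preimage, (EuclideanSpace.volume_preserving_symm_measurableEquiv_toLp (Fin n)).measure_preimage
    (MeasurableSet.univ_pi fun i => measurableSet_Icc).nullMeasurableSet, Set.pi_univ_Icc,
    Real.volume_Icc_pi]
  simp

theorem isCompact_cube (a : Rn n) (l : ℝ) : IsCompact (cube a l) := by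
  have : cube a l = (EuclideanSpace.equiv (Fin n) ℝ).symm '' (univ.pi fun i => Icc (a i) (a i + l)) := by
    rw [cube_eq_preimage, ContinuousLinearEquiv.image_symm_eq_preimage]
    rfl
  rw [this]
  exact (isCompact_univ_pi fun i => isCompact_Icc).image
    (EuclideanSpace.equiv (Fin n) ℝ).symm.continuous

/-- The dyadic subdivision of the cube with lower corner `o` and side length `l`: an index `(k, z)`
stands for the half-open box of side length `l / 2 ^ k` at position `z`. -/
abbrev DyadicIndex (n : ℕ) : Type := ℕ × (Fin n → ℤ)

noncomputable section

/-- The side length of a dyadic box. -/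
def dyadicSide (l : ℝ) (q : DyadicIndex n) : ℝ := l / 2 ^ q.1

/-- The lower corner of a dyadic box. -/
def dyadicCorner (o : Rn n) (l : ℝ) (q : DyadicIndex n) : Rn n :=
  WithLp.toLp 2 fun i => o i + dyadicSide l q * q.2 i

/-- The half-open dyadic box. -/
def dyadicBox (o : Rn n) (l : ℝ) (q : DyadicIndex n) : Set (Rn n) :=
  {x | ∀ i, ⌊(x i - o i) / dyadicSide l q⌋ = q.2 i}

/-- The index of the dyadic box of level `k` containing `x`. -/
def dyadicAt (o : Rn n) (l : ℝ) (k : ℕ) (x : Rn n) : DyadicIndex n :=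
  (k, fun i => ⌊(x i - o i) / (l / 2 ^ k)⌋)

end

variable {o : Rn n} {l : ℝ}

theorem dyadicSide_pos (hl : 0 < l) (q : DyadicIndex n) : 0 < dyadicSide l q := by
  unfold dyadicSide; positivity

theorem mem_dyadicBox_iff (hl : 0 < l) {q : DyadicIndex n} {x : Rn n} : x ∈ dyadicBox o l q ↔
    ∀ i, dyadicCorner o l q i ≤ x i ∧ x i < dyadicCorner o l q i + dyadicSide l q := by
  have hs := dyadicSide_pos hl q
  refine forall_congr' fun i => ?_
  rw [Int.floor_eq_iff, le_div_iff₀ hs, div_lt_iff₀ hs]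
  simp only [dyadicCorner]
  constructor <;> rintro ⟨h1, h2⟩ <;> constructor <;> nlinarith

theorem mem_dyadicBox_iff_eq {q : DyadicIndex n} {x : Rn n} :
    x ∈ dyadicBox o l q ↔ dyadicAt o l q.1 x = q := by
  rw [Prod.ext_iff, funext_iff]
  simp [dyadicBox, dyadicAt, dyadicSide]

theorem mem_dyadicBox_dyadicAt (k : ℕ) (x : Rn n) : x ∈ dyadicBox o l (dyadicAt o l k x) :=
  mem_dyadicBox_iff_eq.2 rfl

theorem measurableSet_dyadicBox (q : DyadicIndex n) : MeasurableSet (dyadicBox o l q) := by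
  have : dyadicBox o l q = ⋂ i, {x | ⌊(x i - o i) / dyadicSide l q⌋ = q.2 i} := by
    ext x; simp [dyadicBox]
  rw [this]
  refine MeasurableSet.iInter fun i => ?_
  have : Measurable fun x : Rn n => ⌊(x i - o i) / dyadicSide l q⌋ := by
    refine Int.measurable_floor.comp ?_
    fun_prop
  exact this (measurableSet_singleton _)

theorem dyadicBox_subset_cube (hl : 0 < l) (q : DyadicIndex n) :
    dyadicBox o l q ⊆ cube (dyadicCorner o l q) (dyadicSide l q) :=
  fun _ hx i => ⟨((mem_dyadicBox_iff hl).1 hx i).1, ((mem_dyadicBox_iff hl).1 hx i).2.le⟩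

theorem dyadicBox_eq_preimage (hl : 0 < l) (q : DyadicIndex n) :
    dyadicBox o l q = (MeasurableEquiv.toLp 2 (Fin n → ℝ)).symm ⁻¹' (univ.pi fun i =>
      Ico (dyadicCorner o l q i) (dyadicCorner o l q i + dyadicSide l q)) := by
  ext x
  rw [mem_dyadicBox_iff hl]
  simp [Set.mem_pi]

theorem volume_dyadicBox (hl : 0 < l) (q : DyadicIndex n) :
    volume (dyadicBox o l q) = ENNReal.ofReal (dyadicSide l q) ^ n := by
  rw [dyadicBox_eq_preimage hl, (EuclideanSpace.volume_preserving_symm_measurableEquiv_toLp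
    (Fin n)).measure_preimage (MeasurableSet.univ_pi fun i => measurableSet_Ico).nullMeasurableSet,
    Real.volume_pi_Ico]
  simp

theorem volume_dyadicBox_ne_zero (hl : 0 < l) (q : DyadicIndex n) :
    volume (dyadicBox o l q) ≠ 0 := by
  rw [volume_dyadicBox hl]
  simp [dyadicSide_pos hl q]

theorem volume_dyadicBox_ne_top (hl : 0 < l) (q : DyadicIndex n) :
    volume (dyadicBox o l q) ≠ ∞ := by
  rw [volume_dyadicBox hl]
  simp

/-- The coarse position is the integer quotient of the fine position by `2 ^ (k - j)`. This gives
the nesting of the boxes. -/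
theorem dyadicAt_eq_of_le {j k : ℕ} (hjk : j ≤ k) {x y : Rn n}
    (h : dyadicAt o l k x = dyadicAt o l k y) : dyadicAt o l j x = dyadicAt o l j y := by
  have key : ∀ (x : Rn n) (i : Fin n), ⌊(x i - o i) / (l / 2 ^ j)⌋ =
      ⌊(x i - o i) / (l / 2 ^ k)⌋ / (2 ^ (k - j) : ℕ) := by
    intro x i
    rw [← Int.floor_div_natCast]
    congr 1
    obtain ⟨d, rfl⟩ := Nat.exists_eq_add_of_le hjk
    simp only [add_tsub_cancel_left, pow_add]
    push_cast
    rw [div_div_eq_mul_div, div_div_eq_mul_div]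
    rcases eq_or_ne l 0 with rfl | hl
    · simp
    · field_simp
  simp only [dyadicAt, Prod.mk.injEq, true_and, funext_iff] at h ⊢
  intro i
  rw [key, key, h i]

theorem dyadicBox_subset_of_mem {p q : DyadicIndex n} (hpq : q.1 ≤ p.1) {x : Rn n}
    (hp : x ∈ dyadicBox o l p) (hq : x ∈ dyadicBox o l q) : dyadicBox o l p ⊆ dyadicBox o l q := by
  intro y hy
  rw [mem_dyadicBox_iff_eq] at *
  rw [← hq]
  exact dyadicAt_eq_of_le hpq (hy.trans hp.symm)

theorem norm_sub_le_of_mem_dyadicBox (hl : 0 < l) {q : DyadicIndex n} {x y : Rn n}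
    (hx : x ∈ dyadicBox o l q) (hy : y ∈ dyadicBox o l q) : ‖x - y‖ ≤ n * dyadicSide l q := by
  refine norm_le_of_forall_abs_le fun i => ?_
  have h1 := (mem_dyadicBox_iff hl).1 hx i
  have h2 := (mem_dyadicBox_iff hl).1 hy i
  simp only [PiLp.sub_apply]
  rw [abs_le]
  constructor <;> linarith [h1.1, h1.2, h2.1, h2.2]

theorem exists_dyadicBox_subset (hl : 0 < l) {U : Set (Rn n)} (hU : IsOpen U) {x : Rn n}
    (hx : x ∈ U) (k₀ : ℕ) : ∃ k > k₀, dyadicBox o l (dyadicAt o l k x) ⊆ U := by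
  obtain ⟨ε, hε, hball⟩ := Metric.isOpen_iff.1 hU x hx
  have hlim : Filter.Tendsto (fun k : ℕ => n * (l * (1 / 2 : ℝ) ^ k)) Filter.atTop (nhds 0) := by
    simpa using ((tendsto_pow_atTop_nhds_zero_of_lt_one (by norm_num : (0 : ℝ) ≤ 1 / 2)
      (by norm_num)).const_mul l).const_mul (n : ℝ)
  obtain ⟨k, hk, hk0⟩ := ((hlim.eventually_lt_const hε).and (Filter.eventually_gt_atTop k₀)).exists
  refine ⟨k, hk0, fun y hy => hball ?_⟩
  rw [Metric.mem_ball, dist_eq_norm]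
  refine (norm_sub_le_of_mem_dyadicBox hl hy (mem_dyadicBox_dyadicAt k x)).trans_lt ?_
  convert hk using 2
  simp [dyadicSide, dyadicAt, div_eq_mul_inv]

theorem volume_dyadicBox_of_succ (hl : 0 < l) {p q : DyadicIndex n} (h : p.1 = q.1 + 1) :
    volume (dyadicBox o l q) = 2 ^ n * volume (dyadicBox o l p) := by
  rw [volume_dyadicBox hl, volume_dyadicBox hl, ← mul_pow]
  congr 1
  rw [show dyadicSide l q = 2 * dyadicSide l p by simp only [dyadicSide, h, pow_succ]; field_simp,
    ENNReal.ofReal_mul zero_le_two]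
  simp

/-- The maximal dyadic subcubes in which an open set of small measure has density larger than
`2 ^ (-n - 1)`. -/
theorem exists_stopping_children (hl : 0 < l) (Q : DyadicIndex n) {U : Set (Rn n)} (hU : IsOpen U)
    (hUQ : volume U ≤ (2⁻¹ : ℝ≥0∞) ^ (n + 2) * volume (dyadicBox o l Q)) :
    ∃ ch : Set (DyadicIndex n), (∀ P ∈ ch, dyadicBox o l P ⊆ dyadicBox o l Q) ∧
      ch.PairwiseDisjoint (dyadicBox o l) ∧
      U ∩ dyadicBox o l Q ⊆ ⋃ P ∈ ch, dyadicBox o l P ∧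
      volume (⋃ P ∈ ch, dyadicBox o l P) ≤ 2⁻¹ * volume (dyadicBox o l Q) ∧
      ∀ P ∈ ch, volume (U ∩ dyadicBox o l P) ≤ 2⁻¹ * volume (dyadicBox o l P) := by
  set B := dyadicBox o l with hB
  set big : DyadicIndex n → Prop := fun P => (2⁻¹ : ℝ≥0∞) ^ (n + 1) * volume (B P) < volume (U ∩ B P)
    with hbig
  -- Maximality is tested only against levels strictly below `Q`; `Q` itself is handled through the
  -- bound on the measure of `U`.
  set ch : Set (DyadicIndex n) := {P | Q.1 < P.1 ∧ B P ⊆ B Q ∧ big P ∧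
    ∀ P', Q.1 < P'.1 → P'.1 < P.1 → B P ⊆ B P' → ¬ big P'} with hch
  have hdisj : ch.PairwiseDisjoint B := by
    intro P hP P' hP' hne
    rw [Function.onFun, Set.disjoint_left]
    intro x hx hx'
    rcases lt_trichotomy P.1 P'.1 with h | h | h
    · exact hP'.2.2.2 P hP.1 h (dyadicBox_subset_of_mem h.le hx' hx) hP.2.2.1
    · rw [hB, mem_dyadicBox_iff_eq] at hx hx'
      exact hne (by rw [← hx, ← hx', h])
    · exact hP.2.2.2 P' hP'.1 h (dyadicBox_subset_of_mem h.le hx hx') hP'.2.2.1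
  have h2pow : ∀ k : ℕ, (2 : ℝ≥0∞) ^ k * (2⁻¹ : ℝ≥0∞) ^ k = 1 := by
    intro k
    rw [← mul_pow, ENNReal.mul_inv_cancel two_ne_zero ENNReal.ofNat_ne_top, one_pow]
  refine ⟨ch, fun P hP => hP.2.1, hdisj, ?_, ?_, ?_⟩
  · rintro x ⟨hxU, hxQ⟩
    -- Since `U` is open, a small box around `x` lies inside `U` and has density one. The coarsest
    -- dense box is then selected.
    have hex : ∃ k, Q.1 < k ∧ big (dyadicAt o l k x) := by
      obtain ⟨k, hk, hsub⟩ := exists_dyadicBox_subset (o := o) hl hU hxU Q.1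
      refine ⟨k, hk, ?_⟩
      simp only [hbig, hB, inter_eq_self_of_subset_right hsub]
      have : (2⁻¹ : ℝ≥0∞) ^ (n + 1) < 1 := by
        refine pow_lt_one₀ zero_le ?_ n.succ_ne_zero
        exact ENNReal.inv_lt_one.2 ENNReal.one_lt_two
      have h := ENNReal.mul_right_strictMono (volume_dyadicBox_ne_zero (o := o) hl
        (dyadicAt o l k x)) (volume_dyadicBox_ne_top hl _) this
      simpa only [mul_one, one_mul, mul_comm] using h
    classical
    have hfind := Nat.find_spec hex
    refine mem_iUnion₂.2 ⟨dyadicAt o l (Nat.find hex) x, ⟨hfind.1, ?_, hfind.2, ?_⟩,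
      mem_dyadicBox_dyadicAt _ _⟩
    · exact dyadicBox_subset_of_mem hfind.1.le (mem_dyadicBox_dyadicAt _ _) hxQ
    · intro P' h1 h2 h3 h4
      have hx' : x ∈ dyadicBox o l P' := h3 (mem_dyadicBox_dyadicAt _ _)
      rw [mem_dyadicBox_iff_eq] at hx'
      rw [← hx'] at h4
      exact Nat.find_min hex h2 ⟨h1, h4⟩
  · calc volume (⋃ P ∈ ch, B P) ≤ ∑' P : ch, volume (B P) :=
          measure_biUnion_le volume (to_countable _) _
      _ ≤ ∑' P : ch, 2 ^ (n + 1) * volume (U ∩ B P) := by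
        refine ENNReal.tsum_le_tsum fun P => ?_
        calc volume (B P) = 2 ^ (n + 1) * ((2⁻¹ : ℝ≥0∞) ^ (n + 1) * volume (B P)) := by
              rw [← mul_assoc, h2pow, one_mul]
          _ ≤ _ := by gcongr; exact P.2.2.2.1.le
      _ = 2 ^ (n + 1) * volume (⋃ P ∈ ch, (U ∩ B P)) := by
        rw [ENNReal.tsum_mul_left, measure_biUnion (to_countable _)
          (hdisj.mono fun _ => inter_subset_right)
          fun P _ => hU.measurableSet.inter (measurableSet_dyadicBox P)]
      _ ≤ 2 ^ (n + 1) * volume U := by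
        gcongr
        exact iUnion₂_subset fun P _ => inter_subset_left
      _ ≤ 2 ^ (n + 1) * ((2⁻¹ : ℝ≥0∞) ^ (n + 2) * volume (B Q)) := by gcongr
      _ = 2⁻¹ * volume (B Q) := by
        rw [pow_succ (2⁻¹ : ℝ≥0∞) (n + 1), ← mul_assoc, ← mul_assoc, h2pow, one_mul]
  · intro P hP
    obtain ⟨x, hx⟩ := nonempty_of_measure_ne_zero (volume_dyadicBox_ne_zero (o := o) hl P)
    set P' := dyadicAt o l (P.1 - 1) x with hP'
    have hlev : P.1 = P'.1 + 1 := by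
      have := hP.1
      simp only [hP', dyadicAt]
      omega
    have hx' : x ∈ dyadicBox o l P' := mem_dyadicBox_dyadicAt _ _
    have hsub : B P ⊆ B P' := dyadicBox_subset_of_mem (by omega) hx hx'
    -- The dyadic parent is `2 ^ n` times as large, so density `2 ^ (-n - 1)` in the parent means
    -- density at most one half in the child.
    have hvol : (2⁻¹ : ℝ≥0∞) ^ (n + 1) * volume (B P') = 2⁻¹ * volume (B P) := by
      rw [hB, volume_dyadicBox_of_succ hl hlev, ← mul_assoc, pow_succ', mul_assoc 2⁻¹,
        mul_comm _ ((2 : ℝ≥0∞) ^ n), h2pow, mul_one]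
    rw [← hvol]
    -- If the parent is `Q`, the hypothesis on `U` bounds the density; otherwise the parent was not
    -- selected, by maximality of `P`.
    rcases (show Q.1 ≤ P'.1 by have := hP.1; omega).eq_or_lt with h | h
    · have hQP : Q = P' := by
        have := mem_dyadicBox_iff_eq.1 (hP.2.1 hx)
        rw [← this, hP', h]
        rfl
      calc volume (U ∩ B P) ≤ volume U := measure_mono inter_subset_left
        _ ≤ (2⁻¹ : ℝ≥0∞) ^ (n + 2) * volume (B Q) := hUQ
        _ ≤ (2⁻¹ : ℝ≥0∞) ^ (n + 1) * volume (B Q) := by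
          gcongr ?_ * _
          refine pow_le_pow_right_of_le_one' ?_ (by omega)
          exact ENNReal.inv_le_one.2 one_le_two
        _ = _ := by rw [hQP]
    · have := hP.2.2.2 P' h (by omega) hsub
      exact (measure_mono (inter_subset_inter_right _ hsub)).trans (not_lt.1 this)

end

section

variable {n : ℕ} {o : Rn n} {l : ℝ}

theorem volume_cube_ne_zero (a : Rn n) (hl : 0 < l) : volume (cube a l) ≠ 0 := by
  rw [volume_cube]
  simp [hl]

theorem volume_cube_ne_top (a : Rn n) (l : ℝ) : volume (cube a l) ≠ ∞ := by
  rw [volume_cube]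
  simp

/-! ### Weights -/

theorem weightMeasure_absolutelyContinuous (w : Rn n → ℝ) : weightMeasure w ≪ volume :=
  withDensity_absolutelyContinuous _ _

theorem weightMeasure_cube_ne_top {w : Rn n → ℝ} (hw : LocallyIntegrable w) (a : Rn n) (l : ℝ) :
    weightMeasure w (cube a l) ≠ ∞ := by
  rw [weightMeasure, withDensity_apply _ (measurableSet_cube a l)]
  exact (hw.integrableOn_isCompact (isCompact_cube a l)).lintegral_lt_top.ne

/-- Write `1 = w^(1/q) w^(-1/q)` on `F` and apply Hölder: `|F|^q` is at most `w(F)` times the power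
of the dual weight in the `A_q` condition, and that condition trades this power for `|Q|^q / w(Q)`.
-/
theorem IsMuckenhoupt.weightMeasure_le_mul {q : ℝ} (hq : 1 < q) {w : Rn n → ℝ}
    (hw : IsMuckenhoupt q w) : ∃ C : ℝ≥0, ∀ (a : Rn n) (l : ℝ), 0 < l → ∀ F ⊆ cube a l,
      MeasurableSet F → 2⁻¹ * volume (cube a l) ≤ volume F →
        weightMeasure w (cube a l) ≤ C * weightMeasure w F := by
  obtain ⟨hloc, hpos, C, hC⟩ := hw
  refine ⟨C * 2 ^ q, fun a l hl F hF hFm hvol => ?_⟩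
  have hq0 : 0 < q := zero_lt_one.trans hq
  have hq1 : 0 < q - 1 := sub_pos.2 hq
  have hV0 := volume_cube_ne_zero a hl
  have hVt := volume_cube_ne_top a l
  set V := volume (cube a l) with hV
  have hwm : AEMeasurable w := hloc.aestronglyMeasurable.aemeasurable
  have hCa := hC a l hl
  rw [setLAverage_eq, setLAverage_eq, ← hV] at hCa
  have hw1 : weightMeasure w (cube a l) = ∫⁻ x in cube a l, ENNReal.ofReal (w x) := by
    rw [weightMeasure, withDensity_apply _ (measurableSet_cube a l)]
  have hw2 : weightMeasure w F = ∫⁻ x in F, ENNReal.ofReal (w x) := by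
    rw [weightMeasure, withDensity_apply _ hFm]
  set σ := ∫⁻ x in cube a l, ENNReal.ofReal (w x ^ (-1 / (q - 1))) with hσ
  rw [← hw1] at hCa
  set W := weightMeasure w (cube a l) with hW
  have hholder : volume F ≤ weightMeasure w F ^ (1 / q) * σ ^ ((q - 1) / q) := by
    have hpq : q.HolderConjugate (q / (q - 1)) := Real.HolderConjugate.conjExponent hq
    have h1 := ENNReal.lintegral_mul_le_Lp_mul_Lq (volume.restrict F) hpq
      (f := fun x => ENNReal.ofReal (w x) ^ (1 / q))
      (g := fun x => ENNReal.ofReal (w x ^ (-1 / (q - 1))) ^ ((q - 1) / q))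
      (by fun_prop) (by fun_prop)
    have h2 : ∫⁻ x in F, ((fun x => ENNReal.ofReal (w x) ^ (1 / q)) *
        fun x => ENNReal.ofReal (w x ^ (-1 / (q - 1))) ^ ((q - 1) / q)) x = volume F := by
      rw [← setLIntegral_one]
      refine lintegral_congr_ae ?_
      filter_upwards [ae_restrict_of_ae hpos] with x hx
      simp only [Pi.mul_apply]
      rw [ENNReal.ofReal_rpow_of_pos hx, ENNReal.ofReal_rpow_of_pos (Real.rpow_pos_of_pos hx _),
        ← ENNReal.ofReal_mul (by positivity), ← Real.rpow_mul hx.le, ← Real.rpow_add hx,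
        show 1 / q + -1 / (q - 1) * ((q - 1) / q) = 0 by field_simp; ring]
      simp
    rw [h2] at h1
    refine h1.trans ?_
    have h3 : ∀ x, (ENNReal.ofReal (w x) ^ (1 / q)) ^ q = ENNReal.ofReal (w x) := by
      intro x
      rw [← ENNReal.rpow_mul, one_div_mul_cancel hq0.ne', ENNReal.rpow_one]
    have h4 : ∀ x, (ENNReal.ofReal (w x ^ (-1 / (q - 1))) ^ ((q - 1) / q)) ^ (q / (q - 1)) =
        ENNReal.ofReal (w x ^ (-1 / (q - 1))) := by
      intro x
      rw [← ENNReal.rpow_mul, show (q - 1) / q * (q / (q - 1)) = 1 by field_simp, ENNReal.rpow_one]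
    simp only [h3, h4]
    rw [← hw2, show 1 / (q / (q - 1)) = (q - 1) / q by field_simp]
    gcongr
    exact lintegral_mono_set hF
  have h5 : (2⁻¹ * V) ^ q ≤ weightMeasure w F * σ ^ (q - 1) := by
    calc (2⁻¹ * V) ^ q ≤ (weightMeasure w F ^ (1 / q) * σ ^ ((q - 1) / q)) ^ q :=
          ENNReal.rpow_le_rpow (hvol.trans hholder) hq0.le
      _ = _ := by
        rw [ENNReal.mul_rpow_of_nonneg _ _ hq0.le, ← ENNReal.rpow_mul, ← ENNReal.rpow_mul,
          one_div_mul_cancel hq0.ne', ENNReal.rpow_one, div_mul_cancel₀ _ hq0.ne']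
  have h6 : W * σ ^ (q - 1) ≤ C * V ^ q := by
    rw [ENNReal.div_rpow_of_nonneg _ _ hq1.le] at hCa
    have hVq : V ^ q = V * V ^ (q - 1) := by
      conv_rhs => rw [← ENNReal.rpow_one V, ← ENNReal.rpow_mul, one_mul]
      rw [← ENNReal.rpow_add _ _ hV0 hVt]
      congr 1; ring
    have hV1 : V ^ (q - 1) ≠ 0 := by simp [ENNReal.rpow_eq_zero_iff, hV0, hVt]
    have hV2 : V ^ (q - 1) ≠ ∞ := ENNReal.rpow_ne_top_of_nonneg hq1.le hVt
    calc W * σ ^ (q - 1) = (W / V * (σ ^ (q - 1) / V ^ (q - 1))) * (V * V ^ (q - 1)) := by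
          rw [mul_mul_mul_comm, ENNReal.div_mul_cancel hV0 hVt, ENNReal.div_mul_cancel hV1 hV2]
      _ ≤ C * V ^ q := by rw [hVq]; gcongr
  -- Multiplying by `W` and cancelling the finite nonzero power of `V` avoids dividing by `σ ^ (q -
  -- 1)`, whose finiteness and positivity are then not needed.
  have h7 : (2⁻¹ * V) ^ q * W ≤ (2⁻¹ * V) ^ q * (C * 2 ^ q * weightMeasure w F) := by
    calc (2⁻¹ * V) ^ q * W ≤ weightMeasure w F * σ ^ (q - 1) * W := by gcongr
      _ = weightMeasure w F * (W * σ ^ (q - 1)) := by ring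
      _ ≤ weightMeasure w F * (C * V ^ q) := by gcongr
      _ = (2⁻¹ * V) ^ q * (C * 2 ^ q * weightMeasure w F) := by
        have : V ^ q = (2⁻¹ * V) ^ q * 2 ^ q := by
          rw [← ENNReal.mul_rpow_of_nonneg _ _ hq0.le]
          congr 1
          rw [mul_comm, ← mul_assoc, ENNReal.mul_inv_cancel two_ne_zero ENNReal.ofNat_ne_top,
            one_mul]
        rw [this]; ring
  have h8 : (2⁻¹ * V) ^ q ≠ 0 := by simp [ENNReal.rpow_eq_zero_iff, hV0, hq0.le]
  have h9 : (2⁻¹ * V) ^ q ≠ ∞ :=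
    ENNReal.rpow_ne_top_of_nonneg hq0.le (ENNReal.mul_ne_top (by simp) hVt)
  have := (ENNReal.mul_le_mul_iff_right h8 h9).1 h7
  rw [ENNReal.coe_mul, ENNReal.coe_rpow_of_nonneg _ hq0.le]
  exact this

/-- Sets of at most half the volume of a cube carry at most a fixed fraction of its weight. -/
theorem IsAInfty.exists_lt_one {w : Rn n → ℝ} (hw : IsAInfty w) :
    ∃ θ : ℝ≥0, θ < 1 ∧ ∀ (a : Rn n) (l : ℝ), 0 < l → ∀ E ⊆ cube a l, MeasurableSet E →
      volume E ≤ 2⁻¹ * volume (cube a l) → weightMeasure w E ≤ θ * weightMeasure w (cube a l) := by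
  obtain ⟨q, hq, hw⟩ := hw
  obtain ⟨C, hC⟩ := hw.weightMeasure_le_mul hq
  -- The complement of `E` has at least half the volume, hence at least the fraction `1 / D` of the
  -- weight; `D ≥ 1` makes `1 - D⁻¹` a genuine subtraction.
  set D : ℝ≥0 := max C 1 with hD
  have hD1 : 1 ≤ D := le_max_right _ _
  have hD0 : D ≠ 0 := (zero_lt_one.trans_le hD1).ne'
  refine ⟨1 - D⁻¹, tsub_lt_self zero_lt_one (by positivity), fun a l hl E hE hEm hvol => ?_⟩
  set W := weightMeasure w (cube a l) with hW
  have hWt : W ≠ ∞ := weightMeasure_cube_ne_top hw.1 a l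
  have hF : 2⁻¹ * volume (cube a l) ≤ volume (cube a l \ E) := by
    rw [measure_sdiff hE hEm.nullMeasurableSet
      (ne_top_of_le_ne_top (volume_cube_ne_top a l) (measure_mono hE))]
    refine ENNReal.le_sub_of_add_le_right
      (ne_top_of_le_ne_top (volume_cube_ne_top a l) (measure_mono hE)) ?_
    calc _ ≤ 2⁻¹ * volume (cube a l) + 2⁻¹ * volume (cube a l) := by gcongr
      _ = volume (cube a l) := by rw [← add_mul, ENNReal.inv_two_add_inv_two, one_mul]
  have h1 := hC a l hl _ sdiff_subset ((measurableSet_cube a l).diff hEm) hF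
  have h2 : W ≤ D * weightMeasure w (cube a l \ E) := h1.trans (by gcongr; exact le_max_left _ _)
  have h3 : weightMeasure w E + weightMeasure w (cube a l \ E) = W := by
    rw [measure_add_sdiff hEm.nullMeasurableSet, union_eq_self_of_subset_left hE]
  have h4 : (D : ℝ≥0∞)⁻¹ * W ≤ weightMeasure w (cube a l \ E) := by
    rw [ENNReal.inv_mul_le_iff (by simpa using hD0) ENNReal.coe_ne_top]
    exact h2
  rw [ENNReal.coe_sub, ENNReal.coe_inv hD0, ENNReal.coe_one,
    ENNReal.sub_mul (fun _ _ => hWt), one_mul]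
  refine ENNReal.le_sub_of_add_le_right ?_ ?_
  · exact ne_top_of_le_ne_top hWt (h4.trans (h3 ▸ le_add_self))
  · rw [← h3]
    gcongr
    rwa [h3]

end

section

variable {n : ℕ} {𝕜 : Type*} [RCLike 𝕜]

/-! ### The John-Nirenberg inequality -/

/-- Chebyshev's inequality with a threshold that may vanish. -/
theorem measure_lt_le_of_lintegral_le {X E : Type*} [MeasurableSpace X] [NormedAddCommGroup E]
    {μ : Measure X} {S : Set X} (hS : MeasurableSet S) {h : X → E}
    (hh : AEStronglyMeasurable h (μ.restrict S)) {v : ℝ} (hv : 0 ≤ v) {V : ℝ≥0∞}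
    (hint : ∫⁻ x in S, ‖h x‖ₑ ∂μ ≤ ENNReal.ofReal v * V) {c : ℝ} (hc : 0 < c) :
    μ (S ∩ {x | c * v < ‖h x‖}) ≤ (ENNReal.ofReal c)⁻¹ * V := by
  rw [inter_comm, ← Measure.restrict_apply' hS]
  rcases hv.eq_or_lt with rfl | hv
  · have h0 : ∫⁻ x in S, ‖h x‖ₑ ∂μ = 0 := by simpa using hint
    rw [lintegral_eq_zero_iff' hh.enorm] at h0
    have : (μ.restrict S) {x | c * 0 < ‖h x‖} = 0 := by
      rw [measure_eq_zero_iff_ae_notMem]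
      filter_upwards [h0] with x hx
      simpa using hx
    rw [this]
    exact zero_le
  · have hcv : 0 < c * v := mul_pos hc hv
    have h1 := mul_meas_ge_le_lintegral₀ hh.enorm (ENNReal.ofReal (c * v))
    have h2 : (μ.restrict S) {x | c * v < ‖h x‖} ≤
        (μ.restrict S) {x | ENNReal.ofReal (c * v) ≤ ‖h x‖ₑ} := by
      refine measure_mono fun x hx => ?_
      rw [mem_ofPred_eq, ← ofReal_norm]
      exact ENNReal.ofReal_le_ofReal (le_of_lt hx)
    rw [← ENNReal.mul_le_iff_le_inv (by simpa using hc) ENNReal.ofReal_ne_top]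
    have hv0 : ENNReal.ofReal v ≠ 0 := by simpa using hv
    refine (ENNReal.mul_le_mul_iff_right hv0 ENNReal.ofReal_ne_top).1 ?_
    calc ENNReal.ofReal v * (ENNReal.ofReal c * (μ.restrict S) {x | c * v < ‖h x‖})
        = ENNReal.ofReal (c * v) * (μ.restrict S) {x | c * v < ‖h x‖} := by
          rw [ENNReal.ofReal_mul hc.le]; ring
      _ ≤ _ := (mul_le_mul_right h2 _).trans (h1.trans hint)

/-- The average of `b` over a cube. -/
noncomputable def cubeMean (b : Rn n → 𝕜) (a : Rn n) (l : ℝ) : 𝕜 := ⨍ z in cube a l, b z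

theorem lintegral_sub_cubeMean_le {b : Rn n → 𝕜} {β : ℝ} (hβ : bmoNorm b ≤ ENNReal.ofReal β)
    (a : Rn n) {l : ℝ} (hl : 0 < l) :
    ∫⁻ x in cube a l, ‖b x - cubeMean b a l‖ₑ ≤ ENNReal.ofReal β * volume (cube a l) := by
  have h1 : ⨍⁻ y in cube a l, ‖b y - ⨍ z in cube a l, b z‖ₑ ∂volume ≤ ENNReal.ofReal β :=
    (le_iSup (fun _ : 0 < l => ⨍⁻ y in cube a l, ‖b y - ⨍ z in cube a l, b z‖ₑ ∂volume)
      hl).trans ((le_iSup₂ (f := fun a l => ⨆ _ : 0 < l,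
        ⨍⁻ y in cube a l, ‖b y - ⨍ z in cube a l, b z‖ₑ ∂volume) a l).trans hβ)
  rw [setLAverage_eq, ENNReal.div_le_iff (volume_cube_ne_zero a hl) (volume_cube_ne_top a l)] at h1
  exact h1

/-- Stopping children for an arbitrary exceptional set of small measure. -/
theorem exists_stopping_children_of_measure_le {o : Rn n} {l : ℝ} (hl : 0 < l)
    (Q : DyadicIndex n) {E : Set (Rn n)}
    (hE : volume E ≤ (2⁻¹ : ℝ≥0∞) ^ (n + 3) * volume (dyadicBox o l Q)) :
    ∃ ch : Set (DyadicIndex n), (∀ P ∈ ch, dyadicBox o l P ⊆ dyadicBox o l Q) ∧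
      ch.PairwiseDisjoint (dyadicBox o l) ∧
      E ∩ dyadicBox o l Q ⊆ ⋃ P ∈ ch, dyadicBox o l P ∧
      volume (⋃ P ∈ ch, dyadicBox o l P) ≤ 2⁻¹ * volume (dyadicBox o l Q) ∧
      ∀ P ∈ ch, volume (E ∩ dyadicBox o l P) ≤ 2⁻¹ * volume (dyadicBox o l P) := by
  -- Outer regularity doubles the measure allowance: the factor `2⁻¹ ^ (n + 3)` becomes the `2⁻¹ ^
  -- (n + 2)` required for open sets.
  obtain ⟨U, hEU, hUo, hU⟩ := E.exists_isOpen_le_add volume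
    (ε := (2⁻¹ : ℝ≥0∞) ^ (n + 3) * volume (dyadicBox o l Q))
    (mul_ne_zero (by simp) (volume_dyadicBox_ne_zero hl Q))
  have hU' : volume U ≤ (2⁻¹ : ℝ≥0∞) ^ (n + 2) * volume (dyadicBox o l Q) := by
    refine hU.trans ((add_le_add_left hE _).trans_eq ?_)
    rw [← add_mul, pow_succ _ (n + 2), ← mul_add, ENNReal.inv_two_add_inv_two, mul_one]
  obtain ⟨ch, h1, h2, h3, h4, h5⟩ := exists_stopping_children hl Q hUo hU'
  exact ⟨ch, h1, h2, (inter_subset_inter_left _ hEU).trans h3, h4,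
    fun P hP => (measure_mono (inter_subset_inter_left _ hEU)).trans (h5 P hP)⟩

/-- The tree of dyadic boxes obtained from a choice of stopping children. -/
def stoppingTree {o : Rn n} {l : ℝ} (ch : DyadicIndex n → Set (DyadicIndex n))
    (h1 : ∀ Q, ∀ P ∈ ch Q, dyadicBox o l P ⊆ dyadicBox o l Q)
    (h2 : ∀ Q, (ch Q).PairwiseDisjoint (dyadicBox o l)) : StoppingTree (DyadicIndex n) (Rn n) where
  box := dyadicBox o l
  child := ch
  measurableSet_box := measurableSet_dyadicBox
  box_subset := h1
  pairwiseDisjoint := h2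

theorem volume_dyadicBox_eq_cube {o : Rn n} {l : ℝ} (hl : 0 < l) (Q : DyadicIndex n) :
    volume (dyadicBox o l Q) = volume (cube (dyadicCorner o l Q) (dyadicSide l Q)) := by
  rw [volume_dyadicBox hl, volume_cube]

theorem dyadicBox_ae_eq_cube {o : Rn n} {l : ℝ} (hl : 0 < l) (Q : DyadicIndex n) :
    dyadicBox o l Q =ᵐ[volume] cube (dyadicCorner o l Q) (dyadicSide l Q) :=
  ae_eq_of_subset_of_measure_ge (dyadicBox_subset_cube hl Q) (volume_dyadicBox_eq_cube hl Q).ge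
    (measurableSet_dyadicBox Q).nullMeasurableSet (volume_cube_ne_top _ _)

/-- The index of the undivided cube. -/
def dyadicRoot (n : ℕ) : DyadicIndex n := (0, 0)

theorem dyadicCorner_root (o : Rn n) (l : ℝ) : dyadicCorner o l (dyadicRoot n) = o := by
  ext i
  simp [dyadicCorner, dyadicRoot]

theorem dyadicSide_root (l : ℝ) : dyadicSide l (dyadicRoot n) = l := by
  simp [dyadicSide, dyadicRoot]

/-- **John-Nirenberg inequality**. -/
theorem volume_lt_norm_sub_cubeMean_le {b : Rn n → 𝕜} (hb : LocallyIntegrable b) {β : ℝ}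
    (hβ0 : 0 ≤ β) (hβ : bmoNorm b ≤ ENNReal.ofReal β) (a : Rn n) {l : ℝ} (hl : 0 < l) (s : ℕ) :
    volume (cube a l ∩ {x | 2 ^ (n + 4) * β * s < ‖b x - cubeMean b a l‖}) ≤
      2⁻¹ ^ s * volume (cube a l) := by
  set B := dyadicBox a l with hB
  set c : DyadicIndex n → 𝕜 := fun q => cubeMean b (dyadicCorner a l q) (dyadicSide l q) with hc
  set E : DyadicIndex n → Set (Rn n) := fun q => cube (dyadicCorner a l q) (dyadicSide l q) ∩
    {x | 2 ^ (n + 3) * β < ‖b x - c q‖} with hE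
  have hEvol : ∀ q, volume (E q) ≤ (2⁻¹ : ℝ≥0∞) ^ (n + 3) * volume (B q) := by
    intro q
    have := measure_lt_le_of_lintegral_le (measurableSet_cube _ _)
      (hb.aestronglyMeasurable.sub aestronglyMeasurable_const).restrict hβ0
      (lintegral_sub_cubeMean_le hβ (dyadicCorner a l q) (dyadicSide_pos hl q))
      (c := 2 ^ (n + 3)) (by positivity)
    rw [← volume_dyadicBox_eq_cube hl] at this
    refine this.trans_eq ?_
    rw [ENNReal.ofReal_pow zero_le_two, ENNReal.inv_pow]
    simp [hB]
  choose ch h1 h2 h3 h4 h5 using fun q => exists_stopping_children_of_measure_le hl q (hEvol q)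
  set t := stoppingTree ch h1 h2 with ht
  -- Every generation adds a fixed multiple of `β`, since consecutive means can be compared at a
  -- good point of the smaller box.
  have hleaf : ∀ s q x, x ∈ t.leaves s q → ‖b x - c q‖ ≤ 2 ^ (n + 4) * β * (s + 1) := by
    intro s
    induction s with
    | zero =>
      intro q x hx
      have hxE : x ∉ E q := fun hxE => hx.2 (h3 q ⟨hxE, hx.1⟩)
      have : ‖b x - c q‖ ≤ 2 ^ (n + 3) * β := by
        by_contra! hlt
        exact hxE ⟨dyadicBox_subset_cube hl q hx.1, hlt⟩
      rw [pow_succ]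
      have h0 : 0 ≤ 2 ^ (n + 3) * β := by positivity
      norm_num
      linarith
    | succ s ih =>
      intro q x hx
      obtain ⟨p, hp, hxp⟩ := mem_iUnion₂.1 hx
      -- The parent's exceptional set fills at most half of `p`, and that of `p` much less, so some
      -- point of `p` is good for both boxes.
      have hlt : volume ((E q ∪ E p) ∩ B p) < volume (B p) := by
        have hp0 : volume (B p) ≠ 0 := volume_dyadicBox_ne_zero hl p
        have hpt : volume (B p) ≠ ∞ := volume_dyadicBox_ne_top hl p
        have hlt1 : (2⁻¹ : ℝ≥0∞) ^ (n + 3) < 2⁻¹ := by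
          calc (2⁻¹ : ℝ≥0∞) ^ (n + 3) ≤ 2⁻¹ ^ 2 :=
                pow_le_pow_right_of_le_one' (ENNReal.inv_le_one.2 one_le_two) (by omega)
            _ < 2⁻¹ := by
              rw [← ENNReal.inv_pow, ENNReal.inv_lt_inv]
              norm_num
        calc volume ((E q ∪ E p) ∩ B p) ≤ volume (E q ∩ B p) + volume (E p) := by
              rw [union_inter_distrib_right]
              refine (measure_union_le _ _).trans ?_
              gcongr
              exact inter_subset_left
          _ ≤ 2⁻¹ * volume (B p) + (2⁻¹ : ℝ≥0∞) ^ (n + 3) * volume (B p) :=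
            add_le_add (h5 q p hp) (hEvol p)
          _ < 2⁻¹ * volume (B p) + 2⁻¹ * volume (B p) := by
            refine ENNReal.add_lt_add_left (ENNReal.mul_ne_top (by simp) hpt) ?_
            simpa only [mul_comm] using ENNReal.mul_right_strictMono hp0 hpt hlt1
          _ = volume (B p) := by rw [← add_mul, ENNReal.inv_two_add_inv_two, one_mul]
      obtain ⟨y, hyp, hyE⟩ : ∃ y ∈ B p, y ∉ E q ∪ E p := by
        by_contra! hcon
        exact hlt.not_ge (measure_mono fun y hy => ⟨hcon y hy, hy⟩)
      simp only [mem_union, not_or] at hyE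
      have hyq : ‖b y - c q‖ ≤ 2 ^ (n + 3) * β := by
        by_contra! hlt
        exact hyE.1 ⟨dyadicBox_subset_cube hl q (h1 q p hp hyp), hlt⟩
      have hyp' : ‖b y - c p‖ ≤ 2 ^ (n + 3) * β := by
        by_contra! hlt
        exact hyE.2 ⟨dyadicBox_subset_cube hl p hyp, hlt⟩
      have hx' := ih p x hxp
      calc ‖b x - c q‖ = ‖(b x - c p) + (b y - c q) - (b y - c p)‖ := by congr 1; ring
        _ ≤ ‖b x - c p‖ + ‖b y - c q‖ + ‖b y - c p‖ :=
          (norm_sub_le _ _).trans (by gcongr; exact norm_add_le _ _)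
        _ ≤ 2 ^ (n + 4) * β * (s + 1) + 2 ^ (n + 3) * β + 2 ^ (n + 3) * β := by gcongr
        _ = 2 ^ (n + 4) * β * ((s + 1 : ℕ) + 1) := by push_cast; ring
  have hroot : cube a l = cube (dyadicCorner a l (dyadicRoot n)) (dyadicSide l (dyadicRoot n)) := by
    rw [dyadicCorner_root, dyadicSide_root]
  have hcr : c (dyadicRoot n) = cubeMean b a l := by
    simp only [hc, dyadicCorner_root, dyadicSide_root]
  calc volume (cube a l ∩ {x | 2 ^ (n + 4) * β * s < ‖b x - cubeMean b a l‖})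
      = volume (B (dyadicRoot n) ∩ {x | 2 ^ (n + 4) * β * s < ‖b x - cubeMean b a l‖}) := by
        refine measure_congr (Filter.EventuallyEq.inter ?_ Filter.EventuallyEq.rfl)
        rw [hroot]
        exact (dyadicBox_ae_eq_cube hl _).symm
    _ ≤ volume (t.descend s (dyadicRoot n)) := by
      refine measure_mono fun x hx => ?_
      refine t.mem_descend_of_forall_notMem_leaves s _ hx.1 fun r hr hmem => ?_
      have h6 := hleaf r _ x hmem
      rw [hcr] at h6
      have h7 := hx.2
      rw [mem_ofPred_eq] at h7
      have h8 : (r : ℝ) + 1 ≤ s := by exact_mod_cast hr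
      have h9 := mul_le_mul_of_nonneg_left h8 (show 0 ≤ 2 ^ (n + 4) * β by positivity)
      linarith
    _ ≤ 2⁻¹ ^ s * volume (t.box (dyadicRoot n)) := t.measure_descend_le h4 s _
    _ = 2⁻¹ ^ s * volume (cube a l) := by
      rw [hroot, ← volume_dyadicBox_eq_cube hl]
      rfl

end

/-! ### Exponential integrability of BMO functions and the `L log L` pairing -/

section

variable {n : ℕ} {𝕜 : Type*} [RCLike 𝕜]

/-- Sum the John-Nirenberg level sets with weights `exp ((s + 1) / 2)`. The series is geometric with
ratio `exp (1 / 2) / 2 < 1`. -/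
theorem exists_lintegral_exp_le (n : ℕ) (𝕜 : Type*) [RCLike 𝕜] : ∃ C : ℝ≥0, ∀ b : Rn n → 𝕜,
    LocallyIntegrable b → ∀ β : ℝ, 0 < β → bmoNorm b ≤ ENNReal.ofReal β → ∀ (a : Rn n) (l : ℝ),
      0 < l → ∫⁻ x in cube a l,
        ENNReal.ofReal (Real.exp (‖b x - cubeMean b a l‖ / (2 ^ (n + 4) * β) / 2)) ≤
          C * volume (cube a l) := by
  set r : ℝ≥0∞ := ENNReal.ofReal (Real.exp (1 / 2)) * 2⁻¹ with hr
  have hr1 : r < 1 := by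
    have h1 : Real.exp (1 / 2) < 2 := by
      have h2 : Real.exp (1 / 2) * Real.exp (1 / 2) = Real.exp 1 := by
        rw [← Real.exp_add]; norm_num
      nlinarith [Real.exp_one_lt_d9, Real.exp_pos (1 / 2)]
    rw [hr, ← div_eq_mul_inv, ENNReal.div_lt_iff (by simp) (by simp), one_mul]
    rw [show (2 : ℝ≥0∞) = ENNReal.ofReal 2 by simp]
    exact (ENNReal.ofReal_lt_ofReal_iff two_pos).2 h1
  set C : ℝ≥0∞ := ENNReal.ofReal (Real.exp (1 / 2)) +
    ∑' s : ℕ, ENNReal.ofReal (Real.exp (1 / 2)) * r ^ s with hC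
  have hCt : C ≠ ∞ := by
    rw [hC, ENNReal.tsum_mul_left, ENNReal.tsum_geometric]
    refine ENNReal.add_ne_top.2 ⟨ENNReal.ofReal_ne_top, ENNReal.mul_ne_top ENNReal.ofReal_ne_top ?_⟩
    simpa [tsub_eq_zero_iff_le] using hr1
  refine ⟨C.toNNReal, fun b hb β hβ0 hβ a l hl => ?_⟩
  rw [ENNReal.coe_toNNReal hCt]
  set K : ℝ := 2 ^ (n + 4) * β with hK
  have hK0 : 0 < K := by positivity
  set A : ℕ → Set (Rn n) := fun s => {x | K * s < ‖b x - cubeMean b a l‖} with hA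
  have hAm : ∀ s, NullMeasurableSet (A s) (volume.restrict (cube a l)) := fun s =>
    nullMeasurableSet_lt aemeasurable_const
      (hb.aestronglyMeasurable.sub aestronglyMeasurable_const).norm.aemeasurable.restrict
  have hpt : ∀ x, ENNReal.ofReal (Real.exp (‖b x - cubeMean b a l‖ / K / 2)) ≤
      ENNReal.ofReal (Real.exp (1 / 2)) +
        ∑' s : ℕ, ENNReal.ofReal (Real.exp (((s : ℝ) + 1) / 2)) * (A s).indicator 1 x := by
    intro x
    set u := ‖b x - cubeMean b a l‖ / K with hu
    by_cases h0 : u ≤ 1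
    · exact (ENNReal.ofReal_le_ofReal (Real.exp_le_exp.2 (by linarith))).trans le_self_add
    -- For `u > 1` the single term with index `⌈u⌉₊ - 1` suffices: its level set contains `x`, and
    -- its weight dominates `exp (u / 2)`.
    · refine le_trans ?_ (le_add_self.trans' (ENNReal.le_tsum (⌈u⌉₊ - 1)))
      push Not at h0
      have hpos : 0 < ⌈u⌉₊ := Nat.ceil_pos.2 (zero_lt_one.trans h0)
      have hmem : x ∈ A (⌈u⌉₊ - 1) := by
        have h1 : ((⌈u⌉₊ - 1 : ℕ) : ℝ) < u := Nat.lt_ceil.1 (by omega)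
        simp only [hA, mem_ofPred_eq]
        rw [hu, lt_div_iff₀ hK0] at h1
        linarith
      rw [indicator_of_mem hmem, Pi.one_apply, mul_one]
      refine ENNReal.ofReal_le_ofReal (Real.exp_le_exp.2 ?_)
      have h2 : ((⌈u⌉₊ - 1 : ℕ) : ℝ) + 1 = ⌈u⌉₊ := by
        rw [← Nat.cast_add_one, Nat.sub_add_cancel hpos]
      rw [h2]
      have := Nat.le_ceil u
      linarith
  calc _ ≤ ∫⁻ x in cube a l, (ENNReal.ofReal (Real.exp (1 / 2)) +
        ∑' s : ℕ, ENNReal.ofReal (Real.exp (((s : ℝ) + 1) / 2)) * (A s).indicator 1 x) :=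
        lintegral_mono hpt
    _ = ENNReal.ofReal (Real.exp (1 / 2)) * volume (cube a l) +
        ∑' s : ℕ, ENNReal.ofReal (Real.exp (((s : ℝ) + 1) / 2)) *
          (volume.restrict (cube a l)) (A s) := by
      rw [lintegral_add_left measurable_const, setLIntegral_const, lintegral_tsum]
      · congr 1
        refine tsum_congr fun s => ?_
        rw [lintegral_const_mul'' (f := (A s).indicator 1) _ ((aemeasurable_const (b := (1 : ℝ≥0∞))).indicator₀ (hAm s)),
          lintegral_indicator_one₀ (hAm s)]
      · exact fun s => ((aemeasurable_const (b := (1 : ℝ≥0∞))).indicator₀ (hAm s)).const_mul _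
    _ ≤ ENNReal.ofReal (Real.exp (1 / 2)) * volume (cube a l) +
        ∑' s : ℕ, ENNReal.ofReal (Real.exp (((s : ℝ) + 1) / 2)) *
          (2⁻¹ ^ s * volume (cube a l)) := by
      gcongr with s
      rw [Measure.restrict_apply' (measurableSet_cube a l), inter_comm]
      exact volume_lt_norm_sub_cubeMean_le hb hβ0.le hβ a hl s
    _ = C * volume (cube a l) := by
      rw [hC, add_mul, ← ENNReal.tsum_mul_right]
      congr 1
      refine tsum_congr fun s => ?_
      rw [hr, mul_pow, ← ENNReal.ofReal_pow (Real.exp_pos _).le, ← Real.exp_nat_mul,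
        ← mul_assoc, ← mul_assoc, ← ENNReal.ofReal_mul (Real.exp_pos _).le, ← Real.exp_add]
      congr 4
      ring

/-! ### The Young function and Luxemburg averages -/

theorem le_Phi {s : ℝ} (hs : 0 ≤ s) : s ≤ Phi s :=
  le_mul_of_one_le_right hs (le_add_of_nonneg_right (le_max_left _ _))

theorem Phi_mono {s t : ℝ} (hs : 0 ≤ s) (hst : s ≤ t) : Phi s ≤ Phi t := by
  unfold Phi
  rcases hs.eq_or_lt with rfl | hs
  · simpa using mul_nonneg hst (add_nonneg zero_le_one (le_max_left _ _))
  · have := Real.log_le_log hs hst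
    gcongr
    linarith

/-- A crude Young inequality. Either `t` is at most the logarithmic factor in `Phi s`, or `s ≤ exp
t`, and then `s * t ≤ exp (2 * t)`. -/
theorem mul_le_Phi_add_exp {s t : ℝ} (hs : 0 ≤ s) (ht : 0 ≤ t) :
    s * t ≤ Phi s + Real.exp (2 * t) := by
  by_cases h : t ≤ 1 + max 0 (Real.log s)
  · have : s * t ≤ Phi s := mul_le_mul_of_nonneg_left h hs
    linarith [Real.exp_pos (2 * t)]
  · push Not at h
    have h1 : Real.log s ≤ t - 1 := by linarith [le_max_right 0 (Real.log s)]
    have h2 : s ≤ Real.exp t := by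
      rcases hs.eq_or_lt with rfl | hs
      · exact (Real.exp_pos t).le
      · rw [← Real.log_le_iff_le_exp hs]; linarith
    have h3 : t ≤ Real.exp t := by linarith [Real.add_one_le_exp t]
    have h4 : s * t ≤ Real.exp t * Real.exp t := by gcongr
    rw [← Real.exp_add, ← two_mul] at h4
    linarith [le_Phi hs]

theorem measurable_Phi : Measurable Phi := by
  unfold Phi
  fun_prop

/-- Reduces an estimate by the Luxemburg average to one for each admissible `s`; it also covers the
case where there is none and the average is infinite. -/
theorem le_luxemburg_mul {f : Rn n → 𝕜} {a : Rn n} {l : ℝ} {x y : ℝ≥0∞} (hy0 : y ≠ 0)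
    (hy : y ≠ ∞)
    (h : ∀ s : ℝ, 0 < s → (⨍⁻ x in cube a l, ENNReal.ofReal (Phi (‖f x‖ / s)) ∂volume) ≤ 1 →
      x ≤ ENNReal.ofReal s * y) : x ≤ luxemburg f a l * y := by
  rw [← ENNReal.div_le_iff hy0 hy]
  refine le_iInf fun s => le_iInf fun hs => le_iInf fun h1 => ?_
  rw [ENNReal.div_le_iff hy0 hy]
  exact h s hs h1

theorem lintegral_enorm_le_luxemburg (f : Rn n → 𝕜) (a : Rn n) {l : ℝ} (hl : 0 < l) :
    ∫⁻ x in cube a l, ‖f x‖ₑ ≤ luxemburg f a l * volume (cube a l) := by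
  refine le_luxemburg_mul (volume_cube_ne_zero a hl) (volume_cube_ne_top a l) fun s hs h => ?_
  rw [setLAverage_eq, ENNReal.div_le_iff (volume_cube_ne_zero a hl) (volume_cube_ne_top a l),
    one_mul] at h
  calc ∫⁻ x in cube a l, ‖f x‖ₑ
      ≤ ∫⁻ x in cube a l, ENNReal.ofReal s * ENNReal.ofReal (Phi (‖f x‖ / s)) := by
        refine lintegral_mono fun x => ?_
        rw [← ENNReal.ofReal_mul hs.le, ← ofReal_norm]
        refine ENNReal.ofReal_le_ofReal ?_
        have := le_Phi (div_nonneg (norm_nonneg (f x)) hs.le)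
        rwa [div_le_iff₀' hs] at this
    _ = ENNReal.ofReal s * ∫⁻ x in cube a l, ENNReal.ofReal (Phi (‖f x‖ / s)) :=
      lintegral_const_mul' _ _ ENNReal.ofReal_ne_top
    _ ≤ _ := by gcongr

/-- The generalized Hölder inequality between `L log L` and `BMO`. -/
theorem exists_lintegral_sub_cubeMean_mul_le (n : ℕ) (𝕜 : Type*) [RCLike 𝕜] : ∃ C : ℝ≥0,
    ∀ b : Rn n → 𝕜, LocallyIntegrable b → ∀ β : ℝ, 0 ≤ β → bmoNorm b ≤ ENNReal.ofReal β →
    ∀ f : Rn n → 𝕜, AEStronglyMeasurable f volume → ∀ (a : Rn n) (l : ℝ), 0 < l →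
      ∫⁻ x in cube a l, ‖(b x - cubeMean b a l) * f x‖ₑ ≤
        C * ENNReal.ofReal β * (luxemburg f a l * volume (cube a l)) := by
  obtain ⟨C, hC⟩ := exists_lintegral_exp_le n 𝕜
  refine ⟨(1 + C) * (4 * 2 ^ (n + 4)), fun b hb β hβ0 hβ f hf a l hl => ?_⟩
  have hV0 := volume_cube_ne_zero a hl
  have hVt := volume_cube_ne_top a l
  -- For `β = 0` the function equals its mean almost everywhere on the cube; the rescaling by `β`
  -- below needs `β > 0`.
  rcases hβ0.eq_or_lt with rfl | hβ0
  · have h1 : ∫⁻ x in cube a l, ‖b x - cubeMean b a l‖ₑ = 0 := by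
      simpa using lintegral_sub_cubeMean_le hβ a hl
    rw [lintegral_eq_zero_iff' (f := fun x => ‖b x - cubeMean b a l‖ₑ)
      (hb.aestronglyMeasurable.sub aestronglyMeasurable_const).enorm.restrict] at h1
    have h2 : ∫⁻ x in cube a l, ‖(b x - cubeMean b a l) * f x‖ₑ = ∫⁻ x in cube a l, 0 := by
      refine lintegral_congr_ae ?_
      filter_upwards [h1] with x hx
      have hx' : b x - cubeMean b a l = 0 := by simpa using hx
      simp [hx']
    rw [h2]
    simp
  -- The factor `4` matches constants: with `t = ‖b - mean‖ / D`, the `exp (2 * t)` of the Young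
  -- inequality is exactly the integrand with a known bound.
  · set D : ℝ := 4 * 2 ^ (n + 4) * β with hD
    have hD0 : 0 < D := by positivity
    have hfin : ((1 + C : ℝ≥0) : ℝ≥0∞) * (4 * 2 ^ (n + 4)) * ENNReal.ofReal β =
        (1 + C) * ENNReal.ofReal D := by
      rw [hD, ENNReal.ofReal_mul (by positivity), ENNReal.ofReal_mul (by positivity),
        ENNReal.ofReal_pow zero_le_two]
      simp [mul_assoc]
    rw [ENNReal.coe_mul, show ((4 * 2 ^ (n + 4) : ℝ≥0) : ℝ≥0∞) = 4 * 2 ^ (n + 4) by simp, hfin,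
      mul_left_comm]
    refine le_luxemburg_mul (mul_ne_zero (mul_ne_zero (by simp) (by simpa using hD0)) hV0)
      (ENNReal.mul_ne_top (ENNReal.mul_ne_top (by simp) (by simp)) hVt) fun s hs h => ?_
    rw [setLAverage_eq, ENNReal.div_le_iff hV0 hVt, one_mul] at h
    calc ∫⁻ x in cube a l, ‖(b x - cubeMean b a l) * f x‖ₑ
        ≤ ∫⁻ x in cube a l, ENNReal.ofReal (s * D) * (ENNReal.ofReal (Phi (‖f x‖ / s)) +
            ENNReal.ofReal (Real.exp (‖b x - cubeMean b a l‖ / (2 ^ (n + 4) * β) / 2))) := by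
          refine lintegral_mono fun x => ?_
          rw [← ofReal_norm, ← ENNReal.ofReal_add ((div_nonneg (norm_nonneg _) hs.le).trans
            (le_Phi (div_nonneg (norm_nonneg _) hs.le))) (Real.exp_pos _).le,
            ← ENNReal.ofReal_mul (by positivity)]
          refine ENNReal.ofReal_le_ofReal ?_
          have h1 := mul_le_Phi_add_exp (div_nonneg (norm_nonneg (f x)) hs.le)
            (div_nonneg (norm_nonneg (b x - cubeMean b a l)) hD0.le)
          have h2 : 2 * (‖b x - cubeMean b a l‖ / D) =
              ‖b x - cubeMean b a l‖ / (2 ^ (n + 4) * β) / 2 := by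
            rw [hD]; field_simp; ring
          rw [h2] at h1
          calc ‖(b x - cubeMean b a l) * f x‖ =
                s * D * (‖f x‖ / s * (‖b x - cubeMean b a l‖ / D)) := by
                rw [norm_mul]; field_simp
            _ ≤ _ := by gcongr
      _ = ENNReal.ofReal (s * D) * ((∫⁻ x in cube a l, ENNReal.ofReal (Phi (‖f x‖ / s))) +
          ∫⁻ x in cube a l,
            ENNReal.ofReal (Real.exp (‖b x - cubeMean b a l‖ / (2 ^ (n + 4) * β) / 2))) := by
        rw [lintegral_const_mul' _ _ ENNReal.ofReal_ne_top, lintegral_add_left']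
        exact (measurable_Phi.comp_aemeasurable
          (hf.norm.aemeasurable.div_const s)).ennreal_ofReal.restrict
      _ ≤ ENNReal.ofReal (s * D) * (volume (cube a l) + C * volume (cube a l)) := by
        gcongr
        exact hC b hb β hβ0 hβ a l hl
      _ = _ := by
        rw [ENNReal.ofReal_mul hs.le]; ring

theorem luxemburg_le_of_ae_norm_le {f : Rn n → 𝕜} {B : ℝ} (hB : 0 < B)
    (hf : ∀ᵐ x, ‖f x‖ ≤ B) (a : Rn n) {l : ℝ} (hl : 0 < l) :
    luxemburg f a l ≤ ENNReal.ofReal B := by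
  refine iInf_le_of_le B (iInf_le_of_le hB (iInf_le_of_le ?_ le_rfl))
  rw [setLAverage_eq, ENNReal.div_le_iff (volume_cube_ne_zero a hl) (volume_cube_ne_top a l)]
  calc _ ≤ ∫⁻ x in cube a l, 1 := by
        refine lintegral_mono_ae (ae_restrict_of_ae ?_)
        filter_upwards [hf] with x hx
        rw [← ENNReal.ofReal_one]
        refine ENNReal.ofReal_le_ofReal ?_
        have := Phi_mono (div_nonneg (norm_nonneg (f x)) hB.le) ((div_le_one hB).2 hx)
        simpa [Phi] using this
    _ = _ := by simp

/-! ### Compactly supported functions in all Lebesgue spaces -/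

/-- `f` has compact support and lies in `L^k` for all finite `k`. -/
def IsNice (f : Rn n → 𝕜) : Prop :=
  HasCompactSupport f ∧ ∀ k : ℕ, MemLp f k volume

/-- The exponential of a multiple of `‖b - c‖` is integrable and dominates every power, through `t ^
k / k! ≤ exp t`. -/
theorem IsBMO.memLp_cube {b : Rn n → 𝕜} (hb : IsBMO b) (k : ℕ) (a : Rn n) {l : ℝ} (hl : 0 < l) :
    MemLp b k (volume.restrict (cube a l)) := by
  have : IsFiniteMeasure (volume.restrict (cube a l)) :=
    ⟨by simpa using (volume_cube_ne_top a l).lt_top⟩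
  rcases Nat.eq_zero_or_pos k with rfl | hk
  · simpa using hb.1.aestronglyMeasurable.restrict
  set c := cubeMean b a l
  suffices h : MemLp (fun x => b x - c) k (volume.restrict (cube a l)) by
    convert h.add (memLp_const c) using 1
    ext x
    simp
  have hm : AEStronglyMeasurable (fun x => b x - c) (volume.restrict (cube a l)) :=
    (hb.1.aestronglyMeasurable.sub aestronglyMeasurable_const).restrict
  obtain ⟨C, hC⟩ := exists_lintegral_exp_le n 𝕜
  set β : ℝ := (bmoNorm b).toReal + 1 with hβ
  have hβ0 : 0 < β := by positivity
  have hβ1 : bmoNorm b ≤ ENNReal.ofReal β := by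
    rw [← ENNReal.ofReal_toReal hb.2.ne]
    exact ENNReal.ofReal_le_ofReal (by simp [hβ])
  have h1 := hC b hb.1 β hβ0 hβ1 a l hl
  set D : ℝ := 2 ^ (n + 4) * β * 2 with hD
  have hD0 : 0 < D := by positivity
  have hfin : ∫⁻ x in cube a l, ‖‖b x - c‖ ^ k‖ₑ < ∞ := by
    calc ∫⁻ x in cube a l, ‖‖b x - c‖ ^ k‖ₑ
        ≤ ∫⁻ x in cube a l, ENNReal.ofReal (D ^ k * k.factorial) *
          ENNReal.ofReal (Real.exp (‖b x - c‖ / (2 ^ (n + 4) * β) / 2)) := by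
          refine lintegral_mono fun x => ?_
          rw [← ofReal_norm, ← ENNReal.ofReal_mul (by positivity)]
          refine ENNReal.ofReal_le_ofReal ?_
          have h2 := Real.pow_div_factorial_le_exp (‖b x - c‖ / D) (by positivity) k
          have h3 : (0 : ℝ) < k.factorial := by positivity
          rw [norm_pow, norm_norm, div_div, ← hD]
          rw [div_le_iff₀ h3, div_pow, div_le_iff₀ (by positivity)] at h2
          linarith
      _ ≤ ENNReal.ofReal (D ^ k * k.factorial) * (C * volume (cube a l)) := by
        rw [lintegral_const_mul' _ _ ENNReal.ofReal_ne_top]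
        gcongr
      _ < ∞ := ENNReal.mul_lt_top ENNReal.ofReal_lt_top
        (ENNReal.mul_lt_top ENNReal.coe_lt_top (volume_cube_ne_top a l).lt_top)
  rw [← integrable_norm_rpow_iff hm (by exact_mod_cast hk.ne') (by simp)]
  simp only [ENNReal.toReal_natCast, Real.rpow_natCast]
  exact ⟨(hm.norm.pow k), hfin⟩

theorem exists_subset_cube_of_isCompact {K : Set (Rn n)} (hK : IsCompact K) :
    ∃ N : ℕ, ∀ M ≥ N, K ⊆ cube (WithLp.toLp 2 fun _ => -((M : ℝ) + 1)) (2 * (M + 1)) := by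
  obtain ⟨R, hR⟩ := hK.isBounded.exists_norm_le
  obtain ⟨N, hN⟩ := exists_nat_ge R
  refine ⟨N, fun M hM x hx i => ?_⟩
  have h1 := (abs_apply_le_norm x i).trans ((hR x hx).trans hN)
  have h2 : (N : ℝ) ≤ M := by exact_mod_cast hM
  rw [abs_le] at h1
  simp only
  constructor <;> linarith [h1.1, h1.2]

/-- Hölder with exponents `2 * k`, after cutting `b` off to a cube containing the support of `f`.
The product with a symbol need not be bounded, so bounded functions would not be a stable class. -/
theorem IsNice.mul_left {b f : Rn n → 𝕜} (hb : IsBMO b) (hf : IsNice f) : IsNice (b * f) := by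
  refine ⟨hf.1.mul_left, fun k => ?_⟩
  obtain ⟨N, hN⟩ := exists_subset_cube_of_isCompact hf.1
  set Q := cube (WithLp.toLp 2 fun _ => -((N : ℝ) + 1)) (2 * (N + 1)) with hQ
  have heq : b * f = Q.indicator b * f := by
    ext x
    by_cases hx : x ∈ Q
    · simp [hx]
    · have : f x = 0 := image_eq_zero_of_notMem_tsupport fun h => hx (hN N le_rfl h)
      simp [this]
  rw [heq]
  have h1 : MemLp (Q.indicator b) ((2 * k : ℕ) : ℝ≥0∞) volume :=
    (memLp_indicator_iff_restrict (measurableSet_cube _ _)).2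
      (hb.memLp_cube (2 * k) _ (by positivity))
  have hH : ENNReal.HolderTriple ((2 * k : ℕ) : ℝ≥0∞) ((2 * k : ℕ) : ℝ≥0∞) (k : ℝ≥0∞) := by
    constructor
    rw [Nat.cast_mul, Nat.cast_two, ENNReal.mul_inv (by simp) (by simp), ← add_mul,
      ENNReal.inv_two_add_inv_two, one_mul]
  exact (hf.2 (2 * k)).mul h1

end

section

variable {n m : ℕ} {𝕜 : Type*} [RCLike 𝕜]

/-! ### Calderón-Zygmund kernels -/

theorem norm_sub_le_sum {E : Type*} [NormedAddCommGroup E] {ι : Type*} [Fintype ι] (y : ι → E)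
    (k l : ι) : ‖y k - y l‖ ≤ ∑ k, ∑ l, ‖y k - y l‖ :=
  (Finset.single_le_sum (f := fun l => ‖y k - y l‖) (fun _ _ => norm_nonneg _)
    (Finset.mem_univ l)).trans (Finset.single_le_sum (f := fun k => ∑ l, ‖y k - y l‖)
      (fun _ _ => Finset.sum_nonneg fun _ _ => norm_nonneg _) (Finset.mem_univ k))

/-- The variables are moved one at a time. Off the diagonal each move tends to zero by the
smoothness condition. Continuity is what yields measurability of the kernel. -/
theorem IsCZKernel.continuousAt {A ε : ℝ} {K : (Fin (m + 1) → Rn n) → 𝕜} (hK : IsCZKernel A ε K)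
    (hε : 0 < ε) {y : Fin (m + 1) → Rn n} (hy : ∃ k l, y k ≠ y l) : ContinuousAt K y := by
  have key : ∀ S : Finset (Fin (m + 1)),
      Filter.Tendsto (fun y' => K (S.piecewise y' y)) (𝓝 y) (𝓝 (K y)) := by
    intro S
    induction S using Finset.induction_on with
    | empty => simp
    | insert j S hj ih =>
      simp only [Finset.piecewise_insert]
      set z : (Fin (m + 1) → Rn n) → Fin (m + 1) → Rn n := fun y' => S.piecewise y' y with hz
      have hzc : Filter.Tendsto z (𝓝 y) (𝓝 y) := by
        rw [tendsto_pi_nhds]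
        intro i
        by_cases hi : i ∈ S
        · simpa [hz, hi] using (continuous_apply i).tendsto y
        · simp [hz, hi]
      have hzi : ∀ i, Filter.Tendsto (fun y' => z y' i) (𝓝 y) (𝓝 (y i)) :=
        fun i => (tendsto_pi_nhds.1 hzc) i
      have hyi : ∀ i, Filter.Tendsto (fun y' : Fin (m + 1) → Rn n => y' i) (𝓝 y) (𝓝 (y i)) :=
        fun i => (continuous_apply i).tendsto y
      obtain ⟨k₀, hk₀⟩ : ∃ k, y j ≠ y k := by
        by_contra! hcon
        obtain ⟨k, l, hkl⟩ := hy
        exact hkl ((hcon k).symm.trans (hcon l))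
      have hpos : 0 < ‖y j - y k₀‖ := norm_pos_iff.2 (sub_ne_zero.2 hk₀)
      set D : (Fin (m + 1) → Rn n) → ℝ := fun y => ∑ k, ∑ l, ‖y k - y l‖ with hD
      have hD0 : 0 < D y := hpos.trans_le (norm_sub_le_sum y j k₀)
      have hDc : Filter.Tendsto (fun y' => D (z y')) (𝓝 y) (𝓝 (D y)) :=
        tendsto_finsetSum _ fun k _ => tendsto_finsetSum _ fun l _ => ((hzi k).sub (hzi l)).norm
      have hbound : ∀ᶠ y' in 𝓝 y, ‖K (z y') - K (Function.update (z y') j (y' j))‖ ≤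
          A * ‖z y' j - y' j‖ ^ ε / (D (z y')) ^ ((m : ℝ) * n + ε) := by
        have h1 : ∀ᶠ y' in 𝓝 y, ‖z y' j - y' j‖ < 1 / 2 * ‖z y' j - z y' k₀‖ := by
          refine (((hzi j).sub (hyi j)).norm).eventually_lt
            ((((hzi j).sub (hzi k₀)).norm).const_mul (1 / 2)) ?_
          simp only [sub_self, norm_zero]
          positivity
        filter_upwards [h1] with y' h
        refine hK.smooth (z y') j (y' j) ⟨j, k₀, fun heq => ?_⟩ ⟨k₀, h.le⟩
        rw [heq, sub_self, norm_zero, mul_zero] at h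
        exact absurd h (norm_nonneg _).not_gt
      have hlim : Filter.Tendsto (fun y' => A * ‖z y' j - y' j‖ ^ ε /
          (D (z y')) ^ ((m : ℝ) * n + ε)) (𝓝 y) (𝓝 0) := by
        have h1 : Filter.Tendsto (fun y' => ‖z y' j - y' j‖ ^ ε) (𝓝 y) (𝓝 0) := by
          have := (((hzi j).sub (hyi j)).norm).rpow_const (p := ε) (Or.inr hε.le)
          simpa [Real.zero_rpow hε.ne'] using this
        have h2 : Filter.Tendsto (fun y' => (D (z y')) ^ ((m : ℝ) * n + ε)) (𝓝 y)
            (𝓝 (D y ^ ((m : ℝ) * n + ε))) := hDc.rpow_const (Or.inl hD0.ne')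
        have h3 := (h1.const_mul A).div h2 (Real.rpow_pos_of_pos hD0 _).ne'
        rw [mul_zero, zero_div] at h3
        exact h3
      have hsub := squeeze_zero_norm' hbound hlim
      have h := ih.sub hsub
      rw [sub_zero] at h
      exact h.congr fun y' => sub_sub_cancel _ _
  simpa [ContinuousAt] using key Finset.univ

theorem lintegral_fin_prod_eq_prod {X : Type*} [MeasureSpace X] [SigmaFinite (volume : Measure X)]
    {m : ℕ} (f : Fin m → X → ℝ≥0∞) (hf : ∀ j, AEMeasurable (f j) volume) :
    ∫⁻ y : Fin m → X, ∏ j, f j (y j) = ∏ j, ∫⁻ x, f j x := by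
  induction m with
  | zero =>
    simp only [volume_pi, Finset.univ_eq_empty, Finset.prod_empty, lintegral_const]
    simp
  | succ m ih =>
    have h := (measurePreserving_piFinSuccAbove (fun _ => (volume : Measure X)) (0 : Fin (m + 1))).symm
    rw [volume_pi, ← h.lintegral_comp_emb (MeasurableEquiv.measurableEmbedding _)]
    simp_rw [MeasurableEquiv.piFinSuccAbove_symm_apply, Fin.insertNthEquiv,
      Fin.prod_univ_succ, Fin.insertNth_zero, Equiv.coe_fn_mk, Fin.cons_succ, Fin.cons_zero,
      cast_eq]
    rw [← ih _ fun j => hf j.succ, ← volume_pi]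
    refine lintegral_prod_mul (μ := volume) (ν := volume) (f := f 0) (g := fun y : Fin m → X => ∏ j, f j.succ (y j)) (hf 0) ?_
    have hmap : ∀ j : Fin m, Measure.QuasiMeasurePreserving (fun y : Fin m → X => y j) volume volume :=
      fun j => Measure.quasiMeasurePreserving_eval (fun _ => (volume : Measure X)) j
    exact Finset.aemeasurable_fun_prod _ fun j _ =>
      (hf j.succ).comp_quasiMeasurePreserving (hmap j)

theorem measurableSet_far (x : Rn n) (c : ℝ) :
    MeasurableSet {y : Fin m → Rn n | ∃ j, c ≤ ‖x - y j‖} := by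
  rw [Set.ofPred_exists]
  refine MeasurableSet.iUnion fun j => ?_
  exact measurableSet_le measurable_const (by fun_prop)

/-- The kernel oscillates little far away, in the averaged sense needed for sparse bounds. -/
theorem IsCZKernel.exists_lintegral_sub_le {A ε : ℝ} {K : (Fin (m + 1) → Rn n) → 𝕜}
    (hK : IsCZKernel A ε K) (hε : 0 < ε) : ∃ C : ℝ≥0, ∀ (r : ℝ) (x x' x₀ : Rn n), 0 < r →
      ‖x - x'‖ ≤ r → ‖x - x₀‖ ≤ r → ∀ (g : Fin m → Rn n → 𝕜) (v : Fin m → ℝ≥0∞),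
      (∀ j, AEStronglyMeasurable (g j) volume) →
      (∀ j, ∀ ρ : ℝ, 0 < ρ → ∫⁻ z in Metric.closedBall x₀ ρ, ‖g j z‖ₑ ≤
        v j * ENNReal.ofReal ρ ^ n) →
      ∫⁻ y in {y : Fin m → Rn n | ∃ j, 2 * r ≤ ‖x - y j‖},
        ‖K (Fin.cons x y) - K (Fin.cons x' y)‖ₑ * ∏ j, ‖g j (y j)‖ₑ ≤ C * ∏ j, v j := by
  set q : ℝ≥0∞ := ENNReal.ofReal ((1 / 2 : ℝ) ^ ε) with hq
  have hq1 : q < 1 := by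
    rw [hq, ← ENNReal.ofReal_one, ENNReal.ofReal_lt_ofReal_iff one_pos]
    exact Real.rpow_lt_one (by norm_num) (by norm_num) hε
  set C : ℝ≥0∞ := ∑' k : ℕ, ENNReal.ofReal (|A| * 4 ^ (m * n)) * q ^ (k + 1) with hC
  have hCt : C ≠ ∞ := by
    rw [hC, ENNReal.tsum_mul_left]
    refine ENNReal.mul_ne_top ENNReal.ofReal_ne_top ?_
    simp_rw [pow_succ]
    rw [ENNReal.tsum_mul_right, ENNReal.tsum_geometric]
    refine ENNReal.mul_ne_top ?_ (ne_top_of_lt hq1)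
    simpa [tsub_eq_zero_iff_le] using hq1
  refine ⟨C.toNNReal, fun r x x' x₀ hr hxx' hxx₀ g v hg hv => ?_⟩
  rw [ENNReal.coe_toNNReal hCt]
  -- Dyadic shells in the largest distance `‖x - y j‖`. On shell `k` the smoothness condition gains
  -- `2 ^ (-(k + 1) * ε)` over the size of the kernel, and this gain sums.
  set S : ℕ → Set (Fin m → Rn n) := fun k =>
    {y | (∃ j, 2 ^ (k + 1) * r ≤ ‖x - y j‖) ∧ ∀ j, ‖x - y j‖ < 2 ^ (k + 2) * r} with hS
  have hSm : ∀ k, MeasurableSet (S k) := by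
    intro k
    refine (measurableSet_far x _).inter ?_
    rw [show (fun y : Fin m → Rn n => ∀ j, ‖x - y j‖ < 2 ^ (k + 2) * r) =
      {y | ∀ j, ‖x - y j‖ < 2 ^ (k + 2) * r} from rfl, Set.ofPred_forall]
    exact MeasurableSet.iInter fun j => measurableSet_lt (by fun_prop) measurable_const
  have hcover : {y : Fin m → Rn n | ∃ j, 2 * r ≤ ‖x - y j‖} ⊆ ⋃ k, S k := by
    rintro y ⟨j₀, hj₀⟩
    have hex : ∃ k : ℕ, ∀ j, ‖x - y j‖ < 2 ^ (k + 2) * r := by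
      have h1 : ∀ j, ∀ᶠ k : ℕ in Filter.atTop, ‖x - y j‖ < 2 ^ (k + 2) * r := by
        intro j
        have : Filter.Tendsto (fun k : ℕ => (2 : ℝ) ^ (k + 2) * r) Filter.atTop Filter.atTop :=
          ((tendsto_pow_atTop_atTop_of_one_lt one_lt_two).comp
            (Filter.tendsto_add_atTop_nat 2)).atTop_mul_const hr
        exact this.eventually_gt_atTop _
      exact (Filter.eventually_all.2 h1).exists
    classical
    refine mem_iUnion.2 ⟨Nat.find hex, ?_, Nat.find_spec hex⟩
    rcases hk : Nat.find hex with _ | k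
    · exact ⟨j₀, by simpa using hj₀⟩
    · have := Nat.find_min hex (m := k) (by omega)
      push Not at this
      exact this
  have hbound : ∀ k, ∫⁻ y in S k, ‖K (Fin.cons x y) - K (Fin.cons x' y)‖ₑ * ∏ j, ‖g j (y j)‖ₑ ≤
      ENNReal.ofReal (|A| * 4 ^ (m * n)) * q ^ (k + 1) * ∏ j, v j := by
    intro k
    set R : ℝ := 2 ^ (k + 1) * r with hR
    have hR0 : 0 < R := by positivity
    have hpt : ∀ y ∈ S k, ‖K (Fin.cons x y) - K (Fin.cons x' y)‖ₑ * ∏ j, ‖g j (y j)‖ₑ ≤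
        ENNReal.ofReal (|A| * r ^ ε / R ^ ((m : ℝ) * n + ε)) * ∏ j, ‖g j (y j)‖ₑ := by
      rintro y ⟨⟨j, hj⟩, -⟩
      gcongr
      rw [← ofReal_norm]
      refine ENNReal.ofReal_le_ofReal ?_
      have hne : ∃ k l, (Fin.cons x y : Fin (m + 1) → Rn n) k ≠ (Fin.cons x y : Fin (m + 1) → Rn n) l := by
        refine ⟨0, j.succ, fun h => ?_⟩
        simp only [Fin.cons_zero, Fin.cons_succ] at h
        rw [← h, sub_self, norm_zero] at hj
        exact absurd hj hR0.not_ge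
      have h1 : (2 : ℝ) * r ≤ R := by
        rw [hR, pow_succ, mul_comm (2 ^ k), mul_assoc]
        have : r ≤ 2 ^ k * r := le_mul_of_one_le_left hr.le (one_le_pow₀ one_le_two)
        linarith
      have h2 := hK.smooth (Fin.cons x y) 0 x' hne ⟨j.succ, by
        simp only [Fin.cons_zero, Fin.cons_succ]; linarith⟩
      rw [Fin.update_cons_zero, Fin.cons_zero] at h2
      refine h2.trans ?_
      have h3 : R ≤ ∑ k, ∑ l, ‖(Fin.cons x y : Fin (m + 1) → Rn n) k -
          (Fin.cons x y : Fin (m + 1) → Rn n) l‖ := by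
        refine hj.trans ?_
        have := norm_sub_le_sum (Fin.cons x y : Fin (m + 1) → Rn n) 0 j.succ
        simpa only [Fin.cons_zero, Fin.cons_succ] using this
      gcongr
      exact le_abs_self A
    -- On a shell every `y j` lies in one ball around `x₀`, so the integral over the shell splits
    -- into a product of ball integrals.
    have hsub : S k ⊆ univ.pi fun _ => Metric.closedBall x₀ (2 ^ (k + 3) * r) := by
      rintro y ⟨-, hy⟩ j -
      rw [Metric.mem_closedBall, dist_eq_norm]
      have h1 : (1 : ℝ) ≤ 2 ^ (k + 2) := one_le_pow₀ one_le_two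
      calc ‖y j - x₀‖ = ‖(x - x₀) - (x - y j)‖ := by congr 1; abel
        _ ≤ ‖x - x₀‖ + ‖x - y j‖ := norm_sub_le _ _
        _ ≤ r + 2 ^ (k + 2) * r := add_le_add hxx₀ (hy j).le
        _ ≤ 2 ^ (k + 3) * r := by rw [pow_succ (2 : ℝ) (k + 2)]; nlinarith
    calc _ ≤ ∫⁻ y in S k, ENNReal.ofReal (|A| * r ^ ε / R ^ ((m : ℝ) * n + ε)) *
            ∏ j, ‖g j (y j)‖ₑ := setLIntegral_mono' (hSm k) hpt
      _ = ENNReal.ofReal (|A| * r ^ ε / R ^ ((m : ℝ) * n + ε)) *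
          ∫⁻ y in S k, ∏ j, ‖g j (y j)‖ₑ := lintegral_const_mul' _ _ ENNReal.ofReal_ne_top
      _ ≤ ENNReal.ofReal (|A| * r ^ ε / R ^ ((m : ℝ) * n + ε)) *
          ∫⁻ y : Fin m → Rn n, ∏ j, (Metric.closedBall x₀ (2 ^ (k + 3) * r)).indicator (fun z => ‖g j z‖ₑ) (y j) := by
        refine mul_le_mul_right ?_ _
        rw [← lintegral_indicator (hSm k)]
        refine lintegral_mono fun y => ?_
        by_cases hy : y ∈ S k
        · rw [indicator_of_mem hy]
          gcongr with j
          rw [indicator_of_mem (hsub hy j (mem_univ j))]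
        · rw [indicator_of_notMem hy]
          exact zero_le
      _ = ENNReal.ofReal (|A| * r ^ ε / R ^ ((m : ℝ) * n + ε)) *
          ∏ j, ∫⁻ z in Metric.closedBall x₀ (2 ^ (k + 3) * r), ‖g j z‖ₑ := by
        rw [lintegral_fin_prod_eq_prod _ fun j =>
          (hg j).enorm.indicator Metric.isClosed_closedBall.measurableSet]
        simp_rw [lintegral_indicator Metric.isClosed_closedBall.measurableSet]
      _ ≤ ENNReal.ofReal (|A| * r ^ ε / R ^ ((m : ℝ) * n + ε)) *
          ∏ j, (v j * ENNReal.ofReal (2 ^ (k + 3) * r) ^ n) := by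
        gcongr with j
        exact hv j _ (by positivity)
      _ = ENNReal.ofReal (|A| * 4 ^ (m * n)) * q ^ (k + 1) * ∏ j, v j := by
        rw [Finset.prod_mul_distrib, Finset.prod_const, Finset.card_univ, Fintype.card_fin,
          ← pow_mul, mul_comm (∏ j, v j), ← mul_assoc]
        congr 1
        rw [hq, ← ENNReal.ofReal_pow (by positivity), ← ENNReal.ofReal_pow (by positivity),
          ← ENNReal.ofReal_mul (by positivity), ← ENNReal.ofReal_mul (by positivity)]
        congr 1
        have h1 : R ^ ((m : ℝ) * n + ε) = R ^ (m * n) * R ^ ε := by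
          rw [Real.rpow_add hR0, ← Nat.cast_mul, Real.rpow_natCast]
        have h3 : (2 : ℝ) ^ (k + 3) * r = 4 * R := by rw [hR]; ring
        rw [h3, mul_pow, h1]
        have h4 : ((1 / 2 : ℝ) ^ ε) ^ (k + 1) * R ^ ε = r ^ ε := by
          rw [← Real.rpow_natCast, ← Real.rpow_mul (by norm_num), mul_comm ε, Real.rpow_mul (by norm_num),
            Real.rpow_natCast, ← Real.mul_rpow (by positivity) hR0.le, hR, ← mul_assoc, ← mul_pow]
          norm_num
        rw [← h4, mul_comm n m]
        have h5 : 0 < R ^ ε := Real.rpow_pos_of_pos hR0 _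
        field_simp
  calc _ ≤ ∫⁻ y in ⋃ k, S k, ‖K (Fin.cons x y) - K (Fin.cons x' y)‖ₑ * ∏ j, ‖g j (y j)‖ₑ :=
        lintegral_mono_set hcover
    _ ≤ ∑' k, ∫⁻ y in S k, ‖K (Fin.cons x y) - K (Fin.cons x' y)‖ₑ * ∏ j, ‖g j (y j)‖ₑ :=
      lintegral_iUnion_le _ _
    _ ≤ ∑' k : ℕ, ENNReal.ofReal (|A| * 4 ^ (m * n)) * q ^ (k + 1) * ∏ j, v j :=
      ENNReal.tsum_le_tsum hbound
    _ = C * ∏ j, v j := by rw [ENNReal.tsum_mul_right]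

end

/-! ### Oscillation of `T` on sets near which one entry vanishes -/

section

variable {n m : ℕ} {𝕜 : Type*} [RCLike 𝕜]

/-- The vanishing entry removes all `y` whose components are all within `r` of `x`. On what remains
the kernel is continuous and bounded, and the product of the entries is integrable. -/
theorem IsCZKernel.integrable_mul_prod {A ε : ℝ} {K : (Fin (m + 1) → Rn n) → 𝕜}
    (hK : IsCZKernel A ε K) (hε : 0 < ε) {r : ℝ} (hr : 0 < r) (x : Rn n)
    {g : Fin m → Rn n → 𝕜} (hg : ∀ j, Integrable (g j)) (j₀ : Fin m)
    (hj₀ : ∀ z, ‖x - z‖ < r → g j₀ z = 0) :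
    Integrable fun y : Fin m → Rn n => K (Fin.cons x y) * ∏ j, g j (y j) := by
  set R : Set (Fin m → Rn n) := {y | ∃ j, r ≤ ‖x - y j‖} with hR
  have hRm : MeasurableSet R := measurableSet_far x r
  have hprod : Integrable fun y : Fin m → Rn n => ∏ j, g j (y j) := Integrable.fintype_prod hg
  have hne : ∀ y ∈ R, ∃ k l, (Fin.cons x y : Fin (m + 1) → Rn n) k ≠
      (Fin.cons x y : Fin (m + 1) → Rn n) l := by
    rintro y ⟨j, hj⟩
    refine ⟨0, j.succ, fun h => ?_⟩
    simp only [Fin.cons_zero, Fin.cons_succ] at h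
    rw [← h, sub_self, norm_zero] at hj
    exact absurd hj hr.not_ge
  have heq : (fun y : Fin m → Rn n => K (Fin.cons x y) * ∏ j, g j (y j)) =
      fun y => R.indicator (fun y => K (Fin.cons x y)) y * ∏ j, g j (y j) := by
    ext y
    by_cases hy : y ∈ R
    · rw [indicator_of_mem hy]
    · have : g j₀ (y j₀) = 0 := by
        refine hj₀ _ ?_
        by_contra! h
        exact hy ⟨j₀, h⟩
      rw [Finset.prod_eq_zero (Finset.mem_univ j₀) this, mul_zero, mul_zero]
  rw [heq]
  refine hprod.bdd_mul (c := |A| / r ^ (m * n)) ?_ (Filter.Eventually.of_forall fun y => ?_)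
  · rw [aestronglyMeasurable_indicator_iff hRm]
    refine ContinuousOn.aestronglyMeasurable ?_ hRm
    intro y hy
    refine ContinuousAt.continuousWithinAt ?_
    refine ContinuousAt.comp (f := fun y : Fin m → Rn n => (Fin.cons x y : Fin (m + 1) → Rn n))
      (hK.continuousAt hε (hne y hy)) ?_
    fun_prop
  · by_cases hy : y ∈ R
    · rw [indicator_of_mem hy]
      refine (hK.size _ (hne y hy)).trans ?_
      obtain ⟨j, hj⟩ := hy
      have h3 : r ≤ ∑ k, ∑ l, ‖(Fin.cons x y : Fin (m + 1) → Rn n) k -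
          (Fin.cons x y : Fin (m + 1) → Rn n) l‖ := by
        refine hj.trans ?_
        have := norm_sub_le_sum (Fin.cons x y : Fin (m + 1) → Rn n) 0 j.succ
        simpa only [Fin.cons_zero, Fin.cons_succ] using this
      gcongr
      exact le_abs_self A
    · rw [indicator_of_notMem hy, norm_zero]
      positivity

theorem enorm_finset_prod {ι : Type*} (s : Finset ι) (f : ι → 𝕜) :
    ‖∏ i ∈ s, f i‖ₑ = ∏ i ∈ s, ‖f i‖ₑ := by
  simp only [← ofReal_norm, norm_prod]
  exact ENNReal.ofReal_prod_of_nonneg fun i _ => norm_nonneg _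

/-- Off a null set, the oscillation of `u` over `P` is at most `c`. -/
def OscLE (u : Rn n → 𝕜) (P : Set (Rn n)) (c : ℝ≥0∞) : Prop :=
  ∃ N, volume N = 0 ∧ ∀ x ∈ P \ N, ∀ x' ∈ P \ N, ‖u x - u x'‖ₑ ≤ c

theorem OscLE.congr_ae {u v : Rn n → 𝕜} {P : Set (Rn n)} {c : ℝ≥0∞} (h : OscLE u P c)
    (huv : u =ᵐ[volume] v) : OscLE v P c := by
  obtain ⟨N, hN, h⟩ := h
  refine ⟨N ∪ {x | u x ≠ v x}, measure_union_null hN (ae_iff.1 huv), fun x hx x' hx' => ?_⟩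
  simp only [mem_sdiff, mem_union, mem_ofPred_eq, not_or, not_not] at hx hx'
  rw [← hx.2.2, ← hx'.2.2]
  exact h x ⟨hx.1, hx.2.1⟩ x' ⟨hx'.1, hx'.2.1⟩

theorem OscLE.add {u v : Rn n → 𝕜} {P : Set (Rn n)} {c d : ℝ≥0∞} (hu : OscLE u P c)
    (hv : OscLE v P d) : OscLE (u + v) P (c + d) := by
  obtain ⟨N, hN, hu⟩ := hu
  obtain ⟨N', hN', hv⟩ := hv
  refine ⟨N ∪ N', measure_union_null hN hN', fun x hx x' hx' => ?_⟩
  simp only [mem_sdiff, mem_union, not_or] at hx hx'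
  calc ‖(u + v) x - (u + v) x'‖ₑ = ‖(u x - u x') + (v x - v x')‖ₑ := by
        simp only [Pi.add_apply]; congr 1; ring
    _ ≤ ‖u x - u x'‖ₑ + ‖v x - v x'‖ₑ := enorm_add_le _ _
    _ ≤ c + d := add_le_add (hu x ⟨hx.1, hx.2.1⟩ x' ⟨hx'.1, hx'.2.1⟩)
      (hv x ⟨hx.1, hx.2.2⟩ x' ⟨hx'.1, hx'.2.2⟩)

theorem OscLE.of_tendsto {u : ℕ → Rn n → 𝕜} {v : Rn n → 𝕜} {P : Set (Rn n)} {c : ℝ≥0∞}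
    (hu : ∀ k, OscLE (u k) P c)
    (hlim : ∀ᵐ x, Filter.Tendsto (fun k => u k x) Filter.atTop (𝓝 (v x))) : OscLE v P c := by
  choose N hN hu using hu
  refine ⟨(⋃ k, N k) ∪ {x | ¬ Filter.Tendsto (fun k => u k x) Filter.atTop (𝓝 (v x))},
    measure_union_null (measure_iUnion_null hN) (ae_iff.1 hlim), fun x hx x' hx' => ?_⟩
  simp only [mem_sdiff, mem_union, mem_iUnion, mem_ofPred_eq, not_or, not_exists, not_not] at hx hx'
  refine le_of_tendsto ((hx.2.2.sub hx'.2.2).enorm) (Filter.Eventually.of_forall fun k => ?_)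
  exact hu k x ⟨hx.1, hx.2.1 k⟩ x' ⟨hx'.1, hx'.2.1 k⟩

/-- Truncation of a function at height `N`. -/
noncomputable def truncate (N : ℝ) (h : Rn n → 𝕜) : Rn n → 𝕜 := {x | ‖h x‖ ≤ N}.indicator h

theorem norm_truncate_le_norm (N : ℝ) (h : Rn n → 𝕜) (x : Rn n) : ‖truncate N h x‖ ≤ ‖h x‖ :=
  norm_indicator_le_norm_self _ _

theorem aestronglyMeasurable_truncate (N : ℝ) {h : Rn n → 𝕜} (hh : AEStronglyMeasurable h) :
    AEStronglyMeasurable (truncate N h) :=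
  hh.indicator₀ (nullMeasurableSet_le hh.norm.aemeasurable aemeasurable_const)

theorem IsNice.mono {f g : Rn n → 𝕜} (hf : IsNice f) (hg : AEStronglyMeasurable g)
    (h : ∀ x, ‖g x‖ ≤ ‖f x‖) : IsNice g := by
  refine ⟨hf.1.mono fun x hx => ?_, fun k => (hf.2 k).mono hg (Filter.Eventually.of_forall h)⟩
  rw [Function.mem_support] at hx ⊢
  intro h0
  have := h x
  rw [h0, norm_zero] at this
  exact hx (norm_le_zero_iff.1 this)

theorem IsNice.aestronglyMeasurable {f : Rn n → 𝕜} (hf : IsNice f) : AEStronglyMeasurable f :=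
  (hf.2 0).1

theorem IsNice.integrable {f : Rn n → 𝕜} (hf : IsNice f) : Integrable f := by
  have := hf.2 1
  rwa [Nat.cast_one, memLp_one_iff_integrable] at this

theorem IsNice.sub {f g : Rn n → 𝕜} (hf : IsNice f) (hg : IsNice g) : IsNice (f - g) := by
  refine ⟨?_, fun k => (hf.2 k).sub (hg.2 k)⟩
  rw [sub_eq_add_neg]
  exact hf.1.add hg.1.neg

theorem IsNice.const_smul {f : Rn n → 𝕜} (hf : IsNice f) (c : 𝕜) : IsNice (c • f) :=
  ⟨hf.1.smul_left (f := fun _ => c), fun k => (hf.2 k).const_smul c⟩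

theorem IsNice.indicator {f : Rn n → 𝕜} (hf : IsNice f) {S : Set (Rn n)} (hS : MeasurableSet S) :
    IsNice (S.indicator f) :=
  hf.mono (hf.aestronglyMeasurable.indicator hS) fun _ => norm_indicator_le_norm_self _ _

theorem tendsto_eLpNorm_sub_truncate {h : Rn n → 𝕜} {k : ℕ} (hk : k ≠ 0) (hh : MemLp h k volume) :
    Filter.Tendsto (fun N : ℕ => eLpNorm (h - truncate N h) k volume) Filter.atTop (𝓝 0) := by
  have hk' : (k : ℝ≥0∞) ≠ 0 := by exact_mod_cast hk
  have hk0 : (0 : ℝ) < k := by exact_mod_cast Nat.pos_of_ne_zero hk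
  have hle : ∀ (N : ℕ) x, ‖(h - truncate N h) x‖ₑ ≤ ‖h x‖ₑ := by
    intro N x
    simp only [Pi.sub_apply, truncate]
    by_cases hx : x ∈ {x | ‖h x‖ ≤ N}
    · rw [indicator_of_mem hx]; simp
    · rw [indicator_of_notMem hx]; simp
  have hfin : ∫⁻ x, ‖h x‖ₑ ^ (k : ℝ) ≠ ∞ := by
    have := (lintegral_rpow_enorm_lt_top_of_eLpNorm_lt_top hk' (by simp) hh.2).ne
    simpa using this
  have hlim : Filter.Tendsto (fun N : ℕ => ∫⁻ x, ‖(h - truncate N h) x‖ₑ ^ (k : ℝ))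
      Filter.atTop (𝓝 (∫⁻ _ : Rn n, 0)) := by
    refine tendsto_lintegral_of_dominated_convergence' (fun x => ‖h x‖ₑ ^ (k : ℝ)) (fun N => ?_)
      (fun N => Filter.Eventually.of_forall fun x => ?_) hfin
      (Filter.Eventually.of_forall fun x => ?_)
    · exact (hh.1.sub (aestronglyMeasurable_truncate N hh.1)).enorm.pow_const _
    · exact ENNReal.rpow_le_rpow (hle N x) hk0.le
    · refine tendsto_const_nhds.congr' ?_
      filter_upwards [Filter.eventually_ge_atTop ⌈‖h x‖⌉₊] with N hN
      have hx : x ∈ {x | ‖h x‖ ≤ N} := Nat.ceil_le.1 hN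
      rw [Pi.sub_apply, truncate, indicator_of_mem hx, sub_self, enorm_zero,
        ENNReal.zero_rpow_of_pos hk0]
  rw [lintegral_zero] at hlim
  have h2 := hlim.ennrpow_const (1 / (k : ℝ))
  rw [ENNReal.zero_rpow_of_pos (by positivity)] at h2
  refine h2.congr fun N => ?_
  rw [eLpNorm_eq_lintegral_rpow_enorm_toReal hk' (by simp)]
  simp

variable {T : (Fin m → Rn n → 𝕜) → Rn n → 𝕜}

/-- The exponent `2 m`, for which `T` maps into `L²`. -/
def evenExponent (m : ℕ) : Fin m → ℝ≥0∞ := fun _ => (2 * m : ℕ)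

theorem one_lt_evenExponent (j : Fin m) : 1 < evenExponent m j ∧ evenExponent m j < ∞ := by
  have : 0 < m := Nat.lt_of_le_of_lt (Nat.zero_le _) j.2
  refine ⟨?_, ENNReal.natCast_lt_top _⟩
  simp only [evenExponent]
  exact_mod_cast (by omega : 1 < 2 * m)

theorem admissible_evenExponent : Admissible (evenExponent m) := Or.inl one_lt_evenExponent

theorem sum_inv_evenExponent (hm : 0 < m) : (∑ j, (evenExponent m j)⁻¹)⁻¹ = 2 := by
  have hm' : (m : ℝ≥0∞) ≠ 0 := by exact_mod_cast hm.ne'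
  simp only [evenExponent, Finset.sum_const, Finset.card_univ, Fintype.card_fin, nsmul_eq_mul]
  rw [Nat.cast_mul, Nat.cast_two, ENNReal.mul_inv (Or.inl two_ne_zero) (Or.inl (by simp)),
    mul_left_comm, ENNReal.mul_inv_cancel hm' (by simp), mul_one, inv_inv]

theorem memProd_evenExponent {g : Fin m → Rn n → 𝕜} (hg : ∀ j, IsNice (g j)) :
    MemProd (evenExponent m) g := fun j => (hg j).2 _

theorem isNice_update {g : Fin m → Rn n → 𝕜} (hg : ∀ j, IsNice (g j)) (j : Fin m)
    {h : Rn n → 𝕜} (hh : IsNice h) (i : Fin m) : IsNice (Function.update g j h i) := by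
  rcases eq_or_ne i j with rfl | hij
  · simpa using hh
  · simpa [hij] using hg i

/-- Truncation converges in `L^(2m)` and `T` is bounded into `L²`, so the images converge in measure
and almost everywhere along a subsequence. The kernel representation, available only for bounded
entries, can be exploited for nice ones through this limit. -/
theorem IsCZOperator.exists_subseq_tendsto_truncate (hT : IsCZOperator T) (hm : 0 < m)
    {g : Fin m → Rn n → 𝕜} (hg : ∀ j, IsNice (g j)) (j : Fin m) :
    ∃ ns : ℕ → ℕ, ∀ᵐ x, Filter.Tendsto
      (fun k => T (Function.update g j (truncate (ns k) (g j))) x) Filter.atTop (𝓝 (T g x)) := by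
  have htr : ∀ N : ℕ, IsNice (truncate N (g j)) := fun N =>
    (hg j).mono (aestronglyMeasurable_truncate N (hg j).aestronglyMeasurable)
      (norm_truncate_le_norm N (g j))
  have hmeas : ∀ {g : Fin m → Rn n → 𝕜}, (∀ j, IsNice (g j)) → AEStronglyMeasurable (T g) :=
    fun hg => hT.measurable _ admissible_evenExponent _ (memProd_evenExponent hg)
  obtain ⟨C, hC⟩ := hT.strong (evenExponent m) one_lt_evenExponent
  rw [sum_inv_evenExponent hm] at hC
  have hdiff : ∀ N : ℕ, T (Function.update g j (truncate N (g j))) - T g =ᵐ[volume]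
      -T (Function.update g j (g j - truncate N (g j))) := by
    intro N
    have h := hT.map_add _ admissible_evenExponent (Function.update g j (truncate N (g j)))
      (memProd_evenExponent (isNice_update hg j (htr N))) j (g j - truncate N (g j))
      (((hg j).sub (htr N)).2 _)
    rw [Function.update_self, Function.update_idem, Function.update_idem, add_sub_cancel,
      Function.update_eq_self] at h
    filter_upwards [h] with x hx
    simp only [Pi.sub_apply, Pi.neg_apply, hx, Pi.add_apply]
    ring
  have hlim : Filter.Tendsto (fun N : ℕ => eLpNorm
      (T (Function.update g j (truncate N (g j))) - T g) 2 volume) Filter.atTop (𝓝 0) := by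
    have h1 : Filter.Tendsto (fun N : ℕ => C * (eLpNorm (g j - truncate N (g j)) (2 * m : ℕ) volume *
        ∏ i ∈ Finset.univ.erase j, eLpNorm (g i) (2 * m : ℕ) volume)) Filter.atTop (𝓝 0) := by
      have hfin : ∏ i ∈ Finset.univ.erase j, eLpNorm (g i) (2 * m : ℕ) volume ≠ ∞ :=
        ENNReal.prod_ne_top fun i _ => ((hg i).2 (2 * m)).2.ne
      have h2 := ENNReal.Tendsto.mul_const
        (tendsto_eLpNorm_sub_truncate (by omega) ((hg j).2 (2 * m))) (Or.inr hfin)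
      have h3 := ENNReal.Tendsto.const_mul (a := (C : ℝ≥0∞)) h2 (Or.inr ENNReal.coe_ne_top)
      simpa using h3
    refine tendsto_of_tendsto_of_tendsto_of_le_of_le tendsto_const_nhds h1 (fun _ => zero_le)
      fun N => ?_
    simp only
    rw [eLpNorm_congr_ae (hdiff N), eLpNorm_neg]
    refine (hC _ (memProd_evenExponent (isNice_update hg j ((hg j).sub (htr N))))).trans_eq ?_
    congr 1
    rw [← Finset.mul_prod_erase _ _ (Finset.mem_univ j), Function.update_self]
    congr 1
    refine Finset.prod_congr rfl fun i hi => ?_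
    rw [Function.update_of_ne (Finset.ne_of_mem_erase hi)]
    rfl
  obtain ⟨ns, -, hns⟩ := (tendstoInMeasure_of_tendsto_eLpNorm two_ne_zero
    (fun N => hmeas (isNice_update hg j (htr N))) (hmeas hg) hlim).exists_seq_tendsto_ae
  exact ⟨ns, hns⟩

/-- If one entry vanishes near `P`, then the oscillation of `T g` over `P` is controlled by the
averages of the entries over balls. -/
theorem IsCZOperator.exists_oscLE (hT : IsCZOperator T) (hm : 0 < m) : ∃ C : ℝ≥0,
    ∀ (P : Set (Rn n)) (r : ℝ), 0 < r → (∀ x ∈ P, ∀ x' ∈ P, ‖x - x'‖ ≤ r) → ∀ x₀ ∈ P,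
    ∀ (g : Fin m → Rn n → 𝕜) (j₀ : Fin m) (v : Fin m → ℝ≥0∞), (∀ j, IsNice (g j)) →
    (∀ x ∈ P, ∀ z, ‖x - z‖ < 2 * r → g j₀ z = 0) →
    (∀ j, ∀ ρ : ℝ, 0 < ρ → ∫⁻ z in Metric.closedBall x₀ ρ, ‖g j z‖ₑ ≤
        v j * ENNReal.ofReal ρ ^ n) →
    OscLE (T g) P (C * ∏ j, v j) := by
  obtain ⟨A, ε, K, hε, hK, hrep⟩ := hT.kernel
  obtain ⟨C, hC⟩ := hK.exists_lintegral_sub_le hε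
  refine ⟨C, fun P r hr hP x₀ hx₀ => ?_⟩
  -- For bounded entries the representation applies on `P`, because the support of `g j₀` stays away
  -- from it. The difference of two values is then an integral of kernel differences over the far
  -- region.
  have hbdd : ∀ (g : Fin m → Rn n → 𝕜) (j₀ : Fin m) (v : Fin m → ℝ≥0∞), (∀ j, IsNice (g j)) →
      (∀ j, MemLp (g j) ∞ volume) → (∀ x ∈ P, ∀ z, ‖x - z‖ < 2 * r → g j₀ z = 0) →
      (∀ j, ∀ ρ : ℝ, 0 < ρ → ∫⁻ z in Metric.closedBall x₀ ρ, ‖g j z‖ₑ ≤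
        v j * ENNReal.ofReal ρ ^ n) → OscLE (T g) P (C * ∏ j, v j) := by
    intro g j₀ v hg hgb hj₀ hv
    have hN := hrep g fun j => ⟨hgb j, (hg j).1⟩
    refine ⟨_, ae_iff.1 hN, fun x hx x' hx' => ?_⟩
    simp only [mem_sdiff, mem_ofPred_eq, not_not] at hx hx'
    have hsupp : ∀ x ∈ P, x ∉ ⋂ j, tsupport (g j) := by
      intro x hx hmem
      refine (notMem_tsupport_iff_eventuallyEq.2 ?_) (mem_iInter.1 hmem j₀)
      filter_upwards [Metric.ball_mem_nhds x (mul_pos two_pos hr)] with z hz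
      refine hj₀ x hx z ?_
      rwa [← dist_eq_norm, dist_comm]
    have hint : ∀ x ∈ P, Integrable fun y : Fin m → Rn n => K (Fin.cons x y) * ∏ j, g j (y j) :=
      fun x hx => hK.integrable_mul_prod hε (mul_pos two_pos hr) x (fun j => (hg j).integrable) j₀
        (hj₀ x hx)
    rw [hx.2 (hsupp x hx.1), hx'.2 (hsupp x' hx'.1), ← integral_sub (hint x hx.1) (hint x' hx'.1)]
    refine (enorm_integral_le_lintegral_enorm _).trans ?_
    refine le_trans (le_of_eq ?_) (hC r x x' x₀ hr (hP x hx.1 x' hx'.1) (hP x hx.1 x₀ hx₀) g v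
      (fun j => (hg j).aestronglyMeasurable) hv)
    rw [← lintegral_indicator (measurableSet_far x _)]
    refine lintegral_congr fun y => ?_
    by_cases hy : y ∈ {y : Fin m → Rn n | ∃ j, 2 * r ≤ ‖x - y j‖}
    · rw [indicator_of_mem hy, ← sub_mul, enorm_mul, enorm_finset_prod]
    · rw [indicator_of_notMem hy]
      have : g j₀ (y j₀) = 0 := by
        refine hj₀ x hx.1 _ ?_
        by_contra! h
        exact hy ⟨j₀, h⟩
      rw [Finset.prod_eq_zero (Finset.mem_univ j₀) this, mul_zero, mul_zero, sub_zero, enorm_zero]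
  -- Boundedness is removed one entry at a time. Truncation does not increase the averages, and
  -- oscillation bounds survive almost everywhere limits.
  have key : ∀ (S : Finset (Fin m)) (g : Fin m → Rn n → 𝕜) (j₀ : Fin m) (v : Fin m → ℝ≥0∞),
      (∀ j, IsNice (g j)) → (∀ j ∉ S, MemLp (g j) ∞ volume) →
      (∀ x ∈ P, ∀ z, ‖x - z‖ < 2 * r → g j₀ z = 0) →
      (∀ j, ∀ ρ : ℝ, 0 < ρ → ∫⁻ z in Metric.closedBall x₀ ρ, ‖g j z‖ₑ ≤
        v j * ENNReal.ofReal ρ ^ n) → OscLE (T g) P (C * ∏ j, v j) := by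
    intro S
    induction S using Finset.induction_on with
    | empty => exact fun g j₀ v hg hgb => hbdd g j₀ v hg fun j => hgb j (Finset.notMem_empty j)
    | insert j S hj ih =>
      intro g j₀ v hg hgb hj₀ hv
      obtain ⟨ns, hns⟩ := hT.exists_subseq_tendsto_truncate hm hg j
      refine OscLE.of_tendsto (fun k => ?_) hns
      have htr : IsNice (truncate (ns k) (g j)) :=
        (hg j).mono (aestronglyMeasurable_truncate _ (hg j).aestronglyMeasurable)
          (norm_truncate_le_norm _ (g j))
      have hle : ∀ i z, ‖Function.update g j (truncate (ns k) (g j)) i z‖ ≤ ‖g i z‖ := by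
        intro i z
        rcases eq_or_ne i j with rfl | hij
        · rw [Function.update_self]
          exact norm_truncate_le_norm _ _ _
        · rw [Function.update_of_ne hij]
      refine ih _ j₀ v (isNice_update hg j htr) (fun i hi => ?_) (fun x hx z hz => ?_)
        fun i ρ hρ => ?_
      · rcases eq_or_ne i j with rfl | hij
        · rw [Function.update_self]
          refine memLp_top_of_bound htr.aestronglyMeasurable (ns k)
            (Filter.Eventually.of_forall fun x => ?_)
          rw [truncate, indicator]
          split_ifs with h
          · exact h
          · simp
        · rw [Function.update_of_ne hij]
          exact hgb i (by simp [hij, hi])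
      · simpa [hj₀ x hx z hz] using hle j₀ z
      · refine (lintegral_mono fun z => ?_).trans (hv i ρ hρ)
        exact enorm_le_iff_norm_le.2 (hle i z)
  exact fun g j₀ v hg hj₀ hv => key Finset.univ g j₀ v hg (fun j hj => absurd (Finset.mem_univ j) hj)
    hj₀ hv

end

section

variable {n m : ℕ} {𝕜 : Type*} [RCLike 𝕜]

/-! ### Iterated commutators -/

/-- An operator which is additive and homogeneous in every entry, on compactly supported functions
in all Lebesgue spaces. -/
structure IsMultilinear (S : (Fin m → Rn n → 𝕜) → Rn n → 𝕜) : Prop where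
  map_add : ∀ g : Fin m → Rn n → 𝕜, (∀ j, IsNice (g j)) → ∀ j h, IsNice h →
    S (Function.update g j (g j + h)) =ᵐ[volume] S g + S (Function.update g j h)
  map_smul : ∀ g : Fin m → Rn n → 𝕜, (∀ j, IsNice (g j)) → ∀ (j : Fin m) (c : 𝕜),
    S (Function.update g j (c • g j)) =ᵐ[volume] c • S g

theorem IsCZOperator.isMultilinear {T : (Fin m → Rn n → 𝕜) → Rn n → 𝕜} (hT : IsCZOperator T) :
    IsMultilinear T where
  map_add g hg j h hh := hT.map_add _ admissible_evenExponent g (memProd_evenExponent hg) j h (hh.2 _)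
  map_smul g hg := hT.map_smul _ admissible_evenExponent g (memProd_evenExponent hg)

/-- Multiplication by `b` preserves the compactly supported functions in all Lebesgue spaces. -/
def IsMultiplier (b : Rn n → 𝕜) : Prop := ∀ f : Rn n → 𝕜, IsNice f → IsNice (b * f)

theorem IsBMO.isMultiplier {b : Rn n → 𝕜} (hb : IsBMO b) : IsMultiplier b :=
  fun _ hf => hf.mul_left hb

theorem IsMultiplier.sub_const {b : Rn n → 𝕜} (hb : IsMultiplier b) (c : 𝕜) :
    IsMultiplier (fun x => b x - c) := by
  intro f hf
  have : (fun x => b x - c) * f = b * f - c • f := by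
    ext x
    simp [sub_mul]
  rw [this]
  exact (hb f hf).sub (hf.const_smul c)

theorem IsMultilinear.entryCommutator {S : (Fin m → Rn n → 𝕜) → Rn n → 𝕜} (hS : IsMultilinear S)
    {b : Rn n → 𝕜} (hb : IsMultiplier b) (j : Fin m) :
    IsMultilinear (entryCommutator b j S) where
  map_add g hg i h hh := by
    have h1 := hS.map_add g hg i h hh
    rcases eq_or_ne i j with rfl | hij
    · have h2 := hS.map_add (Function.update g i (b * g i)) (isNice_update hg i (hb _ (hg i))) i
        (b * h) (hb _ hh)
      rw [Function.update_self, Function.update_idem, Function.update_idem, ← mul_add] at h2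
      filter_upwards [h1, h2] with x h1 h2
      simp only [MultiCZ.entryCommutator, Pi.add_apply, Function.update_self,
        Function.update_idem] at h1 h2 ⊢
      rw [h1, h2]
      ring
    · have h2 := hS.map_add (Function.update g j (b * g j)) (isNice_update hg j (hb _ (hg j))) i h hh
      rw [Function.update_of_ne hij, Function.update_comm hij.symm, Function.update_comm hij.symm] at h2
      filter_upwards [h1, h2] with x h1 h2
      simp only [MultiCZ.entryCommutator, Pi.add_apply, Function.update_of_ne hij.symm] at h1 h2 ⊢
      rw [h1, h2]
      ring
  map_smul g hg i c := by
    have h1 := hS.map_smul g hg i c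
    rcases eq_or_ne i j with rfl | hij
    · have h2 := hS.map_smul (Function.update g i (b * g i)) (isNice_update hg i (hb _ (hg i))) i c
      rw [Function.update_self, Function.update_idem, ← mul_smul_comm] at h2
      filter_upwards [h1, h2] with x h1 h2
      simp only [MultiCZ.entryCommutator, Pi.smul_apply, smul_eq_mul, Function.update_self,
        Function.update_idem] at h1 h2 ⊢
      rw [h1, h2]
      ring
    · have h2 := hS.map_smul (Function.update g j (b * g j)) (isNice_update hg j (hb _ (hg j))) i c
      rw [Function.update_of_ne hij, Function.update_comm hij.symm] at h2
      filter_upwards [h1, h2] with x h1 h2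
      simp only [MultiCZ.entryCommutator, Pi.smul_apply, smul_eq_mul,
        Function.update_of_ne hij.symm] at h1 h2 ⊢
      rw [h1, h2]
      ring

/-- Multiplication by a constant commutes with an operator linear in the `j`-th entry. -/
theorem IsMultilinear.entryCommutator_sub_const {S : (Fin m → Rn n → 𝕜) → Rn n → 𝕜}
    (hS : IsMultilinear S) {b : Rn n → 𝕜} (hb : IsMultiplier b) (j : Fin m) (c : 𝕜)
    {g : Fin m → Rn n → 𝕜} (hg : ∀ j, IsNice (g j)) :
    MultiCZ.entryCommutator b j S g =ᵐ[volume]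
      MultiCZ.entryCommutator (fun x => b x - c) j S g := by
  have hbc := (hb.sub_const c) _ (hg j)
  have h1 := hS.map_add (Function.update g j ((fun x => b x - c) * g j))
    (isNice_update hg j hbc) j (c • g j) ((hg j).const_smul c)
  have h2 := hS.map_smul g hg j c
  have h3 : (fun x => b x - c) * g j + c • g j = b * g j := by
    ext x
    simp only [Pi.add_apply, Pi.mul_apply, Pi.smul_apply, smul_eq_mul]
    ring
  rw [Function.update_self, Function.update_idem, Function.update_idem, h3] at h1
  filter_upwards [h1, h2] with x h1 h2
  simp only [MultiCZ.entryCommutator, Pi.add_apply, Pi.smul_apply, smul_eq_mul] at h1 h2 ⊢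
  rw [h1, h2]
  ring

theorem IsMultilinear.foldr_entryCommutator {T : (Fin m → Rn n → 𝕜) → Rn n → 𝕜}
    (hT : IsMultilinear T) {b : Fin m → Rn n → 𝕜} (hb : ∀ j, IsMultiplier (b j)) (L : List (Fin m)) :
    IsMultilinear (L.foldr (fun j S => MultiCZ.entryCommutator (b j) j S) T) := by
  induction L with
  | nil => exact hT
  | cons j L ih => exact ih.entryCommutator (hb j) j

/-- Iterated commutators do not change when constants are subtracted from the symbols. -/
theorem IsMultilinear.iteratedCommutator_sub_const {T : (Fin m → Rn n → 𝕜) → Rn n → 𝕜}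
    (hT : IsMultilinear T) {b : Fin m → Rn n → 𝕜} (hb : ∀ j, IsMultiplier (b j)) (c : Fin m → 𝕜)
    {g : Fin m → Rn n → 𝕜} (hg : ∀ j, IsNice (g j)) :
    iteratedCommutator b T g =ᵐ[volume] iteratedCommutator (fun j x => b j x - c j) T g := by
  have key : ∀ (L : List (Fin m)) (g : Fin m → Rn n → 𝕜), (∀ j, IsNice (g j)) →
      L.foldr (fun j S => MultiCZ.entryCommutator (b j) j S) T g =ᵐ[volume]
      L.foldr (fun j S => MultiCZ.entryCommutator (fun x => b j x - c j) j S) T g := by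
    intro L
    induction L with
    | nil => exact fun g _ => Filter.EventuallyEq.rfl
    | cons j L ih =>
      intro g hg
      refine ((hT.foldr_entryCommutator hb L).entryCommutator_sub_const (hb j) j (c j) hg).trans ?_
      filter_upwards [ih g hg, ih _ (isNice_update hg j (((hb j).sub_const (c j)) _ (hg j)))]
        with x h1 h2
      simp only [MultiCZ.entryCommutator, List.foldr_cons] at h1 h2 ⊢
      rw [h1, h2]
  exact key _ g hg

/-- The tuple `g` with the entries in `B` multiplied by the symbols `b`. -/
def mulOn (B : Finset (Fin m)) (b g : Fin m → Rn n → 𝕜) : Fin m → Rn n → 𝕜 :=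
  fun i => if i ∈ B then b i * g i else g i

/-- Each commutator places its symbol either outside `T` or, with a minus sign, inside the entry;
`B` collects the symbols placed inside. This is pure unfolding and needs no linearity. -/
theorem iteratedCommutator_eq_sum (T : (Fin m → Rn n → 𝕜) → Rn n → 𝕜) (b g : Fin m → Rn n → 𝕜)
    (x : Rn n) : iteratedCommutator b T g x =
      ∑ B : Finset (Fin m), (-1) ^ B.card * (∏ j ∈ Bᶜ, b j x) * T (mulOn B b g) x := by
  have key : ∀ (L : List (Fin m)), L.Nodup → ∀ g : Fin m → Rn n → 𝕜,
      L.foldr (fun j S => entryCommutator (b j) j S) T g x =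
      ∑ B ∈ L.toFinset.powerset, (-1) ^ B.card * (∏ j ∈ L.toFinset \ B, b j x) *
        T (mulOn B b g) x := by
    intro L
    induction L with
    | nil =>
      intro _ g
      have : mulOn ∅ b g = g := by ext; simp [mulOn]
      simp [this]
    | cons j L ih =>
      intro hL g
      obtain ⟨hj, hL⟩ := List.nodup_cons.1 hL
      have hj' : j ∉ L.toFinset := by simpa using hj
      rw [List.foldr_cons, List.toFinset_cons, Finset.sum_powerset_insert hj']
      simp only [entryCommutator]
      rw [ih hL g, ih hL, Finset.mul_sum, sub_eq_add_neg, ← Finset.sum_neg_distrib]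
      congr 1
      · refine Finset.sum_congr rfl fun B hB => ?_
        have hjB : j ∉ B := fun h => hj' (Finset.mem_powerset.1 hB h)
        rw [Finset.insert_sdiff_of_notMem _ hjB, Finset.prod_insert (by simp [hj])]
        ring
      · refine Finset.sum_congr rfl fun B hB => ?_
        have hjB : j ∉ B := fun h => hj' (Finset.mem_powerset.1 hB h)
        rw [Finset.card_insert_of_notMem hjB, Finset.insert_sdiff_insert,
          Finset.sdiff_insert_of_notMem hj']
        have : mulOn B b (Function.update g j (b j * g j)) = mulOn (insert j B) b g := by
          ext i
          rcases eq_or_ne i j with rfl | hij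
          · simp [mulOn, hjB]
          · simp [mulOn, hij]
        rw [this]
        ring
  have h := key (List.finRange m) (List.nodup_finRange m) g
  rw [List.toFinset_finRange, Finset.powerset_univ] at h
  rw [iteratedCommutator, h]
  simp only [Finset.compl_eq_univ_sdiff]

/-! ### Localization -/

/-- The entries are cut off to `R` one after another. Each change is `T` of a tuple with one entry
vanishing on `R`, hence near `P`, so the oscillation bound applies `m` times. -/
theorem IsCZOperator.exists_oscLE_sub {T : (Fin m → Rn n → 𝕜) → Rn n → 𝕜} (hT : IsCZOperator T)
    (hm : 0 < m) : ∃ C : ℝ≥0,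
    ∀ (P : Set (Rn n)) (r : ℝ), 0 < r → (∀ x ∈ P, ∀ x' ∈ P, ‖x - x'‖ ≤ r) → ∀ x₀ ∈ P,
    ∀ R : Set (Rn n), MeasurableSet R → (∀ x ∈ P, ∀ z ∉ R, 2 * r ≤ ‖x - z‖) →
    ∀ (g : Fin m → Rn n → 𝕜) (v : Fin m → ℝ≥0∞), (∀ j, IsNice (g j)) →
    (∀ j, ∀ ρ : ℝ, 0 < ρ → ∫⁻ z in Metric.closedBall x₀ ρ, ‖g j z‖ₑ ≤
        v j * ENNReal.ofReal ρ ^ n) →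
    OscLE (T g - T fun j => R.indicator (g j)) P (C * ∏ j, v j) := by
  obtain ⟨C, hC⟩ := hT.exists_oscLE hm
  refine ⟨m * C, fun P r hr hP x₀ hx₀ R hRm hR g v hg hv => ?_⟩
  set gR : Fin m → Rn n → 𝕜 := fun j => R.indicator (g j) with hgR
  have hgRn : ∀ j, IsNice (gR j) := fun j => (hg j).indicator hRm
  have key : ∀ S : Finset (Fin m), OscLE (T g - T (S.piecewise gR g)) P (S.card * (C * ∏ j, v j)) := by
    intro S
    induction S using Finset.induction_on with
    | empty => exact ⟨∅, measure_empty, fun x _ x' _ => by simp⟩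
    | insert j S hj ih =>
      set z := S.piecewise gR g with hz
      have hzn : ∀ i, IsNice (z i) := by
        intro i
        by_cases hi : i ∈ S
        · simpa [hz, hi] using hgRn i
        · simpa [hz, hi] using hg i
      have hzj : z j = g j := by simp [hz, hj]
      set gc : Rn n → 𝕜 := Rᶜ.indicator (g j) with hgc
      have hgcn : IsNice gc := (hg j).indicator hRm.compl
      have hadd := hT.isMultilinear.map_add (Function.update z j (gR j))
        (isNice_update hzn j (hgRn j)) j gc hgcn
      rw [Function.update_self, Function.update_idem, Function.update_idem, hgR] at hadd
      simp only at hadd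
      rw [hgc, indicator_self_add_compl, ← hzj, Function.update_eq_self, hzj, ← hgc] at hadd
      have hosc : OscLE (T (Function.update z j gc)) P (C * ∏ j, v j) := by
        refine hC P r hr hP x₀ hx₀ _ j v (isNice_update hzn j hgcn) (fun x hx w hw => ?_)
          fun i ρ hρ => (lintegral_mono fun w => ?_).trans (hv i ρ hρ)
        · rw [Function.update_self, hgc, indicator_of_notMem]
          intro hwR
          exact (hR x hx w hwR).not_gt hw
        · rw [enorm_le_iff_norm_le]
          rcases eq_or_ne i j with rfl | hij
          · rw [Function.update_self]
            exact norm_indicator_le_norm_self _ _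
          · rw [Function.update_of_ne hij]
            by_cases hi : i ∈ S
            · simp only [hz, hi, Finset.piecewise_eq_of_mem]
              exact norm_indicator_le_norm_self _ _
            · simp only [hz, hi, not_false_eq_true, Finset.piecewise_eq_of_notMem, le_refl]
      have hsum := ih.add hosc
      rw [Finset.card_insert_of_notMem hj, Nat.cast_add_one, add_mul, one_mul,
        Finset.piecewise_insert]
      refine hsum.congr_ae ?_
      filter_upwards [hadd] with x hx
      simp only [Pi.add_apply, Pi.sub_apply] at hx ⊢
      rw [hx]
      ring
  have h := key Finset.univ
  rw [Finset.piecewise_univ, Finset.card_univ, Fintype.card_fin, ← mul_assoc] at h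
  simpa using h

/-! ### Weak-type bounds -/

/-- The `L^{1/m,∞}` bound at height `c ^ m * ∏ j, v j`, with the `m`-th root taken. In this form the
exceptional set is small compared with `V` once `c` is large. -/
theorem IsCZOperator.exists_measure_lt_le {T : (Fin m → Rn n → 𝕜) → Rn n → 𝕜} (hT : IsCZOperator T)
    (hm : 0 < m) : ∃ D : ℝ≥0, ∀ g : Fin m → Rn n → 𝕜, (∀ j, IsNice (g j)) →
      ∀ (v : Fin m → ℝ) (V : ℝ≥0∞), (∀ j, 0 ≤ v j) →
      (∀ j, ∫⁻ x, ‖g j x‖ₑ ≤ ENNReal.ofReal (v j) * V) → ∀ c : ℝ, 0 < c →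
        volume {x | c ^ m * ∏ j, v j < ‖T g x‖} ≤ D * (ENNReal.ofReal c)⁻¹ * V := by
  obtain ⟨C, hC⟩ := hT.weak
  set D : ℝ≥0 := max C 1 with hD
  refine ⟨D, fun g hg v V hv hint c hc => ?_⟩
  have hCD : (C : ℝ≥0∞) ≤ (D : ℝ≥0∞) ^ m := by
    have h1 : C ≤ D ^ m := (le_max_left _ _).trans (le_self_pow₀ (le_max_right _ _) hm.ne')
    exact_mod_cast h1
  have hg1 : MemProd (fun _ => 1) g := fun j => by simpa using (hg j).2 1
  have hbound : ∀ t : ℝ, 0 < t → ENNReal.ofReal t * volume {x | t < ‖T g x‖} ^ m ≤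
      (D : ℝ≥0∞) ^ m * (ENNReal.ofReal (∏ j, v j) * V ^ m) := by
    intro t ht
    calc _ ≤ C * ∏ j, eLpNorm (g j) 1 volume := hC g hg1 t ht
      _ ≤ (D : ℝ≥0∞) ^ m * ∏ j, (ENNReal.ofReal (v j) * V) := by
        gcongr with j
        rw [eLpNorm_one_eq_lintegral_enorm]
        exact hint j
      _ = _ := by
        rw [Finset.prod_mul_distrib, ENNReal.ofReal_prod_of_nonneg fun j _ => hv j]
        simp
  -- When the product vanishes the threshold is zero, where the weak bound says nothing; the set is
  -- exhausted by the thresholds `1 / (k + 1)`.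
  rcases (Finset.prod_nonneg fun j _ => hv j : 0 ≤ ∏ j, v j).eq_or_lt with h0 | hpos
  · have hz : volume {x | c ^ m * ∏ j, v j < ‖T g x‖} = 0 := by
      have hsub : {x | c ^ m * ∏ j, v j < ‖T g x‖} ⊆ ⋃ k : ℕ, {x | 1 / ((k : ℝ) + 1) < ‖T g x‖} := by
        intro x hx
        simp only [← h0, mul_zero, mem_ofPred_eq] at hx
        obtain ⟨k, hk⟩ := exists_nat_one_div_lt hx
        exact mem_iUnion.2 ⟨k, hk⟩
      refine measure_mono_null hsub (measure_iUnion_null fun k => ?_)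
      have hk : (0 : ℝ) < 1 / ((k : ℝ) + 1) := by positivity
      have h1 := hbound _ hk
      by_cases hV : V = ∞
      · have h2 := hC g hg1 _ hk
        obtain ⟨j, -, hj⟩ := Finset.prod_eq_zero_iff.1 h0.symm
        have h3 : eLpNorm (g j) 1 volume = 0 := by
          rw [eLpNorm_one_eq_lintegral_enorm]
          simpa [hj] using hint j
        rw [Finset.prod_eq_zero (Finset.mem_univ j) h3, mul_zero, nonpos_iff_eq_zero, mul_eq_zero,
          pow_eq_zero_iff hm.ne'] at h2
        exact h2.resolve_left (by simpa using hk)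
      · rw [← h0, ENNReal.ofReal_zero, zero_mul, mul_zero, nonpos_iff_eq_zero, mul_eq_zero,
          pow_eq_zero_iff hm.ne'] at h1
        exact h1.resolve_left (by simpa using hk)
    rw [hz]
    exact zero_le
  · have ht : 0 < c ^ m * ∏ j, v j := by positivity
    have h1 := hbound _ ht
    have hv0 : ENNReal.ofReal (∏ j, v j) ≠ 0 := by simpa using hpos
    have hc0 : ENNReal.ofReal c ≠ 0 := by simpa using hc
    rw [ENNReal.ofReal_mul (by positivity), mul_comm (ENNReal.ofReal (c ^ m)), mul_assoc,
      mul_left_comm ((D : ℝ≥0∞) ^ m), ENNReal.mul_le_mul_iff_right hv0 ENNReal.ofReal_ne_top,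
      ENNReal.ofReal_pow hc.le, ← mul_pow, ← mul_pow] at h1
    have h2 := (ENNReal.pow_le_pow_left_iff hm.ne').1 h1
    rw [mul_assoc, mul_left_comm, ← ENNReal.div_eq_inv_mul]
    rwa [ENNReal.le_div_iff_mul_le (Or.inl hc0) (Or.inl ENNReal.ofReal_ne_top), mul_comm]

/-- The weak-type bound for the maximal function over balls. -/
theorem exists_measure_ball_average_lt_le (hn : 0 < n) : ∃ D : ℝ≥0, ∀ h : Rn n → 𝕜, Integrable h →
    ∀ (v : ℝ) (V : ℝ≥0∞), 0 ≤ v → ∫⁻ x, ‖h x‖ₑ ≤ ENNReal.ofReal v * V → ∀ c : ℝ, 0 < c →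
      volume {x | ∃ ρ : ℝ, 0 < ρ ∧ ENNReal.ofReal (c * v) * ENNReal.ofReal ρ ^ n <
        ∫⁻ z in Metric.closedBall x ρ, ‖h z‖ₑ} ≤ D * (ENNReal.ofReal c)⁻¹ * V := by
  have hω : volume (Metric.ball (0 : Rn n) 1) ≠ ∞ := measure_ball_lt_top.ne
  refine ⟨(5 ^ n) * (volume (Metric.ball (0 : Rn n) 1)).toNNReal, fun h hh v V hv hint c hc => ?_⟩
  set E := {x | ∃ ρ : ℝ, 0 < ρ ∧ ENNReal.ofReal (c * v) * ENNReal.ofReal ρ ^ n <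
        ∫⁻ z in Metric.closedBall x ρ, ‖h z‖ₑ} with hE
  have hfin : ∫⁻ x, ‖h x‖ₑ ≠ ∞ := hh.2.ne
  rcases hv.eq_or_lt with rfl | hv
  · have h0 : ∫⁻ x, ‖h x‖ₑ = 0 := by simpa using hint
    have : E = ∅ := by
      rw [eq_empty_iff_forall_notMem]
      rintro x ⟨ρ, -, hρ⟩
      exact (hρ.trans_le ((setLIntegral_le_lintegral _ _).trans h0.le)).not_ge zero_le
    rw [this, measure_empty]
    exact zero_le
  have hcv : 0 < c * v := mul_pos hc hv
  choose! ρ hρ0 hρ using fun x (hx : x ∈ E) => hx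
  -- The radii must be bounded for the Vitali lemma. They are, since `c * v * ρ ^ n` is less than
  -- the finite integral of `h`, and `0 < n`.
  obtain ⟨R, hR⟩ : ∃ R : ℝ, ∀ x ∈ E, ρ x ≤ R := by
    refine ⟨((∫⁻ x, ‖h x‖ₑ).toReal / (c * v)) + 1, fun x hx => ?_⟩
    have h1 := (hρ x hx).trans_le (setLIntegral_le_lintegral _ _)
    rw [← ENNReal.ofReal_toReal hfin, ← ENNReal.ofReal_pow (hρ0 x hx).le,
      ← ENNReal.ofReal_mul hcv.le] at h1
    have h2 := (ENNReal.ofReal_lt_ofReal_iff_of_nonneg (by have := hρ0 x hx; positivity)).1 h1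
    by_contra! hlt
    have h3 : 1 ≤ ρ x := le_trans (le_add_of_nonneg_left (by positivity)) hlt.le
    have h4 : ρ x ≤ ρ x ^ n := le_self_pow₀ h3 hn.ne'
    have h5 : (∫⁻ x, ‖h x‖ₑ).toReal / (c * v) < ρ x ^ n := by linarith
    rw [div_lt_iff₀ hcv] at h5
    linarith
  obtain ⟨u, huE, hud, hu⟩ := Vitali.exists_disjoint_subfamily_covering_enlargement_closedBall E
    (fun x => x) ρ R hR 5 (by norm_num)
  have hucount : u.Countable := hud.countable_of_nonempty_interior fun x hx =>
    ⟨x, by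
      rw [mem_interior_iff_mem_nhds]
      exact Metric.closedBall_mem_nhds x (hρ0 x (huE hx))⟩
  have hcover : E ⊆ ⋃ x ∈ u, Metric.closedBall x (5 * ρ x) := by
    intro x hx
    obtain ⟨y, hy, hsub⟩ := hu x hx
    exact mem_iUnion₂.2 ⟨y, hy, hsub (Metric.mem_closedBall_self (hρ0 x hx).le)⟩
  have hball : ∀ x ∈ u, ENNReal.ofReal (c * v) * volume (Metric.closedBall x (5 * ρ x)) ≤
      5 ^ n * volume (Metric.ball (0 : Rn n) 1) * ∫⁻ z in Metric.closedBall x (ρ x), ‖h z‖ₑ := by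
    intro x hx
    have hr := hρ0 x (huE hx)
    rw [Measure.addHaar_closedBall _ _ (by positivity), finrank_euclideanSpace, Fintype.card_fin,
      mul_pow, ENNReal.ofReal_mul (p := 5 ^ n) (by positivity), ENNReal.ofReal_pow (by positivity),
      ENNReal.ofReal_pow hr.le]
    calc _ = 5 ^ n * volume (Metric.ball (0 : Rn n) 1) *
          (ENNReal.ofReal (c * v) * ENNReal.ofReal (ρ x) ^ n) := by
          rw [ENNReal.ofReal_ofNat]; ring
      _ ≤ _ := by gcongr; exact (hρ x (huE hx)).le
  have hmain : ENNReal.ofReal (c * v) * volume E ≤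
      5 ^ n * volume (Metric.ball (0 : Rn n) 1) * (ENNReal.ofReal v * V) := by
    calc ENNReal.ofReal (c * v) * volume E
        ≤ ENNReal.ofReal (c * v) * ∑' x : u, volume (Metric.closedBall (x : Rn n) (5 * ρ x)) := by
          gcongr
          exact (measure_mono hcover).trans (measure_biUnion_le _ hucount _)
      _ = ∑' x : u, ENNReal.ofReal (c * v) * volume (Metric.closedBall (x : Rn n) (5 * ρ x)) :=
        ENNReal.tsum_mul_left.symm
      _ ≤ ∑' x : u, 5 ^ n * volume (Metric.ball (0 : Rn n) 1) *
          ∫⁻ z in Metric.closedBall (x : Rn n) (ρ x), ‖h z‖ₑ :=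
        ENNReal.tsum_le_tsum fun x => hball x x.2
      _ = 5 ^ n * volume (Metric.ball (0 : Rn n) 1) *
          ∫⁻ z in ⋃ x ∈ u, Metric.closedBall (x : Rn n) (ρ x), ‖h z‖ₑ := by
        rw [ENNReal.tsum_mul_left, lintegral_biUnion hucount
          (fun x _ => Metric.isClosed_closedBall.measurableSet) hud]
      _ ≤ _ := by
        gcongr
        exact (setLIntegral_le_lintegral _ _).trans hint
  have hv0 : ENNReal.ofReal v ≠ 0 := by simpa using hv
  have hc0 : ENNReal.ofReal c ≠ 0 := by simpa using hc
  rw [ENNReal.ofReal_mul hc.le, mul_comm (ENNReal.ofReal c), mul_assoc, mul_left_comm _ _ V,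
    ENNReal.mul_le_mul_iff_right hv0 ENNReal.ofReal_ne_top] at hmain
  rw [mul_assoc, mul_left_comm, ← ENNReal.div_eq_inv_mul,
    ENNReal.le_div_iff_mul_le (Or.inl hc0) (Or.inl ENNReal.ofReal_ne_top), mul_comm]
  simpa [ENNReal.coe_toNNReal hω] using hmain

end

section

variable {n m : ℕ} {𝕜 : Type*} [RCLike 𝕜]

/-! ### Dilated dyadic boxes -/

noncomputable section

/-- The lower corner of the dilate of a dyadic box. -/
def starCorner (o : Rn n) (l : ℝ) (q : DyadicIndex n) : Rn n :=
  WithLp.toLp 2 fun i => dyadicCorner o l q i - 2 * n * dyadicSide l q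

/-- The side length of the dilate of a dyadic box. -/
def starSide (l : ℝ) (q : DyadicIndex n) : ℝ := (4 * n + 1) * dyadicSide l q

/-- The dilate of a dyadic box. -/
def starCube (o : Rn n) (l : ℝ) (q : DyadicIndex n) : Set (Rn n) :=
  cube (starCorner o l q) (starSide l q)

end

variable {o : Rn n} {l : ℝ}

theorem starSide_pos (hl : 0 < l) (q : DyadicIndex n) : 0 < starSide l q := by
  have := dyadicSide_pos hl q
  unfold starSide
  positivity

theorem measurableSet_starCube (q : DyadicIndex n) : MeasurableSet (starCube o l q) :=
  measurableSet_cube _ _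

theorem mem_starCube_iff {q : DyadicIndex n} {z : Rn n} : z ∈ starCube o l q ↔
    ∀ i, dyadicCorner o l q i - 2 * n * dyadicSide l q ≤ z i ∧
      z i ≤ dyadicCorner o l q i + (2 * n + 1) * dyadicSide l q := by
  refine forall_congr' fun i => ?_
  simp only [starCorner, starSide]
  constructor <;> rintro ⟨h1, h2⟩ <;> constructor <;> linarith

theorem cube_subset_starCube (hl : 0 < l) (q : DyadicIndex n) :
    cube (dyadicCorner o l q) (dyadicSide l q) ⊆ starCube o l q := by
  intro z hz
  have hs := dyadicSide_pos hl q
  refine mem_starCube_iff.2 fun i => ?_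
  have h1 := hz i
  have h2 : 0 ≤ 2 * n * dyadicSide l q := by positivity
  constructor <;> linarith [h1.1, h1.2]

theorem dyadicBox_subset_starCube (hl : 0 < l) (q : DyadicIndex n) :
    dyadicBox o l q ⊆ starCube o l q :=
  (dyadicBox_subset_cube hl q).trans (cube_subset_starCube hl q)

/-- The dilate adds `2 * n` side lengths on every side because `n` side lengths bound the diameter
of the box; twice that bound is the separation the kernel estimate requires. -/
theorem le_norm_sub_of_notMem_starCube (hl : 0 < l) {q : DyadicIndex n} {x z : Rn n}
    (hx : x ∈ dyadicBox o l q) (hz : z ∉ starCube o l q) : 2 * (n * dyadicSide l q) ≤ ‖x - z‖ := by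
  rw [mem_starCube_iff] at hz
  push Not at hz
  obtain ⟨i, hi⟩ := hz
  have hxi := (mem_dyadicBox_iff hl).1 hx i
  refine le_trans ?_ (abs_apply_le_norm (x - z) i)
  rw [PiLp.sub_apply, le_abs]
  by_cases h : dyadicCorner o l q i - 2 * n * dyadicSide l q ≤ z i
  · right; linarith [hi h]
  · left; linarith

theorem starCube_subset_closedBall (hl : 0 < l) {q : DyadicIndex n} {x : Rn n}
    (hx : x ∈ dyadicBox o l q) :
    starCube o l q ⊆ Metric.closedBall x (n * ((2 * n + 1) * dyadicSide l q)) := by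
  intro z hz
  rw [Metric.mem_closedBall, dist_eq_norm]
  refine norm_le_of_forall_abs_le fun i => ?_
  have h1 := mem_starCube_iff.1 hz i
  have h2 := (mem_dyadicBox_iff hl).1 hx i
  rw [PiLp.sub_apply, abs_le]
  constructor <;> linarith [h1.1, h1.2, h2.1, h2.2]

theorem starCube_subset_starCube (hl : 0 < l) {p q : DyadicIndex n}
    (h : dyadicBox o l p ⊆ dyadicBox o l q) : starCube o l p ⊆ starCube o l q := by
  have hp := dyadicSide_pos hl p
  have key : ∀ s : ℝ, 0 ≤ s → s < dyadicSide l p → ∀ i, dyadicCorner o l q i ≤ dyadicCorner o l p i ∧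
      dyadicCorner o l p i + s < dyadicCorner o l q i + dyadicSide l q := by
    intro s hs hsp i
    have hmem : ∀ s : ℝ, 0 ≤ s → s < dyadicSide l p →
        (WithLp.toLp 2 fun i => dyadicCorner o l p i + s : Rn n) ∈ dyadicBox o l p := by
      intro s hs hsp
      refine (mem_dyadicBox_iff hl).2 fun i => ?_
      simp only
      constructor <;> linarith
    have h0 := (mem_dyadicBox_iff hl).1 (h (hmem 0 le_rfl hp)) i
    have h1 := (mem_dyadicBox_iff hl).1 (h (hmem s hs hsp)) i
    simp only at h0 h1
    exact ⟨by linarith [h0.1], h1.2⟩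
  intro z hz
  refine mem_starCube_iff.2 fun i => ?_
  have hzi := mem_starCube_iff.1 hz i
  have h1 := (key 0 le_rfl hp i).1
  -- The boxes are half-open, so the upper faces are compared through points arbitrarily close to
  -- them.
  have h2 : dyadicCorner o l p i + dyadicSide l p ≤ dyadicCorner o l q i + dyadicSide l q := by
    by_contra! hcon
    have h3 := (key 0 le_rfl hp i).2
    have h4 := (key (dyadicCorner o l q i + dyadicSide l q - dyadicCorner o l p i) (by linarith)
      (by linarith) i).2
    linarith
  have h3 : dyadicSide l p ≤ dyadicSide l q := by linarith
  have h4 : 2 * n * dyadicSide l p ≤ 2 * n * dyadicSide l q := by gcongr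
  constructor
  · linarith [hzi.1]
  · have : z i ≤ dyadicCorner o l p i + (2 * n * dyadicSide l p + dyadicSide l p) := by
      linarith [hzi.2]
    linarith

theorem volume_starCube (hl : 0 < l) (q : DyadicIndex n) :
    volume (starCube o l q) = ENNReal.ofReal ((4 * n + 1) ^ n) * volume (dyadicBox o l q) := by
  rw [starCube, volume_cube, volume_dyadicBox hl, starSide, ENNReal.ofReal_mul (by positivity),
    mul_pow, ENNReal.ofReal_pow (by positivity)]

/-! ### One step of the decomposition -/

theorem exists_mul_inv_ofReal_le {K η : ℝ≥0∞} (hK : K ≠ ∞) (hη : η ≠ 0) :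
    ∃ c : ℝ, 1 ≤ c ∧ K * (ENNReal.ofReal c)⁻¹ ≤ η := by
  have hKη : K / η ≠ ∞ := ENNReal.div_ne_top hK hη
  refine ⟨(K / η).toReal + 1, le_add_of_nonneg_left ENNReal.toReal_nonneg, ?_⟩
  have hc : 0 < (K / η).toReal + 1 := by positivity
  rw [← div_eq_mul_inv, ENNReal.div_le_iff (ENNReal.ofReal_pos.2 hc).ne' ENNReal.ofReal_ne_top, mul_comm]
  by_cases hηt : η = ∞
  · simp [hηt]
  rw [← ENNReal.div_le_iff hη hηt]
  conv_lhs => rw [← ENNReal.ofReal_toReal hKη]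
  exact ENNReal.ofReal_le_ofReal (by linarith)

/-- One half plus one quarter is less than one, so a point avoiding all three sets remains. -/
theorem exists_mem_diff_of_measure_le {X : Type*} [MeasurableSpace X] {μ : Measure X}
    {P E E' N : Set X} (hP0 : μ P ≠ 0) (hPt : μ P ≠ ∞) (hE : μ (E ∩ P) ≤ 2⁻¹ * μ P)
    (hE' : μ E' ≤ 4⁻¹ * μ P) (hN : μ N = 0) : ∃ y ∈ P, y ∉ E ∧ y ∉ E' ∧ y ∉ N := by
  by_contra! hcon
  have hsub : P ⊆ (E ∩ P) ∪ (E' ∪ N) := by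
    intro y hy
    by_cases h1 : y ∈ E
    · exact Or.inl ⟨h1, hy⟩
    by_cases h2 : y ∈ E'
    · exact Or.inr (Or.inl h2)
    · exact Or.inr (Or.inr (hcon y hy h1 h2))
  have h1 : μ P ≤ (2⁻¹ + 4⁻¹) * μ P := by
    calc μ P ≤ μ (E ∩ P) + (μ E' + μ N) :=
          (measure_mono hsub).trans ((measure_union_le _ _).trans (by
            gcongr; exact measure_union_le _ _))
      _ ≤ 2⁻¹ * μ P + (4⁻¹ * μ P + 0) := by rw [hN]; gcongr
      _ = _ := by rw [add_zero, add_mul]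
  have h2 : (2⁻¹ + 4⁻¹ : ℝ≥0∞) < 1 := by
    calc (2⁻¹ + 4⁻¹ : ℝ≥0∞) < 2⁻¹ + 2⁻¹ := by
          refine ENNReal.add_lt_add_left (by simp) ?_
          rw [ENNReal.inv_lt_inv]
          norm_num
      _ = 1 := ENNReal.inv_two_add_inv_two
  have h3 : (2⁻¹ + 4⁻¹ : ℝ≥0∞) * μ P < 1 * μ P := by
    rw [mul_comm, mul_comm 1]
    exact ENNReal.mul_right_strictMono hP0 hPt h2
  rw [one_mul] at h3
  exact h3.not_ge h1

/-- Outside a small exceptional set `T g` is bounded, and on boxes that are not filled by this set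
`T g` is bounded up to its localization. -/
theorem IsCZOperator.exists_exceptional_set {T : (Fin m → Rn n → 𝕜) → Rn n → 𝕜}
    (hT : IsCZOperator T) (hn : 0 < n) (hm : 0 < m) {η : ℝ≥0∞} (hη : η ≠ 0) : ∃ Λ : ℝ, 0 ≤ Λ ∧
    ∀ (o : Rn n) (l : ℝ), 0 < l → ∀ (g : Fin m → Rn n → 𝕜) (v : Fin m → ℝ) (V : ℝ≥0∞),
    (∀ j, IsNice (g j)) → (∀ j, 0 ≤ v j) →
    (∀ j, ∫⁻ x, ‖g j x‖ₑ ≤ ENNReal.ofReal (v j) * V) →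
    ∃ E : Set (Rn n), volume E ≤ η * V ∧ (∀ x ∉ E, ‖T g x‖ ≤ Λ * ∏ j, v j) ∧
      ∀ P : DyadicIndex n, volume (E ∩ dyadicBox o l P) ≤ 2⁻¹ * volume (dyadicBox o l P) →
        ∀ᵐ x, x ∈ dyadicBox o l P →
          ‖T g x - T (fun j => (starCube o l P).indicator (g j)) x‖ ≤ Λ * ∏ j, v j := by
  obtain ⟨D₁, hD₁⟩ := hT.exists_measure_lt_le hm
  obtain ⟨D₂, hD₂⟩ := exists_measure_ball_average_lt_le (𝕜 := 𝕜) hn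
  obtain ⟨C, hC⟩ := hT.exists_oscLE_sub hm
  -- `c` makes the set of large `T g` and the `m` sets of large ball averages small together; `c'`
  -- makes the set of large values of the localized operator at most a quarter of a box.
  obtain ⟨c, hc1, hc⟩ := exists_mul_inv_ofReal_le (K := D₁ + m * D₂) (by finiteness) hη
  obtain ⟨c', hc'1, hc'⟩ := exists_mul_inv_ofReal_le (K := D₁) (η := 4⁻¹) (by finiteness) (by simp)
  have hc0 : 0 < c := one_pos.trans_le hc1
  have hc'0 : 0 < c' := one_pos.trans_le hc'1
  set κ : ℝ := (n * (2 * n + 1)) ^ n with hκ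
  have hκ0 : 0 ≤ κ := by positivity
  refine ⟨c ^ m + c' ^ m * (c * κ) ^ m + C * c ^ m, by positivity,
    fun o l hl g v V hg hv hint => ?_⟩
  have hprod : 0 ≤ ∏ j, v j := Finset.prod_nonneg fun j _ => hv j
  set E₁ : Set (Rn n) := {x | c ^ m * ∏ j, v j < ‖T g x‖} with hE₁
  set E₂ : Fin m → Set (Rn n) := fun j => {x | ∃ ρ : ℝ, 0 < ρ ∧
    ENNReal.ofReal (c * v j) * ENNReal.ofReal ρ ^ n < ∫⁻ z in Metric.closedBall x ρ, ‖g j z‖ₑ} with hE₂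
  have hT1 : ∀ x ∉ E₁ ∪ ⋃ j, E₂ j, ‖T g x‖ ≤ c ^ m * ∏ j, v j := by
    intro x hx
    by_contra! h
    exact hx (Or.inl h)
  have hT2 : ∀ x ∉ E₁ ∪ ⋃ j, E₂ j, ∀ j, ∀ ρ : ℝ, 0 < ρ →
      ∫⁻ z in Metric.closedBall x ρ, ‖g j z‖ₑ ≤ ENNReal.ofReal (c * v j) * ENNReal.ofReal ρ ^ n := by
    intro x hx j ρ hρ
    by_contra! h
    exact hx (Or.inr (mem_iUnion.2 ⟨j, ρ, hρ, h⟩))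
  refine ⟨E₁ ∪ ⋃ j, E₂ j, ?_, ?_, ?_⟩
  · calc volume (E₁ ∪ ⋃ j, E₂ j) ≤ volume E₁ + ∑ j, volume (E₂ j) :=
          (measure_union_le _ _).trans (by gcongr; exact measure_iUnion_fintype_le _ _)
      _ ≤ D₁ * (ENNReal.ofReal c)⁻¹ * V + ∑ _j : Fin m, D₂ * (ENNReal.ofReal c)⁻¹ * V := by
        gcongr with j
        · exact hD₁ g hg v V hv hint c hc0
        · exact hD₂ (g j) (hg j).integrable (v j) V (hv j) (hint j) c hc0
      _ = (D₁ + m * D₂) * (ENNReal.ofReal c)⁻¹ * V := by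
        rw [Finset.sum_const, Finset.card_univ, Fintype.card_fin, nsmul_eq_mul]
        ring
      _ ≤ η * V := by gcongr
  · intro x hx
    refine (hT1 x hx).trans ?_
    gcongr
    have h1 : 0 ≤ c' ^ m * (c * κ) ^ m := by positivity
    have h2 : 0 ≤ C * c ^ m := by positivity
    linarith
  · intro P hP
    have hP0 := volume_dyadicBox_ne_zero (o := o) hl P
    have hPt := volume_dyadicBox_ne_top (o := o) hl P
    have hs := dyadicSide_pos hl P
    have hn' : (0 : ℝ) < n := by exact_mod_cast hn
    -- A point of `P` outside the exceptional set controls the averages over all balls centred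
    -- there, hence the oscillation over `P` and the mass on the dilate.
    obtain ⟨x₀, hx₀, hx₀E, -⟩ := exists_mem_diff_of_measure_le (E' := ∅) (N := ∅) hP0 hPt hP
      (by simp) (by simp)
    have hball := hT2 x₀ hx₀E
    obtain ⟨N, hN, hosc⟩ := hC (dyadicBox o l P) (n * dyadicSide l P) (by positivity)
      (fun x hx x' hx' => norm_sub_le_of_mem_dyadicBox hl hx hx') x₀ hx₀ (starCube o l P)
      (measurableSet_starCube P) (fun x hx z hz => le_norm_sub_of_notMem_starCube hl hx hz) g
      (fun j => ENNReal.ofReal (c * v j)) hg hball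
    set gP : Fin m → Rn n → 𝕜 := fun j => (starCube o l P).indicator (g j) with hgP
    have hgPn : ∀ j, IsNice (gP j) := fun j => (hg j).indicator (measurableSet_starCube P)
    have hintP : ∀ j, ∫⁻ x, ‖gP j x‖ₑ ≤ ENNReal.ofReal (c * v j * κ) * volume (dyadicBox o l P) := by
      intro j
      have hcv : 0 ≤ c * v j := mul_nonneg hc0.le (hv j)
      calc ∫⁻ x, ‖gP j x‖ₑ = ∫⁻ x in starCube o l P, ‖g j x‖ₑ := by
            rw [← lintegral_indicator (measurableSet_starCube P)]
            exact lintegral_congr fun x => by simp only [hgP, enorm_indicator_eq_indicator_enorm]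
        _ ≤ ∫⁻ x in Metric.closedBall x₀ (n * ((2 * n + 1) * dyadicSide l P)), ‖g j x‖ₑ :=
          lintegral_mono_set (starCube_subset_closedBall hl hx₀)
        _ ≤ _ := hball j _ (by positivity)
        _ = _ := by
          rw [volume_dyadicBox hl, ← mul_assoc, ENNReal.ofReal_mul (q := dyadicSide l P)
            (by positivity), mul_pow, ENNReal.ofReal_mul (q := κ) hcv, hκ,
            ENNReal.ofReal_pow (by positivity), mul_assoc]
    have hweak := hD₁ gP hgPn (fun j => c * v j * κ) _
      (fun j => mul_nonneg (mul_nonneg hc0.le (hv j)) hκ0) hintP c' hc'0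
    have hweak' : volume {x | c' ^ m * ∏ j, (c * v j * κ) < ‖T gP x‖} ≤
        4⁻¹ * volume (dyadicBox o l P) := hweak.trans (by gcongr)
    -- At `y` both `T g` and its localization are bounded. The oscillation bound carries their
    -- difference from `y` to almost every point of `P`.
    obtain ⟨y, hyP, hyE, hyE', hyN⟩ := exists_mem_diff_of_measure_le hP0 hPt hP hweak' hN
    have hy1 := hT1 y hyE
    have hy2 : ‖T gP y‖ ≤ c' ^ m * (c * κ) ^ m * ∏ j, v j := by
      have h1 : ∏ j, (c * v j * κ) = (c * κ) ^ m * ∏ j, v j := by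
        rw [show (fun j => c * v j * κ) = fun j => (c * κ) * v j by ext j; ring,
          Finset.prod_mul_distrib]
        simp
      simp only [h1, mem_ofPred_eq, not_lt] at hyE'
      linarith
    filter_upwards [measure_eq_zero_iff_ae_notMem.1 hN] with x hxN hx
    have h1 := hosc x ⟨hx, hxN⟩ y ⟨hyP, hyN⟩
    have h2 : ‖(T g - T gP) x - (T g - T gP) y‖ ≤ C * c ^ m * ∏ j, v j := by
      rw [← ENNReal.ofReal_prod_of_nonneg fun j _ => mul_nonneg hc0.le (hv j),
        Finset.prod_mul_distrib, Finset.prod_const, Finset.card_univ, Fintype.card_fin,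
        ← ENNReal.ofReal_coe_nnreal, ← ENNReal.ofReal_mul (NNReal.coe_nonneg C), ← ofReal_norm,
        ENNReal.ofReal_le_ofReal_iff (by positivity)] at h1
      linarith
    calc ‖T g x - T gP x‖ = ‖((T g - T gP) x - (T g - T gP) y) + T g y - T gP y‖ := by
          simp only [Pi.sub_apply]; congr 1; ring
      _ ≤ ‖(T g - T gP) x - (T g - T gP) y‖ + ‖T g y‖ + ‖T gP y‖ :=
        (norm_sub_le _ _).trans (by gcongr; exact norm_add_le _ _)
      _ ≤ C * c ^ m * ∏ j, v j + c ^ m * ∏ j, v j + c' ^ m * (c * κ) ^ m * ∏ j, v j := by gcongr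
      _ = _ := by ring

/-- Outside a small exceptional set a function of bounded mean oscillation is close to its
average. -/
theorem exists_exceptional_set_of_bmoNorm_le (n : ℕ) (𝕜 : Type*) [RCLike 𝕜] {η : ℝ≥0∞}
    (hη : η ≠ 0) : ∃ c : ℝ, 1 ≤ c ∧ ∀ (o : Rn n) (l : ℝ), 0 < l → ∀ (b : Rn n → 𝕜) (β : ℝ),
      LocallyIntegrable b → 0 ≤ β → bmoNorm b ≤ ENNReal.ofReal β → ∀ q : DyadicIndex n,
      volume (starCube o l q ∩
        {x | c * β < ‖b x - cubeMean b (starCorner o l q) (starSide l q)‖}) ≤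
          η * volume (dyadicBox o l q) := by
  obtain ⟨c, hc1, hc⟩ := exists_mul_inv_ofReal_le (K := ENNReal.ofReal ((4 * n + 1) ^ n))
    ENNReal.ofReal_ne_top hη
  refine ⟨c, hc1, fun o l hl b β hb hβ0 hβ q => ?_⟩
  have h1 := measure_lt_le_of_lintegral_le (measurableSet_cube _ _)
      (hb.aestronglyMeasurable.sub aestronglyMeasurable_const).restrict hβ0
      (lintegral_sub_cubeMean_le hβ (starCorner o l q) (starSide_pos hl q))
      (c := c) (one_pos.trans_le hc1)
  refine h1.trans ?_
  have h2 := volume_starCube (o := o) hl q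
  rw [starCube] at h2
  rw [h2, ← mul_assoc, mul_comm (ENNReal.ofReal c)⁻¹]
  gcongr

end

/-! ### One stopping step for the commutator -/

section

variable {n m : ℕ} {𝕜 : Type*} [RCLike 𝕜]

theorem BddCompactSupp.isNice {f : Fin m → Rn n → 𝕜} (hf : BddCompactSupp f) (j : Fin m) :
    IsNice (f j) := by
  refine ⟨(hf j).2, fun k => ?_⟩
  have hK : IsCompact (tsupport (f j)) := (hf j).2
  have : IsFiniteMeasure (volume.restrict (tsupport (f j))) :=
    ⟨by simpa using hK.measure_lt_top⟩
  have h1 : (tsupport (f j)).indicator (f j) = f j := by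
    rw [indicator_eq_self]
    exact subset_tsupport _
  rw [← h1, memLp_indicator_iff_restrict (isClosed_tsupport _).measurableSet]
  exact ((hf j).1.restrict _).mono_exponent le_top

theorem BddCompactSupp.exists_luxemburg_le {f : Fin m → Rn n → 𝕜} (hf : BddCompactSupp f)
    (j : Fin m) : ∃ B : ℝ, ∀ (a : Rn n) (l : ℝ), 0 < l →
      luxemburg (f j) a l ≤ ENNReal.ofReal B := by
  have hfin := (hf j).1.2
  refine ⟨(eLpNorm (f j) ∞ volume).toReal + 1, fun a l hl =>
    luxemburg_le_of_ae_norm_le (by positivity) ?_ a hl⟩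
  filter_upwards [ae_le_eLpNormEssSup (f := f j) (μ := volume)] with x hx
  rw [← eLpNorm_exponent_top, ← ofReal_norm,
    ENNReal.ofReal_le_iff_le_toReal hfin.ne] at hx
  linarith

/-- Each of the `2 ^ m` terms receives `β j` exactly once: from the symbol outside if `j ∉ B`, from
the entry inside if `j ∈ B`. -/
theorem norm_sum_prod_compl_mul_le {y : Fin m → 𝕜} {u : Finset (Fin m) → 𝕜} {D Λ : ℝ}
    {β : Fin m → ℝ} (hD : 1 ≤ D) (hβ : ∀ j, 0 ≤ β j) (hy : ∀ j, ‖y j‖ ≤ D * β j)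
    (hu : ∀ B, ‖u B‖ ≤ Λ * ∏ j ∈ B, β j) :
    ‖∑ B : Finset (Fin m), (-1) ^ B.card * (∏ j ∈ Bᶜ, y j) * u B‖ ≤
      2 ^ m * Λ * D ^ m * ∏ j, β j := by
  calc _ ≤ ∑ _B : Finset (Fin m), Λ * D ^ m * ∏ j, β j := by
        refine norm_sum_le_of_le _ fun B _ => ?_
        rw [norm_mul, norm_mul, norm_pow, norm_neg, norm_one, one_pow, one_mul, norm_prod]
        have h1 : ∏ j ∈ Bᶜ, ‖y j‖ ≤ D ^ m * ∏ j ∈ Bᶜ, β j := by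
          calc ∏ j ∈ Bᶜ, ‖y j‖ ≤ ∏ j ∈ Bᶜ, (D * β j) :=
                Finset.prod_le_prod (fun _ _ => norm_nonneg _) fun j _ => hy j
            _ = D ^ (Bᶜ).card * ∏ j ∈ Bᶜ, β j := by
              rw [Finset.prod_mul_distrib, Finset.prod_const]
            _ ≤ D ^ m * ∏ j ∈ Bᶜ, β j := by
              refine mul_le_mul_of_nonneg_right (pow_le_pow_right₀ hD ?_)
                (Finset.prod_nonneg fun j _ => hβ j)
              simpa using Finset.card_le_univ (Bᶜ)
        have h2 : 0 ≤ D ^ m * ∏ j ∈ Bᶜ, β j :=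
          mul_nonneg (by positivity) (Finset.prod_nonneg fun j _ => hβ j)
        calc _ ≤ (D ^ m * ∏ j ∈ Bᶜ, β j) * (Λ * ∏ j ∈ B, β j) :=
              mul_le_mul h1 (hu B) (norm_nonneg _) h2
          _ = Λ * D ^ m * ((∏ j ∈ B, β j) * ∏ j ∈ Bᶜ, β j) := by ring
          _ = _ := by rw [Finset.prod_mul_prod_compl]
    _ = _ := by
      rw [Finset.sum_const, Finset.card_univ, Fintype.card_finset, Fintype.card_fin, nsmul_eq_mul]
      push_cast
      ring

theorem norm_iteratedCommutator_le {T : (Fin m → Rn n → 𝕜) → Rn n → 𝕜}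
    {b g : Fin m → Rn n → 𝕜} {x : Rn n} {D Λ : ℝ} {β : Fin m → ℝ} (hD : 1 ≤ D)
    (hβ : ∀ j, 0 ≤ β j) (hb : ∀ j, ‖b j x‖ ≤ D * β j)
    (hg : ∀ B, ‖T (mulOn B b g) x‖ ≤ Λ * ∏ j ∈ B, β j) :
    ‖iteratedCommutator b T g x‖ ≤ 2 ^ m * Λ * D ^ m * ∏ j, β j := by
  rw [iteratedCommutator_eq_sum]
  exact norm_sum_prod_compl_mul_le hD hβ hb hg

theorem norm_iteratedCommutator_sub_le {T : (Fin m → Rn n → 𝕜) → Rn n → 𝕜}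
    {b g g' : Fin m → Rn n → 𝕜} {x : Rn n} {D Λ : ℝ} {β : Fin m → ℝ} (hD : 1 ≤ D)
    (hβ : ∀ j, 0 ≤ β j) (hb : ∀ j, ‖b j x‖ ≤ D * β j)
    (hg : ∀ B, ‖T (mulOn B b g) x - T (mulOn B b g') x‖ ≤ Λ * ∏ j ∈ B, β j) :
    ‖iteratedCommutator b T g x - iteratedCommutator b T g' x‖ ≤
      2 ^ m * Λ * D ^ m * ∏ j, β j := by
  rw [iteratedCommutator_eq_sum, iteratedCommutator_eq_sum, ← Finset.sum_sub_distrib]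
  simp only [← mul_sub]
  exact norm_sum_prod_compl_mul_le hD hβ hb hg

noncomputable section

/-- The average of `b` over the dilate of a dyadic box. -/
def starMean (o : Rn n) (l : ℝ) (b : Rn n → 𝕜) (q : DyadicIndex n) : 𝕜 :=
  cubeMean b (starCorner o l q) (starSide l q)

/-- The restriction of a tuple of functions to the dilate of a dyadic box. -/
def starRestrict (o : Rn n) (l : ℝ) (f : Fin m → Rn n → 𝕜) (q : DyadicIndex n) :
    Fin m → Rn n → 𝕜 := fun j => (starCube o l q).indicator (f j)

/-- The Luxemburg average over the dilate of a dyadic box. -/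
def starLux (o : Rn n) (l : ℝ) (f : Rn n → 𝕜) (q : DyadicIndex n) : ℝ :=
  (luxemburg f (starCorner o l q) (starSide l q)).toReal

end

theorem starRestrict_mulOn {o : Rn n} {l : ℝ} (B : Finset (Fin m)) (b f : Fin m → Rn n → 𝕜)
    (q : DyadicIndex n) :
    starRestrict o l (mulOn B b f) q = mulOn B b (starRestrict o l f q) := by
  ext j x
  by_cases hB : j ∈ B <;> by_cases hx : x ∈ starCube o l q <;>
    simp [starRestrict, mulOn, hB, hx]

theorem starRestrict_starRestrict {o : Rn n} {l : ℝ} (hl : 0 < l) {P q : DyadicIndex n}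
    (h : dyadicBox o l P ⊆ dyadicBox o l q) (f : Fin m → Rn n → 𝕜) :
    starRestrict o l (starRestrict o l f q) P = starRestrict o l f P := by
  ext j x
  simp only [starRestrict, indicator_indicator,
    inter_eq_left.2 (starCube_subset_starCube hl h)]

theorem isNice_mulOn {b g : Fin m → Rn n → 𝕜} (hb : ∀ j, IsMultiplier (b j))
    (hg : ∀ j, IsNice (g j)) (B : Finset (Fin m)) (j : Fin m) : IsNice (mulOn B b g j) := by
  by_cases hB : j ∈ B
  · simpa [mulOn, hB] using hb j _ (hg j)
  · simpa [mulOn, hB] using hg j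

theorem isNice_starRestrict {o : Rn n} {l : ℝ} {f : Fin m → Rn n → 𝕜} (hf : ∀ j, IsNice (f j))
    (q : DyadicIndex n) (j : Fin m) : IsNice (starRestrict o l f q j) :=
  (hf j).indicator (measurableSet_starCube q)

/-- One step of the decomposition for the terms of the iterated commutator. -/
theorem IsCZOperator.exists_commutator_exceptional_set {T : (Fin m → Rn n → 𝕜) → Rn n → 𝕜}
    (hT : IsCZOperator T) (hn : 0 < n) (hm : 0 < m) {η : ℝ≥0∞} (hη : η ≠ 0) :
    ∃ c Λ : ℝ, 1 ≤ c ∧ 0 ≤ Λ ∧ ∀ b : Fin m → Rn n → 𝕜, (∀ j, IsBMO (b j)) →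
      ∀ β : Fin m → ℝ, (∀ j, 0 ≤ β j) → (∀ j, bmoNorm (b j) ≤ ENNReal.ofReal (β j)) →
      ∀ f : Fin m → Rn n → 𝕜, BddCompactSupp f → ∀ (o : Rn n) (l : ℝ), 0 < l →
      ∀ q : DyadicIndex n, ∃ E : Set (Rn n), volume E ≤ η * volume (dyadicBox o l q) ∧
        (∀ j, ∀ x ∈ starCube o l q, x ∉ E → ‖b j x - starMean o l (b j) q‖ ≤ c * β j) ∧
        (∀ x ∉ E, ∀ B, ‖T (mulOn B (fun j x => b j x - starMean o l (b j) q)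
          (starRestrict o l f q)) x‖ ≤ Λ * (∏ j, starLux o l (f j) q) * ∏ j ∈ B, β j) ∧
        ∀ P : DyadicIndex n, dyadicBox o l P ⊆ dyadicBox o l q →
          volume (E ∩ dyadicBox o l P) ≤ 2⁻¹ * volume (dyadicBox o l P) →
          ∀ᵐ x, x ∈ dyadicBox o l P → ∀ B,
            ‖T (mulOn B (fun j x => b j x - starMean o l (b j) q) (starRestrict o l f q)) x -
              T (mulOn B (fun j x => b j x - starMean o l (b j) q) (starRestrict o l f P)) x‖ ≤
              Λ * (∏ j, starLux o l (f j) q) * ∏ j ∈ B, β j := by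
  -- The allowance is shared by the `2 ^ m` tuples in the expansion and the `m` symbols.
  set η' : ℝ≥0∞ := η / (2 ^ m + m) with hη'
  have hη'0 : η' ≠ 0 := ENNReal.div_ne_zero.2 ⟨hη, by finiteness⟩
  obtain ⟨Λ, hΛ0, hΛ⟩ := hT.exists_exceptional_set hn hm hη'0
  obtain ⟨c, hc1, hc⟩ := exists_exceptional_set_of_bmoNorm_le n 𝕜 hη'0
  obtain ⟨C, hC⟩ := exists_lintegral_sub_cubeMean_mul_le n 𝕜
  set R : ℝ := (C + 1) * (4 * n + 1) ^ n with hR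
  have hR0 : 0 ≤ R := by positivity
  refine ⟨c, Λ * R ^ m, hc1, by positivity, fun b hb β hβ0 hβ f hf o l hl q => ?_⟩
  set bq : Fin m → Rn n → 𝕜 := fun j x => b j x - starMean o l (b j) q with hbq
  have hbqm : ∀ j, IsMultiplier (bq j) := fun j => (hb j).isMultiplier.sub_const _
  set V := volume (dyadicBox o l q) with hV
  have hL0 : ∀ j, 0 ≤ starLux o l (f j) q := fun j => ENNReal.toReal_nonneg
  have hL : ∀ j, luxemburg (f j) (starCorner o l q) (starSide l q) =
      ENNReal.ofReal (starLux o l (f j) q) := by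
    intro j
    obtain ⟨B, hB⟩ := hf.exists_luxemburg_le j
    exact (ENNReal.ofReal_toReal (((hB _ _ (starSide_pos hl q)).trans_lt
      ENNReal.ofReal_lt_top).ne)).symm
  -- Entries carrying a symbol are bounded by the `L log L`-BMO pairing, the others by the plain
  -- `L¹` bound. `R` serves both cases and includes the volume ratio of the dilate.
  set v : Finset (Fin m) → Fin m → ℝ := fun B j =>
    R * starLux o l (f j) q * (if j ∈ B then β j else 1) with hv
  have hv0 : ∀ B j, 0 ≤ v B j := by
    intro B j
    refine mul_nonneg (mul_nonneg hR0 (hL0 j)) ?_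
    split_ifs
    exacts [hβ0 j, zero_le_one]
  have hvprod : ∀ B, Λ * ∏ j, v B j = Λ * R ^ m * (∏ j, starLux o l (f j) q) * ∏ j ∈ B, β j := by
    intro B
    simp only [hv]
    rw [Finset.prod_mul_distrib, Finset.prod_mul_distrib, Finset.prod_const, Finset.card_univ,
      Fintype.card_fin, Finset.prod_ite_mem, Finset.univ_inter]
    ring
  have hnice : ∀ B j, IsNice (mulOn B bq (starRestrict o l f q) j) :=
    isNice_mulOn hbqm (isNice_starRestrict hf.isNice q)
  have hint : ∀ B j, ∫⁻ x, ‖mulOn B bq (starRestrict o l f q) j x‖ₑ ≤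
      ENNReal.ofReal (v B j) * V := by
    intro B j
    rw [← starRestrict_mulOn]
    have h1 : ∫⁻ x, ‖starRestrict o l (mulOn B bq f) q j x‖ₑ =
        ∫⁻ x in starCube o l q, ‖mulOn B bq f j x‖ₑ := by
      rw [← lintegral_indicator (measurableSet_starCube q)]
      exact lintegral_congr fun x => by
        simp only [starRestrict, enorm_indicator_eq_indicator_enorm]
    have hvol := volume_starCube (o := o) hl q
    rw [h1]
    have hRe : ENNReal.ofReal R = (C + 1) * ENNReal.ofReal ((4 * n + 1) ^ n) := by
      rw [hR, ENNReal.ofReal_mul (by positivity), ENNReal.ofReal_add C.coe_nonneg zero_le_one]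
      simp
    by_cases hB : j ∈ B
    · simp only [mulOn, hv, hB, if_true]
      refine (hC (b j) (hb j).1 (β j) (hβ0 j) (hβ j) (f j) (hf j).1.1 (starCorner o l q)
        (starSide l q) (starSide_pos hl q)).trans ?_
      rw [hL, ← starCube, hvol, ENNReal.ofReal_mul (mul_nonneg hR0 (hL0 j)), ENNReal.ofReal_mul hR0,
        hRe]
      calc _ = C * (ENNReal.ofReal ((4 * n + 1) ^ n) * ENNReal.ofReal (starLux o l (f j) q) *
            ENNReal.ofReal (β j) * V) := by ring
        _ ≤ (C + 1) * (ENNReal.ofReal ((4 * n + 1) ^ n) * ENNReal.ofReal (starLux o l (f j) q) *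
            ENNReal.ofReal (β j) * V) := by gcongr; exact le_self_add
        _ = _ := by ring
    · simp only [mulOn, hv, hB, if_false, mul_one]
      refine (lintegral_enorm_le_luxemburg (f j) (starCorner o l q) (starSide_pos hl q)).trans ?_
      rw [hL, ← starCube, hvol, ENNReal.ofReal_mul hR0, hRe]
      calc _ = 1 * (ENNReal.ofReal ((4 * n + 1) ^ n) * ENNReal.ofReal (starLux o l (f j) q) *
            V) := by ring
        _ ≤ (C + 1) * (ENNReal.ofReal ((4 * n + 1) ^ n) * ENNReal.ofReal (starLux o l (f j) q) *
            V) := by gcongr; exact le_add_self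
        _ = _ := by ring
  choose E hE1 hE2 hE3 using fun B => hΛ o l hl (mulOn B bq (starRestrict o l f q)) (v B) V
    (hnice B) (hv0 B) (hint B)
  set E' : Fin m → Set (Rn n) := fun j => starCube o l q ∩ {x | c * β j < ‖bq j x‖} with hE'
  have hE'1 : ∀ j, volume (E' j) ≤ η' * V := fun j => hc o l hl (b j) (β j) (hb j).1 (hβ0 j) (hβ j) q
  refine ⟨(⋃ B, E B) ∪ ⋃ j, E' j, ?_, ?_, ?_, ?_⟩
  · calc _ ≤ ∑ B, volume (E B) + ∑ j, volume (E' j) :=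
          (measure_union_le _ _).trans (add_le_add (measure_iUnion_fintype_le _ _)
            (measure_iUnion_fintype_le _ _))
      _ ≤ ∑ _B : Finset (Fin m), η' * V + ∑ _j : Fin m, η' * V := by
        gcongr with B _ j _
        exacts [hE1 B, hE'1 j]
      _ = η' * (2 ^ m + m) * V := by
        rw [Finset.sum_const, Finset.sum_const, Finset.card_univ, Finset.card_univ,
          Fintype.card_finset, Fintype.card_fin, nsmul_eq_mul, nsmul_eq_mul]
        push_cast
        ring
      _ = η * V := by
        rw [hη', ENNReal.div_mul_cancel (by positivity) (by finiteness)]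
  · intro j x hx hxE
    by_contra! hlt
    exact hxE (Or.inr (mem_iUnion.2 ⟨j, hx, hlt⟩))
  · intro x hxE B
    rw [← hvprod]
    exact hE2 B x fun h => hxE (Or.inl (mem_iUnion.2 ⟨B, h⟩))
  · intro P hP hPE
    have h1 : ∀ B, ∀ᵐ x, x ∈ dyadicBox o l P →
        ‖T (mulOn B bq (starRestrict o l f q)) x -
          T (starRestrict o l (mulOn B bq (starRestrict o l f q)) P) x‖ ≤ Λ * ∏ j, v B j := by
      refine fun B => hE3 B P ((measure_mono (inter_subset_inter_left _ fun x hx => ?_)).trans hPE)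
      exact Or.inl (mem_iUnion.2 ⟨B, hx⟩)
    filter_upwards [ae_all_iff.2 h1] with x hx hxP B
    have h2 := hx B hxP
    rwa [starRestrict_mulOn, starRestrict_starRestrict hl hP, hvprod] at h2

end

/-! ### The distributional estimate on a dyadic system -/

section

variable {n m : ℕ} {𝕜 : Type*} [RCLike 𝕜]

theorem weightMeasure_dyadicBox_eq_cube (w : Rn n → ℝ) {o : Rn n} {l : ℝ} (hl : 0 < l)
    (q : DyadicIndex n) : weightMeasure w (dyadicBox o l q) =
      weightMeasure w (cube (dyadicCorner o l q) (dyadicSide l q)) :=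
  measure_congr ((weightMeasure_absolutelyContinuous w).ae_eq (dyadicBox_ae_eq_cube hl q))

/-- A function whose deviation from its averages is controlled off the exceptional sets of a
stopping tree deviates at most linearly in the generation. -/
theorem norm_sub_starMean_le_of_mem_leaves {o : Rn n} {l : ℝ} (hl : 0 < l)
    {ch : DyadicIndex n → Set (DyadicIndex n)}
    {h1 : ∀ Q, ∀ P ∈ ch Q, dyadicBox o l P ⊆ dyadicBox o l Q}
    {h2 : ∀ Q, (ch Q).PairwiseDisjoint (dyadicBox o l)} {E : DyadicIndex n → Set (Rn n)}
    (h3 : ∀ Q, E Q ∩ dyadicBox o l Q ⊆ ⋃ P ∈ ch Q, dyadicBox o l P)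
    (h4 : ∀ Q, ∀ P ∈ ch Q, volume (E Q ∩ dyadicBox o l P) ≤ 2⁻¹ * volume (dyadicBox o l P))
    (h5 : ∀ Q, volume (E Q) ≤ 4⁻¹ * volume (dyadicBox o l Q)) {b : Rn n → 𝕜} {d : ℝ}
    (hd : ∀ Q, ∀ x ∈ starCube o l Q, x ∉ E Q → ‖b x - starMean o l b Q‖ ≤ d) (s : ℕ)
    (Q : DyadicIndex n) (x : Rn n) (hx : x ∈ (stoppingTree ch h1 h2).leaves s Q) :
    ‖b x - starMean o l b Q‖ ≤ 2 * d * (s + 1) := by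
  have hx0 : ∀ x Q, x ∈ (stoppingTree ch h1 h2).leaves 0 Q → ‖b x - starMean o l b Q‖ ≤ d :=
    fun x Q hx => hd Q x (dyadicBox_subset_starCube hl Q hx.1) fun hxE => hx.2 (h3 Q ⟨hxE, hx.1⟩)
  induction s generalizing Q with
  | zero =>
    have h6 := hx0 x Q hx
    have h7 := (norm_nonneg _).trans h6
    push_cast
    linarith
  | succ s ih =>
    obtain ⟨P, hP, hxP⟩ := mem_iUnion₂.1 hx
    -- A point of the child that is good for both boxes compares the two means; a generation
    -- therefore costs `2 * d`.
    obtain ⟨y, hyP, hyQ, hyE, -⟩ := exists_mem_diff_of_measure_le (N := ∅)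
      (volume_dyadicBox_ne_zero hl P) (volume_dyadicBox_ne_top hl P) (h4 Q P hP) (h5 P) (by simp)
    have hy1 := hd Q y (dyadicBox_subset_starCube hl Q (h1 Q P hP hyP)) hyQ
    have hy2 := hd P y (dyadicBox_subset_starCube hl P hyP) hyE
    calc ‖b x - starMean o l b Q‖
        = ‖(b x - starMean o l b P) + (b y - starMean o l b Q) - (b y - starMean o l b P)‖ := by
          congr 1; ring
      _ ≤ ‖b x - starMean o l b P‖ + ‖b y - starMean o l b Q‖ + ‖b y - starMean o l b P‖ :=
        (norm_sub_le _ _).trans (by gcongr; exact norm_add_le _ _)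
      _ ≤ 2 * d * (s + 1) + d + d := by gcongr; exact ih P hxP
      _ = 2 * d * ((s + 1 : ℕ) + 1) := by push_cast; ring

/-- The distributional estimate for the iterated commutator, on a dyadic system of boxes. -/
theorem IsCZOperator.exists_weightMeasure_lt_le {T : (Fin m → Rn n → 𝕜) → Rn n → 𝕜}
    (hT : IsCZOperator T) (hn : 0 < n) (hm : 0 < m) {w : Rn n → ℝ} (hw : IsAInfty w) :
    ∃ (K : ℝ) (θ : ℝ≥0), 0 < K ∧ θ < 1 ∧ ∀ b : Fin m → Rn n → 𝕜, (∀ j, IsBMO (b j)) →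
      ∀ f : Fin m → Rn n → 𝕜, BddCompactSupp f → ∀ (o : Rn n) (l : ℝ), 0 < l →
      ∀ q : DyadicIndex n, ∀ r : ℝ, 0 ≤ r →
        weightMeasure w (dyadicBox o l q ∩
          {x | 2 * K * r < ‖iteratedCommutator b T (starRestrict o l f q) x‖}) ≤
        ∑' s : ℕ, θ ^ s * weightMeasure w (dyadicBox o l q ∩
          {x | ∃ P, x ∈ dyadicBox o l P ∧ (((s : ℝ) + 1) ^ (m + 2))⁻¹ * r <
            (∏ j, (bmoNorm (b j)).toReal) * ∏ j, starLux o l (f j) P}) := by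
  obtain ⟨c, Λ, hc1, hΛ, hstep⟩ := hT.exists_commutator_exceptional_set hn hm
    (η := (2⁻¹ : ℝ≥0∞) ^ (n + 3)) (by simp)
  obtain ⟨θ, hθ1, hθ⟩ := hw.exists_lt_one
  have hwloc : LocallyIntegrable w := hw.choose_spec.2.1
  -- The summand `1` only ensures `0 < K`, so that one may divide by it later.
  set K : ℝ := 2 ^ m * Λ * (2 * c) ^ m + 1 with hK
  have hc0 : 0 < c := one_pos.trans_le hc1
  have hK0 : 0 < K := by positivity
  refine ⟨K, θ, hK0, hθ1, fun b hb f hf o l hl => ?_⟩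
  set β : Fin m → ℝ := fun j => (bmoNorm (b j)).toReal with hβ
  have hβ0 : ∀ j, 0 ≤ β j := fun j => ENNReal.toReal_nonneg
  have hβ1 : ∀ j, bmoNorm (b j) ≤ ENNReal.ofReal (β j) :=
    fun j => (ENNReal.ofReal_toReal (hb j).2.ne).ge
  choose E hE1 hE2 hE3 hE4 using hstep b hb β hβ0 hβ1 f hf o l hl
  choose ch h1 h2 h3 h4 h5 using fun q => exists_stopping_children_of_measure_le hl q (hE1 q)
  set t := stoppingTree ch h1 h2 with ht
  have hE5 : ∀ q, volume (E q) ≤ 4⁻¹ * volume (dyadicBox o l q) := by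
    intro q
    refine (hE1 q).trans ?_
    gcongr
    calc (2⁻¹ : ℝ≥0∞) ^ (n + 3) ≤ 2⁻¹ ^ 2 :=
          pow_le_pow_right_of_le_one' (ENNReal.inv_le_one.2 one_le_two) (by omega)
      _ = 4⁻¹ := by rw [← ENNReal.inv_pow]; norm_num
  have hleaf : ∀ j s q x, x ∈ t.leaves s q →
      ‖b j x - starMean o l (b j) q‖ ≤ 2 * c * ((s : ℝ) + 1) * β j := by
    intro j s q x hx
    have h6 := norm_sub_starMean_le_of_mem_leaves hl h3 h5 hE5 (fun q => hE2 q j) s q x hx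
    linarith
  have hL0 : ∀ q, 0 ≤ ∏ j, starLux o l (f j) q :=
    fun q => Finset.prod_nonneg fun j _ => ENNReal.toReal_nonneg
  have hβp : 0 ≤ ∏ j, β j := Finset.prod_nonneg fun j _ => hβ0 j
  have hac := weightMeasure_absolutelyContinuous w
  -- There are countably many pairs of boxes, so a single null set serves every change of constants.
  have hshift : ∀ᵐ x, ∀ q P, iteratedCommutator b T (starRestrict o l f P) x =
      iteratedCommutator (fun j x => b j x - starMean o l (b j) q) T (starRestrict o l f P) x :=
    ae_all_iff.2 fun q => ae_all_iff.2 fun P =>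
      hT.isMultilinear.iteratedCommutator_sub_const (fun j => (hb j).isMultiplier) _
        (isNice_starRestrict hf.isNice P)
  refine fun q r hr => t.measure_lt_le (a := fun q => (∏ j, β j) * ∏ j, starLux o l (f j) q)
    (F := fun q x => ‖iteratedCommutator b T (starRestrict o l f q) x‖) ?_
    (ENNReal.coe_lt_one_iff.2 hθ1) ?_ hK0.le m ?_ ?_ hr q
  · intro q
    refine (hθ _ _ (dyadicSide_pos hl q) _ ((iUnion₂_subset (h1 q)).trans
      (dyadicBox_subset_cube hl q)) (MeasurableSet.biUnion (to_countable _)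
        fun P _ => measurableSet_dyadicBox P) ?_).trans_eq ?_
    · rw [← volume_dyadicBox_eq_cube hl]
      exact h4 q
    · rw [← weightMeasure_dyadicBox_eq_cube w hl]
      rfl
  · intro q
    exact ne_top_of_le_ne_top (weightMeasure_cube_ne_top hwloc _ _)
      (measure_mono (dyadicBox_subset_cube hl q))
  · filter_upwards [hac.ae_le hshift] with x hx q hxq
    have hxE : x ∉ E q := fun hxE => hxq.2 (h3 q ⟨hxE, hxq.1⟩)
    have h6 := norm_iteratedCommutator_le (T := T) (D := 2 * c) (by linarith) hβ0
      (fun j => by simpa using hleaf j 0 q x hxq) (hE3 q x hxE)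
    rw [hx q q]
    refine h6.trans ?_
    have h7 := mul_nonneg hβp (hL0 q)
    rw [hK, add_mul, one_mul]
    refine (le_of_eq ?_).trans (le_add_of_nonneg_right h7)
    ring
  · have hE4' : ∀ᵐ x, ∀ q, ∀ P ∈ ch q, x ∈ dyadicBox o l P → ∀ B,
        ‖T (mulOn B (fun j x => b j x - starMean o l (b j) q) (starRestrict o l f q)) x -
          T (mulOn B (fun j x => b j x - starMean o l (b j) q) (starRestrict o l f P)) x‖ ≤
          Λ * (∏ j, starLux o l (f j) q) * ∏ j ∈ B, β j := by
      refine ae_all_iff.2 fun q => (ae_ball_iff (to_countable _)).2 fun P hP => ?_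
      exact hE4 q P (h1 q P hP) (h5 q P hP)
    filter_upwards [hac.ae_le hshift, hac.ae_le hE4'] with x hx hx' q P hP s hxP
    have hxq : x ∈ t.leaves (s + 1) q := mem_iUnion₂.2 ⟨P, hP, hxP⟩
    have hs : (1 : ℝ) ≤ (s : ℝ) + 2 := by
      have : (0 : ℝ) ≤ s := by positivity
      linarith
    -- A leaf of height `s` below the child has height `s + 1` below `q`, where the symbols deviate
    -- by at most `2 * c * (s + 2) * β j`. The `m` symbols together produce the power `m`.
    have h6 := norm_iteratedCommutator_sub_le (T := T) (D := 2 * c * ((s : ℝ) + 2))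
      (by nlinarith) hβ0 (fun j => by
        have := hleaf j (s + 1) q x hxq
        push_cast at this
        rwa [add_assoc, one_add_one_eq_two] at this) (hx' q P hP (t.leaves_subset_box _ _ hxP))
    rw [hx q q, hx q P]
    refine (norm_le_insert' _ _).trans (add_le_add le_rfl (h6.trans ?_))
    have h7 := mul_nonneg (mul_nonneg hβp (hL0 q)) (show 0 ≤ ((s : ℝ) + 2) ^ m by positivity)
    rw [hK, add_mul, add_mul, one_mul, mul_pow (2 * c)]
    refine (le_of_eq ?_).trans (le_add_of_nonneg_right h7)
    ring

end

section

variable {n m : ℕ} {𝕜 : Type*} [RCLike 𝕜]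

/-! ### From distributional estimates to integrals -/

/-- Geometric decay beats every polynomial factor; this makes both final constants finite. -/
theorem tsum_mul_pow_ne_top {θ : ℝ≥0} (hθ : θ < 1) (k : ℕ) :
    ∑' s : ℕ, (θ : ℝ≥0∞) ^ s * ENNReal.ofReal (((s : ℝ) + 1) ^ k) ≠ ∞ := by
  have h1 : Summable fun s : ℕ => ((s : ℝ) + 1) ^ k * (θ : ℝ) ^ s := by
    rcases eq_or_ne θ 0 with rfl | h0
    · refine summable_of_ne_finset_zero (s := {0}) fun s hs => ?_
      have : s ≠ 0 := by simpa using hs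
      simp [this]
    · have h2 := (summable_nat_add_iff 1).2 (summable_pow_mul_geometric_of_norm_lt_one (R := ℝ) k
        (r := θ) (by simpa using hθ))
      refine (h2.mul_left (θ : ℝ)⁻¹).congr fun s => ?_
      have : (θ : ℝ) ≠ 0 := by exact_mod_cast h0
      rw [pow_succ]
      push_cast
      field_simp
  have h3 : ∀ s : ℕ, (θ : ℝ≥0∞) ^ s * ENNReal.ofReal (((s : ℝ) + 1) ^ k) =
      ENNReal.ofReal (((s : ℝ) + 1) ^ k * (θ : ℝ) ^ s) := by
    intro s
    rw [mul_comm, ENNReal.ofReal_mul (by positivity), ENNReal.ofReal_pow (p := (θ : ℝ)) θ.coe_nonneg,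
      ENNReal.ofReal_coe_nnreal]
  simp_rw [h3]
  rw [← ENNReal.ofReal_tsum_of_nonneg (fun s => by positivity) h1]
  exact ENNReal.ofReal_ne_top

/-- Layer-cake formula on both sides: rescaling the level by `γ s` costs the factor `γ s ^ p`. -/
theorem lintegral_rpow_le_of_measure_lt_le {X : Type*} [MeasurableSpace X] {μ ν : Measure X}
    {F G : X → ℝ} (hF0 : ∀ x, 0 ≤ F x) (hF : AEMeasurable F ν) (hG0 : ∀ x, 0 ≤ G x)
    (hG : AEMeasurable G μ) {γ : ℕ → ℝ} (hγ : ∀ s, 0 < γ s) {θ : ℕ → ℝ≥0∞}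
    (h : ∀ r, 0 ≤ r → ν {x | r < F x} ≤ ∑' s, θ s * μ {x | (γ s)⁻¹ * r < G x}) {p : ℝ}
    (hp : 0 < p) :
    ∫⁻ x, ENNReal.ofReal (F x ^ p) ∂ν ≤
      (∑' s, θ s * ENNReal.ofReal (γ s ^ p)) * ∫⁻ x, ENNReal.ofReal (G x ^ p) ∂μ := by
  have hset : ∀ s r, {x | (γ s)⁻¹ * r < G x} = {x | r < γ s * G x} := by
    intro s r
    ext x
    rw [mem_ofPred_eq, mem_ofPred_eq, inv_mul_lt_iff₀ (hγ s)]
  have hmeas : ∀ s, Measurable fun t : ℝ => μ {x | t < γ s * G x} * ENNReal.ofReal (t ^ (p - 1)) := by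
    intro s
    have h1 : Antitone fun t : ℝ => μ {x | t < γ s * G x} :=
      fun t t' htt' => measure_mono fun x hx => htt'.trans_lt hx
    have h2 : Measurable fun t : ℝ => μ {x | t < γ s * G x} := h1.measurable
    exact h2.mul (by fun_prop)
  have hs : ∀ s, ∫⁻ x, ENNReal.ofReal ((γ s * G x) ^ p) ∂μ =
      ENNReal.ofReal (γ s ^ p) * ∫⁻ x, ENNReal.ofReal (G x ^ p) ∂μ := by
    intro s
    rw [← lintegral_const_mul' _ _ ENNReal.ofReal_ne_top]
    refine lintegral_congr fun x => ?_
    rw [Real.mul_rpow (hγ s).le (hG0 x), ENNReal.ofReal_mul (Real.rpow_nonneg (hγ s).le _)]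
  rw [lintegral_rpow_eq_lintegral_meas_lt_mul ν (Filter.Eventually.of_forall hF0) hF hp]
  calc _ ≤ ENNReal.ofReal p * ∫⁻ t in Ioi (0 : ℝ), ∑' s, θ s * (μ {x | t < γ s * G x} *
          ENNReal.ofReal (t ^ (p - 1))) := by
        refine mul_le_mul_right (setLIntegral_mono' measurableSet_Ioi fun t ht => ?_) _
        simp_rw [← mul_assoc]
        rw [ENNReal.tsum_mul_right]
        refine mul_le_mul_left ?_ _
        simpa only [hset] using h t (le_of_lt ht)
    _ = ∑' s, θ s * (ENNReal.ofReal p * ∫⁻ t in Ioi (0 : ℝ), μ {x | t < γ s * G x} *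
          ENNReal.ofReal (t ^ (p - 1))) := by
        rw [lintegral_tsum fun s => ((hmeas s).const_mul _).aemeasurable, ← ENNReal.tsum_mul_left]
        refine tsum_congr fun s => ?_
        rw [lintegral_const_mul _ (hmeas s)]
        ring
    _ = ∑' s, θ s * ENNReal.ofReal (γ s ^ p) * ∫⁻ x, ENNReal.ofReal (G x ^ p) ∂μ := by
        refine tsum_congr fun s => ?_
        rw [← lintegral_rpow_eq_lintegral_meas_lt_mul μ (Filter.Eventually.of_forall fun x =>
          mul_nonneg (hγ s).le (hG0 x)) (hG.const_mul _) hp, hs, mul_assoc]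
    _ = _ := ENNReal.tsum_mul_right

/-! ### The Young function -/

theorem Phi_pos {t : ℝ} (ht : 0 < t) : 0 < Phi t := by
  have : 0 ≤ max 0 (Real.log t) := le_max_left _ _
  unfold Phi
  positivity

/-- The logarithmic factor of a product is at most the product of the logarithmic factors, and `1 +
log u ≤ u`. -/
theorem Phi_mul_le {u t : ℝ} (hu : 1 ≤ u) (ht : 0 < t) : Phi (u * t) ≤ u ^ 2 * Phi t := by
  have hu0 : 0 < u := one_pos.trans_le hu
  have h1 : 1 + Real.log u ≤ u := by linarith [Real.log_le_sub_one_of_pos hu0]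
  have h2 : 0 ≤ Real.log u := Real.log_nonneg hu
  set L := max 0 (Real.log t) with hL
  have hL0 : 0 ≤ L := le_max_left _ _
  have h3 : max 0 (Real.log (u * t)) ≤ Real.log u + L := by
    rw [Real.log_mul hu0.ne' ht.ne']
    refine max_le (by positivity) ?_
    gcongr
    exact le_max_right _ _
  calc Phi (u * t) ≤ u * t * (1 + (Real.log u + L)) := by unfold Phi; gcongr
    _ ≤ u * t * ((1 + Real.log u) * (1 + L)) := by gcongr; nlinarith
    _ ≤ u * t * (u * (1 + L)) := by gcongr
    _ = u ^ 2 * Phi t := by rw [Phi, ← hL]; ring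

theorem iterate_Phi_pos (k : ℕ) {t : ℝ} (ht : 0 < t) : 0 < Phi^[k] t := by
  induction k with
  | zero => exact ht
  | succ k ih => rw [Function.iterate_succ_apply']; exact Phi_pos ih

/-- Each application of `Phi` squares the dilation factor. Only polynomial growth in `u` matters. -/
theorem iterate_Phi_mul_le (k : ℕ) {u t : ℝ} (hu : 1 ≤ u) (ht : 0 < t) :
    Phi^[k] (u * t) ≤ u ^ (2 ^ k) * Phi^[k] t := by
  have hu0 : 0 < u := one_pos.trans_le hu
  induction k with
  | zero => simp
  | succ k ih =>
    rw [Function.iterate_succ_apply', Function.iterate_succ_apply']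
    calc Phi (Phi^[k] (u * t)) ≤ Phi (u ^ 2 ^ k * Phi^[k] t) :=
          Phi_mono (iterate_Phi_pos k (by positivity)).le ih
      _ ≤ (u ^ 2 ^ k) ^ 2 * Phi (Phi^[k] t) := Phi_mul_le (one_le_pow₀ hu) (iterate_Phi_pos k ht)
      _ = _ := by rw [← pow_mul, ← pow_succ]

/-! ### The dyadic maximal function -/

theorem IsCZOperator.aestronglyMeasurable_iteratedCommutator {T : (Fin m → Rn n → 𝕜) → Rn n → 𝕜}
    (hT : IsCZOperator T) {b g : Fin m → Rn n → 𝕜} (hb : ∀ j, IsBMO (b j))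
    (hg : ∀ j, IsNice (g j)) : AEStronglyMeasurable (iteratedCommutator b T g) := by
  have h : iteratedCommutator b T g = fun x => ∑ B : Finset (Fin m),
      (-1) ^ B.card * (∏ j ∈ Bᶜ, b j x) * T (mulOn B b g) x :=
    funext fun x => iteratedCommutator_eq_sum T b g x
  rw [h]
  refine Finset.aestronglyMeasurable_fun_sum _ fun B _ => (AEStronglyMeasurable.mul ?_ ?_)
  · refine aestronglyMeasurable_const.mul (Finset.aestronglyMeasurable_fun_prod _ fun j _ => ?_)
    exact (hb j).1.aestronglyMeasurable
  · exact hT.measurable _ admissible_evenExponent _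
      (memProd_evenExponent (isNice_mulOn (fun j => (hb j).isMultiplier) hg B))

/-- The dyadic maximal function of the products of Luxemburg averages over dilated boxes. -/
noncomputable def dyadicMaxLLogL (o : Rn n) (l : ℝ) (f : Fin m → Rn n → 𝕜) (x : Rn n) : ℝ≥0∞ :=
  ⨆ P : DyadicIndex n, (dyadicBox o l P).indicator
    (fun _ => ENNReal.ofReal (∏ j, starLux o l (f j) P)) x

/-- Being a countable supremum, the dyadic function is measurable, as the layer-cake formula
requires. Measurability of `maxLLogL` is thereby never needed. -/
theorem measurable_dyadicMaxLLogL (o : Rn n) (l : ℝ) (f : Fin m → Rn n → 𝕜) :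
    Measurable (dyadicMaxLLogL o l f) :=
  Measurable.iSup fun P => measurable_const.indicator (measurableSet_dyadicBox P)

theorem dyadicMaxLLogL_le {o : Rn n} {l : ℝ} (hl : 0 < l) (f : Fin m → Rn n → 𝕜) (x : Rn n) :
    dyadicMaxLLogL o l f x ≤ maxLLogL f x := by
  refine iSup_le fun P => indicator_apply_le' (fun hx => ?_) fun _ => zero_le
  rw [ENNReal.ofReal_prod_of_nonneg (f := fun j => starLux o l (f j) P)
    fun j _ => ENNReal.toReal_nonneg]
  calc _ ≤ ∏ j, luxemburg (f j) (starCorner o l P) (starSide l P) :=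
        Finset.prod_le_prod' fun j _ => ENNReal.ofReal_toReal_le
    _ ≤ maxLLogL f x := le_iSup₂_of_le (starCorner o l P) (starSide l P) <|
        le_iSup₂_of_le (f := fun _ _ => ∏ j, luxemburg (f j) (starCorner o l P) (starSide l P))
          (starSide_pos hl P) (dyadicBox_subset_starCube hl P hx) le_rfl

theorem BddCompactSupp.maxLLogL_lt_top {f : Fin m → Rn n → 𝕜} (hf : BddCompactSupp f) (x : Rn n) :
    maxLLogL f x < ∞ := by
  choose B hB using hf.exists_luxemburg_le
  calc maxLLogL f x ≤ ∏ j, ENNReal.ofReal (B j) :=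
        iSup₂_le fun a l => iSup₂_le fun hl _ => Finset.prod_le_prod' fun j _ => hB j a l hl
    _ < ∞ := ENNReal.prod_lt_top fun j _ => ENNReal.ofReal_lt_top

theorem BddCompactSupp.prod_starLux_le {f : Fin m → Rn n → 𝕜} (hf : BddCompactSupp f) {o : Rn n}
    {l : ℝ} (hl : 0 < l) {P : DyadicIndex n} {x : Rn n} (hx : x ∈ dyadicBox o l P) :
    ∏ j, starLux o l (f j) P ≤ (dyadicMaxLLogL o l f x).toReal := by
  rw [← ENNReal.ofReal_le_iff_le_toReal ((dyadicMaxLLogL_le hl f x).trans_lt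
    (hf.maxLLogL_lt_top x)).ne]
  exact le_iSup_of_le P (by rw [indicator_of_mem hx])

/-- The distributional estimate for the iterated commutator, on a cube containing the supports. -/
theorem IsCZOperator.exists_weightMeasure_cube_lt_le {T : (Fin m → Rn n → 𝕜) → Rn n → 𝕜}
    (hT : IsCZOperator T) (hn : 0 < n) (hm : 0 < m) {w : Rn n → ℝ} (hw : IsAInfty w) :
    ∃ (K : ℝ) (θ : ℝ≥0), 0 < K ∧ θ < 1 ∧ ∀ b : Fin m → Rn n → 𝕜, (∀ j, IsBMO (b j)) →
      ∀ f : Fin m → Rn n → 𝕜, BddCompactSupp f → ∀ (o : Rn n) (l : ℝ), 0 < l →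
      (∀ j, tsupport (f j) ⊆ cube o l) → ∀ r : ℝ, 0 ≤ r →
        (weightMeasure w).restrict (cube o l) {x | r < K⁻¹ * ‖iteratedCommutator b T f x‖} ≤
        ∑' s : ℕ, (θ : ℝ≥0∞) ^ s * weightMeasure w {x | (((s : ℝ) + 1) ^ (m + 2))⁻¹ * r <
            (∏ j, (bmoNorm (b j)).toReal) * (dyadicMaxLLogL o l f x).toReal} := by
  obtain ⟨K, θ, hK, hθ, h⟩ := hT.exists_weightMeasure_lt_le hn hm hw
  refine ⟨2 * K, θ, by positivity, hθ, fun b hb f hf o l hl hfs r hr => ?_⟩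
  have hroot : dyadicBox o l (dyadicRoot n) =ᵐ[volume] cube o l := by
    simpa only [dyadicCorner_root, dyadicSide_root] using dyadicBox_ae_eq_cube (o := o) hl
      (dyadicRoot n)
  -- The supports lie in the root cube, so restriction to its dilate does nothing and the estimate
  -- concerns the full commutator.
  have hfr : starRestrict o l f (dyadicRoot n) = f := by
    ext1 j
    rw [starRestrict, indicator_eq_self]
    refine (subset_tsupport _).trans ((hfs j).trans ?_)
    simpa only [dyadicCorner_root, dyadicSide_root] using
      cube_subset_starCube (o := o) hl (dyadicRoot n)
  have h1 := h b hb f hf o l hl (dyadicRoot n) r hr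
  rw [hfr] at h1
  have h2 : {x | r < (2 * K)⁻¹ * ‖iteratedCommutator b T f x‖} =
      {x | 2 * K * r < ‖iteratedCommutator b T f x‖} := by
    ext x
    rw [mem_ofPred_eq, mem_ofPred_eq, lt_inv_mul_iff₀ (by positivity)]
  rw [h2, Measure.restrict_apply' (measurableSet_cube _ _), inter_comm]
  have h3 : weightMeasure w (cube o l ∩ {x | 2 * K * r < ‖iteratedCommutator b T f x‖}) =
      weightMeasure w (dyadicBox o l (dyadicRoot n) ∩
        {x | 2 * K * r < ‖iteratedCommutator b T f x‖}) :=
    measure_congr (((weightMeasure_absolutelyContinuous w).ae_eq hroot).symm.inter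
      Filter.EventuallyEq.rfl)
  rw [h3]
  refine h1.trans (ENNReal.tsum_le_tsum fun s => mul_le_mul_right (measure_mono ?_) _)
  rintro x ⟨-, P, hxP, hx⟩
  exact hx.trans_le (mul_le_mul_of_nonneg_left (hf.prod_starLux_le hl hxP)
    (Finset.prod_nonneg fun j _ => ENNReal.toReal_nonneg))

end

section

variable {n m : ℕ} {𝕜 : Type*} [RCLike 𝕜]

/-! ### Exhaustion by cubes -/

/-- The cubes centered at the origin. -/
def centeredCube (n N : ℕ) : Set (Rn n) :=
  cube (WithLp.toLp 2 fun _ => -((N : ℝ) + 1)) (2 * (N + 1))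

theorem monotone_centeredCube (n : ℕ) : Monotone (centeredCube n) := by
  intro N M hNM x hx i
  have h1 := hx i
  have h2 : (N : ℝ) ≤ M := by exact_mod_cast hNM
  simp only at h1 ⊢
  constructor <;> linarith [h1.1, h1.2]

theorem iUnion_centeredCube_add (n N : ℕ) : ⋃ k, centeredCube n (N + k) = univ := by
  refine eq_univ_of_forall fun x => ?_
  obtain ⟨M, hM⟩ := exists_subset_cube_of_isCompact (isCompact_singleton (x := x))
  exact mem_iUnion.2 ⟨M, hM (N + M) (by omega) rfl⟩

theorem BddCompactSupp.exists_subset_centeredCube {f : Fin m → Rn n → 𝕜} (hf : BddCompactSupp f) :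
    ∃ N, ∀ k j, tsupport (f j) ⊆ centeredCube n (N + k) := by
  obtain ⟨N, hN⟩ := exists_subset_cube_of_isCompact (isCompact_iUnion fun j => (hf j).2.isCompact)
  exact ⟨N, fun k j => (subset_iUnion (fun j => tsupport (f j)) j).trans (hN (N + k) (by omega))⟩

/-- The estimates on cubes have constants independent of the cube, so monotone exhaustion extends
them to the whole space. -/
theorem lintegral_le_of_forall_centeredCube {μ : Measure (Rn n)} {g : Rn n → ℝ≥0∞} {c : ℝ≥0∞}
    (N : ℕ) (h : ∀ k, ∫⁻ x in centeredCube n (N + k), g x ∂μ ≤ c) : ∫⁻ x, g x ∂μ ≤ c := by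
  have hmono : Monotone fun k => centeredCube n (N + k) :=
    fun k k' hk => monotone_centeredCube n (by omega)
  rw [← setLIntegral_univ, ← iUnion_centeredCube_add n N,
    setLIntegral_iUnion_of_directed _ hmono.directed_le]
  exact iSup_le h

theorem measure_le_of_forall_centeredCube {μ : Measure (Rn n)} {S : Set (Rn n)} {c : ℝ≥0∞}
    (N : ℕ) (h : ∀ k, μ.restrict (centeredCube n (N + k)) S ≤ c) : μ S ≤ c := by
  have hmono : Monotone fun k => S ∩ centeredCube n (N + k) :=
    fun k k' hk => inter_subset_inter_right _ (monotone_centeredCube n (by omega))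
  rw [← inter_univ S, ← iUnion_centeredCube_add n N, inter_iUnion, hmono.measure_iUnion]
  refine iSup_le fun k => ?_
  have h1 := h k
  rwa [Measure.restrict_apply' (s := centeredCube n (N + k)) (measurableSet_cube _ _)] at h1

/-! ### The two inequalities -/

theorem IsCZOperator.exists_lintegral_iteratedCommutator_rpow_le
    {T : (Fin m → Rn n → 𝕜) → Rn n → 𝕜} (hT : IsCZOperator T) (hn : 0 < n) (hm : 0 < m)
    {w : Rn n → ℝ} (hw : IsAInfty w) {p : ℝ} (hp : 0 < p) : ∃ C : ℝ≥0, ∀ b : Fin m → Rn n → 𝕜,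
      (∀ j, IsBMO (b j)) → ∀ f : Fin m → Rn n → 𝕜, BddCompactSupp f →
        (∫⁻ x, ‖iteratedCommutator b T f x‖ₑ ^ p ∂(weightMeasure w)) ≤
          C * (∏ j, bmoNorm (b j)) ^ p * (∫⁻ x, maxLLogL f x ^ p ∂(weightMeasure w)) := by
  obtain ⟨K, θ, hK, hθ, h⟩ := hT.exists_weightMeasure_cube_lt_le hn hm hw
  set γ : ℕ → ℝ := fun s => ((s : ℝ) + 1) ^ (m + 2) with hγ
  set S : ℝ≥0∞ := ∑' s : ℕ, (θ : ℝ≥0∞) ^ s * ENNReal.ofReal (γ s ^ p) with hS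
  have hSfin : S ≠ ∞ := by
    -- Since `γ s ≥ 1`, rounding `p` up to an integer only enlarges the series.
    obtain ⟨k, hk⟩ := exists_nat_ge p
    refine ne_top_of_le_ne_top (tsum_mul_pow_ne_top hθ ((m + 2) * k)) (ENNReal.tsum_le_tsum
      fun s => mul_le_mul_right (ENNReal.ofReal_le_ofReal ?_) _)
    have h1 : (1 : ℝ) ≤ γ s := one_le_pow₀ (by linarith [show (0 : ℝ) ≤ s by positivity])
    calc γ s ^ p ≤ γ s ^ (k : ℝ) := Real.rpow_le_rpow_of_exponent_le h1 hk
      _ = _ := by rw [Real.rpow_natCast, hγ, ← pow_mul]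
  have hKfin : ENNReal.ofReal K ^ p ≠ ∞ := ENNReal.rpow_ne_top_of_nonneg hp.le ENNReal.ofReal_ne_top
  refine ⟨(ENNReal.ofReal K ^ p * S).toNNReal, fun b hb f hf => ?_⟩
  rw [ENNReal.coe_toNNReal (ENNReal.mul_ne_top hKfin hSfin)]
  obtain ⟨N, hN⟩ := hf.exists_subset_centeredCube
  refine lintegral_le_of_forall_centeredCube N fun k => ?_
  set o : Rn n := WithLp.toLp 2 fun _ => -(((N + k : ℕ) : ℝ) + 1) with ho
  set l : ℝ := 2 * (((N + k : ℕ) : ℝ) + 1) with hl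
  have hl0 : 0 < l := by positivity
  have hβ : ENNReal.ofReal (∏ j, (bmoNorm (b j)).toReal) = ∏ j, bmoNorm (b j) := by
    rw [ENNReal.ofReal_prod_of_nonneg fun j _ => ENNReal.toReal_nonneg]
    exact Finset.prod_congr rfl fun j _ => ENNReal.ofReal_toReal (hb j).2.ne
  have hβ0 : 0 ≤ ∏ j, (bmoNorm (b j)).toReal := Finset.prod_nonneg fun j _ => ENNReal.toReal_nonneg
  have hFm : AEStronglyMeasurable (iteratedCommutator b T f) (weightMeasure w) :=
    (hT.aestronglyMeasurable_iteratedCommutator hb hf.isNice).mono_ac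
      (weightMeasure_absolutelyContinuous w)
  have hmain := lintegral_rpow_le_of_measure_lt_le
    (F := fun x => K⁻¹ * ‖iteratedCommutator b T f x‖)
    (G := fun x => (∏ j, (bmoNorm (b j)).toReal) * (dyadicMaxLLogL o l f x).toReal)
    (fun x => by positivity) (hFm.norm.aemeasurable.const_mul _).restrict
    (fun x => mul_nonneg hβ0 ENNReal.toReal_nonneg)
    ((measurable_dyadicMaxLLogL o l f).ennreal_toReal.const_mul _).aemeasurable (γ := γ)
    (fun s => by positivity) (h b hb f hf o l hl0 (hN k)) hp
  calc ∫⁻ x in centeredCube n (N + k), ‖iteratedCommutator b T f x‖ₑ ^ p ∂(weightMeasure w)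
      = ENNReal.ofReal K ^ p * ∫⁻ x in cube o l,
          ENNReal.ofReal ((K⁻¹ * ‖iteratedCommutator b T f x‖) ^ p) ∂(weightMeasure w) := by
        rw [← lintegral_const_mul' _ _ hKfin]
        refine lintegral_congr fun x => ?_
        rw [← ENNReal.ofReal_rpow_of_nonneg (by positivity) hp.le,
          ← ENNReal.mul_rpow_of_nonneg _ _ hp.le, ← ENNReal.ofReal_mul hK.le,
          mul_inv_cancel_left₀ hK.ne', ofReal_norm]
    _ ≤ ENNReal.ofReal K ^ p * (S * ((∏ j, bmoNorm (b j)) ^ p *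
          ∫⁻ x, maxLLogL f x ^ p ∂(weightMeasure w))) := by
        refine mul_le_mul_right (hmain.trans (mul_le_mul_right ?_ _)) _
        rw [← lintegral_const_mul' _ _ (ENNReal.rpow_ne_top_of_nonneg hp.le
          (hβ ▸ ENNReal.ofReal_ne_top))]
        refine lintegral_mono fun x => ?_
        rw [← ENNReal.ofReal_rpow_of_nonneg (mul_nonneg hβ0 ENNReal.toReal_nonneg) hp.le,
          ENNReal.ofReal_mul hβ0, hβ, ENNReal.mul_rpow_of_nonneg _ _ hp.le]
        gcongr
        exact ENNReal.ofReal_toReal_le.trans (dyadicMaxLLogL_le hl0 f x)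
    _ = _ := by ring

theorem IsCZOperator.exists_iSup_weightMeasure_iteratedCommutator_le
    {T : (Fin m → Rn n → 𝕜) → Rn n → 𝕜} (hT : IsCZOperator T) (hn : 0 < n) (hm : 0 < m)
    {w : Rn n → ℝ} (hw : IsAInfty w) {b : Fin m → Rn n → 𝕜} (hb : ∀ j, IsBMO (b j)) :
    ∃ c : ℝ≥0, ∀ f : Fin m → Rn n → 𝕜, BddCompactSupp f →
      (⨆ (t : ℝ) (_ : 0 < t), ENNReal.ofReal (1 / Phi^[m] (1 / t)) *
          weightMeasure w {y | t ^ m < ‖iteratedCommutator b T f y‖}) ≤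
        c * (⨆ (t : ℝ) (_ : 0 < t), ENNReal.ofReal (1 / Phi^[m] (1 / t)) *
          weightMeasure w {y | ENNReal.ofReal (t ^ m) < maxLLogL f y}) := by
  obtain ⟨K, θ, hK, hθ, h⟩ := hT.exists_weightMeasure_cube_lt_le hn hm hw
  set β : ℝ := ∏ j, (bmoNorm (b j)).toReal with hβ
  have hβ0 : 0 ≤ β := Finset.prod_nonneg fun j _ => ENNReal.toReal_nonneg
  -- The dilation factor must be at least one for the growth bound of `Phi^[m]`. The dependence of
  -- the constant on the symbols enters here.
  set U : ℝ := 1 + K * β with hU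
  have hU1 : 1 ≤ U := le_add_of_nonneg_right (by positivity)
  have hU0 : 0 < U := one_pos.trans_le hU1
  set u : ℕ → ℝ := fun s => ((s : ℝ) + 1) ^ (m + 2) * U with hu
  have hγ1 : ∀ s : ℕ, (1 : ℝ) ≤ ((s : ℝ) + 1) ^ (m + 2) :=
    fun s => one_le_pow₀ (by linarith [show (0 : ℝ) ≤ s by positivity])
  have hu1 : ∀ s, 1 ≤ u s := fun s => one_le_mul_of_one_le_of_one_le (hγ1 s) hU1
  set S : ℝ≥0∞ := ∑' s : ℕ, (θ : ℝ≥0∞) ^ s * ENNReal.ofReal (u s ^ 2 ^ m) with hS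
  have hSfin : S ≠ ∞ := by
    have h1 : S = (∑' s : ℕ, (θ : ℝ≥0∞) ^ s *
        ENNReal.ofReal (((s : ℝ) + 1) ^ ((m + 2) * 2 ^ m))) * ENNReal.ofReal (U ^ 2 ^ m) := by
      rw [← ENNReal.tsum_mul_right]
      refine tsum_congr fun s => ?_
      rw [hu, mul_pow, ← pow_mul, ENNReal.ofReal_mul (by positivity), mul_assoc]
    rw [h1]
    exact ENNReal.mul_ne_top (tsum_mul_pow_ne_top hθ _) ENNReal.ofReal_ne_top
  refine ⟨S.toNNReal, fun f hf => ?_⟩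
  rw [ENNReal.coe_toNNReal hSfin]
  set R : ℝ≥0∞ := ⨆ (t : ℝ) (_ : 0 < t), ENNReal.ofReal (1 / Phi^[m] (1 / t)) *
    weightMeasure w {y | ENNReal.ofReal (t ^ m) < maxLLogL f y} with hR
  have hweak : ∀ t : ℝ, 0 < t → weightMeasure w {y | ENNReal.ofReal (t ^ m) < maxLLogL f y} ≤
      ENNReal.ofReal (Phi^[m] (1 / t)) * R := by
    intro t ht
    have hΦ := iterate_Phi_pos m (one_div_pos.2 ht)
    have h1 : ENNReal.ofReal (1 / Phi^[m] (1 / t)) *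
        weightMeasure w {y | ENNReal.ofReal (t ^ m) < maxLLogL f y} ≤ R :=
      le_iSup₂_of_le (f := fun t (_ : 0 < t) => ENNReal.ofReal (1 / Phi^[m] (1 / t)) *
        weightMeasure w {y | ENNReal.ofReal (t ^ m) < maxLLogL f y}) t ht le_rfl
    refine le_trans (le_of_eq ?_) (mul_le_mul_right h1 _)
    rw [← mul_assoc, ← ENNReal.ofReal_mul hΦ.le, mul_one_div_cancel hΦ.ne', ENNReal.ofReal_one,
      one_mul]
  obtain ⟨N, hN⟩ := hf.exists_subset_centeredCube
  refine iSup₂_le fun t ht => ?_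
  have hΦ := iterate_Phi_pos m (one_div_pos.2 ht)
  have hmain : weightMeasure w {y | t ^ m < ‖iteratedCommutator b T f y‖} ≤
      ∑' s : ℕ, (θ : ℝ≥0∞) ^ s *
        (ENNReal.ofReal (u s ^ 2 ^ m * Phi^[m] (1 / t)) * R) := by
    refine measure_le_of_forall_centeredCube N fun k => ?_
    have hl0 : (0 : ℝ) < 2 * (((N + k : ℕ) : ℝ) + 1) := by positivity
    set o : Rn n := WithLp.toLp 2 fun _ => -(((N + k : ℕ) : ℝ) + 1) with ho
    have h1 := h b hb f hf o _ hl0 (hN k) (K⁻¹ * t ^ m) (by positivity)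
    simp only [mul_lt_mul_iff_right₀ (inv_pos.2 hK)] at h1
    refine h1.trans (ENNReal.tsum_le_tsum fun s => mul_le_mul_right ?_ _)
    have hus : 0 < u s := one_pos.trans_le (hu1 s)
    calc _ ≤ weightMeasure w {y | ENNReal.ofReal ((t / u s) ^ m) < maxLLogL f y} := by
          refine measure_mono fun x hx => ?_
          rw [mem_ofPred_eq] at hx ⊢
          refine lt_of_lt_of_le ?_ (dyadicMaxLLogL_le (o := o) hl0 f x)
          rw [ENNReal.ofReal_lt_iff_lt_toReal (by positivity) ((dyadicMaxLLogL_le hl0 f x).trans_lt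
            (hf.maxLLogL_lt_top x)).ne]
          set M := (dyadicMaxLLogL _ _ f x).toReal with hM
          have hM0 : 0 ≤ M := ENNReal.toReal_nonneg
          rw [inv_mul_lt_iff₀ (by positivity), inv_mul_lt_iff₀ hK] at hx
          -- The level is divided by `u s ^ m`, more than the needed `u s`, so that it again has the
          -- form of an `m`-th power.
          rw [div_pow, div_lt_iff₀ (by positivity), mul_comm]
          refine hx.trans_le ?_
          calc K * (((s : ℝ) + 1) ^ (m + 2) * (β * M))
              = ((s : ℝ) + 1) ^ (m + 2) * (K * β) * M := by ring
            _ ≤ u s * M := by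
              refine mul_le_mul_of_nonneg_right (mul_le_mul_of_nonneg_left ?_ (by positivity)) hM0
              linarith
            _ ≤ u s ^ m * M := by
              gcongr
              exact le_self_pow₀ (hu1 s) hm.ne'
      _ ≤ ENNReal.ofReal (Phi^[m] (1 / (t / u s))) * R := hweak _ (by positivity)
      _ ≤ _ := by
        gcongr
        rw [one_div_div, div_eq_mul_one_div]
        exact iterate_Phi_mul_le m (hu1 s) (by positivity)
  -- The factor `Phi^[m] (1 / t)` cancels, leaving the convergent series `S`, which does not depend
  -- on `t` or `f`.
  calc _ ≤ ENNReal.ofReal (1 / Phi^[m] (1 / t)) * ∑' s : ℕ, (θ : ℝ≥0∞) ^ s *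
        (ENNReal.ofReal (u s ^ 2 ^ m * Phi^[m] (1 / t)) * R) := mul_le_mul_right hmain _
    _ = ∑' s : ℕ, (θ : ℝ≥0∞) ^ s * ENNReal.ofReal (u s ^ 2 ^ m) * R := by
      rw [← ENNReal.tsum_mul_left]
      refine tsum_congr fun s => ?_
      have hus : 0 < u s := one_pos.trans_le (hu1 s)
      rw [ENNReal.ofReal_mul (by positivity)]
      have h1 : ENNReal.ofReal (1 / Phi^[m] (1 / t)) * ENNReal.ofReal (Phi^[m] (1 / t)) = 1 := by
        rw [← ENNReal.ofReal_mul (by positivity), one_div_mul_cancel hΦ.ne', ENNReal.ofReal_one]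
      calc _ = (ENNReal.ofReal (1 / Phi^[m] (1 / t)) * ENNReal.ofReal (Phi^[m] (1 / t))) *
            ((θ : ℝ≥0∞) ^ s * ENNReal.ofReal (u s ^ 2 ^ m) * R) := by ring
        _ = _ := by rw [h1, one_mul]
    _ = S * R := ENNReal.tsum_mul_right

end

end MultiCZ

theorem theorem3p2 {𝕜 : Type*} [RCLike 𝕜] {n m : ℕ} (hn : 0 < n) (hm : 0 < m)
    (T : (Fin m → Rn n → 𝕜) → Rn n → 𝕜) (hT : IsCZOperator T)
    (w : Rn n → ℝ) (hw : IsAInfty w) :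
    (∀ p : ℝ, 0 < p → ∃ C : ℝ≥0, ∀ b : Fin m → Rn n → 𝕜, (∀ j, IsBMO (b j)) →
      ∀ f : Fin m → Rn n → 𝕜, BddCompactSupp f →
        (∫⁻ x, ‖iteratedCommutator b T f x‖ₑ ^ p ∂(weightMeasure w)) ≤
          C * (∏ j, bmoNorm (b j)) ^ p * (∫⁻ x, maxLLogL f x ^ p ∂(weightMeasure w))) ∧
    (∀ b : Fin m → Rn n → 𝕜, (∀ j, IsBMO (b j)) → ∃ c : ℝ≥0,
      ∀ f : Fin m → Rn n → 𝕜, BddCompactSupp f →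
        (⨆ (t : ℝ) (_ : 0 < t), ENNReal.ofReal (1 / Phi^[m] (1 / t)) *
            weightMeasure w {y | t ^ m < ‖iteratedCommutator b T f y‖}) ≤
          c * (⨆ (t : ℝ) (_ : 0 < t), ENNReal.ofReal (1 / Phi^[m] (1 / t)) *
            weightMeasure w {y | ENNReal.ofReal (t ^ m) < maxLLogL f y})) := by
  exact ⟨fun _ hp => hT.exists_lintegral_iteratedCommutator_rpow_le hn hm hw hp,
    fun _ hb => hT.exists_iSup_weightMeasure_iteratedCommutator_le hn hm hw hb⟩
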